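/- All manifolds, metrics, maps and hypersurfaces are of class $C^\infty$; hypersurfaces are immersed. Let $(\mathbb M^n,g)$, $n\ge 1$, be a Riemannian manifold, $I\subset\mathbb R$ an open interval, $\mathbb M^n\times I$ the Riemannian product with metric $g+dt^2$, and $\xi=\partial_t$. A hypersurface is \emph{vertical} at a point if $\xi$ is tangent to it there, \emph{horizontal} if $\xi$ is orthogonal to it there, and \emph{totally umbilical} if its shape operator (with respect to local unit normals) is a multiple of the identity at every point. A \emph{warped product structure near} $p\in\mathbb M^n$ is an isometry of $J\times_f N=(J\times N,\ dx_1^2+f(x_1)^2g_N)$ onto an open neighborhood of $p$, where $J\subset\mathbb R$ is an open interval, $f:J\to(0,\infty)$ is smooth and $(N,g_N)$ is an $(n-1)$-dimensional Riemannian manifold. Let $(p,t)\in\mathbb M^n\times I$. (1) There is a totally umbilical hypersurface of $\mathbb M^n\times I$ passing through $(p,t)$ and neither vertical nor horizontal there if and only if $\mathbb M^n$ has a warped product structure near $p$. (2) Let $\Sigma$ be a totally umbilical hypersurface that is neither vertical nor horizontal at a point $q\in\Sigma$ lying over $(p,t)$. Then there are a warped product structure $J\times_f N$ near $p$, a constant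 $c\neq0$, a sign and a curve $s\mapsto(x_0(s),x_1(s))\in I\times J$, defined on an open interval $A$, with $$x_1'(s)=\pm\sqrt{1-c^2f(x_1(s))^2}\neq0,\qquad x_0'(s)=c\,f(x_1(s)),$$ such that a neighborhood of $q$ in $\Sigma$ is parametrized diffeomorphically by $A\times N\ni(s,u)\mapsto\big((x_1(s),u),x_0(s)\big)\in(J\times_fN)\times I\subset\mathbb M^n\times I$. Conversely, for every warped product structure near $p$ and every such curve, this map is a totally umbilical immersion of $A\times N$ that is nowhere vertical and nowhere horizontal. (3) Let $n=2$. A totally umbilical surface as in (1) exists if and only if $\mathbb M^2$ admits a Killing field without zeros on some open neighborhood of $p$. Moreover, for every totally umbilical surface $\Sigma$ that is neither vertical nor horizontal at a point $q\in\Sigma$ over $(p,t)$ there are $\varepsilon>0$, open neighborhoods $W$ of $p$ in $\mathbb M^2$ and $U$ of $q$ in $\Sigma$ whose projection lies in $W$, and a smooth local one-parameter group $(\psi_s)_{|s|<\varepsilon}$ of maps defined on $W$, with $\frac{d}{ds}\big|_{s=0}\psi_s(p)\ne0$, such that the maps $\psi_s\times\mathrm{id}_I$ are injective local isometries of $\mathbb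 M^2\times I$ on $W\times I$ and leave $\Sigma$ invariant near $q$, in the sense that they lift to a smooth family of maps $\chi_s:U\to\Sigma$ with $\chi_0=\mathrm{id}$. -/

import Mathlib

open Set
open scoped Manifold ContDiff Topology

universe u v w

noncomputable section

section LeviCivita

/-- A field of (candidate) inner products on the tangent spaces of `P`. -/
abbrev MetricField {E H : Type*} [NormedAddCommGroup E] [NormedSpace ℝ E] [TopologicalSpace H]
    (IP : ModelWithCorners ℝ E H) (P : Type*) [TopologicalSpace P] [ChartedSpace H P] :=
  ∀ z : P, TangentSpace IP z → TangentSpace IP z → ℝ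

variable {E H P : Type*} [NormedAddCommGroup E] [NormedSpace ℝ E] [TopologicalSpace H]
  {IP : ModelWithCorners ℝ E H} [TopologicalSpace P] [ChartedSpace H P]
  {ES HS S : Type*} [NormedAddCommGroup ES] [NormedSpace ℝ ES] [TopologicalSpace HS]
  {IS : ModelWithCorners ℝ ES HS} [TopologicalSpace S] [ChartedSpace HS S]

/-- The coefficient `γ(a, b)` of the metric, as a function of the coordinate `y ∈ E`, in the
preferred chart around `z`, for constant coordinate vectors `a, b ∈ E`. -/
def chartMetric (γ : MetricField IP P) (z : P) (a b y : E) : ℝ :=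
  γ ((extChartAt IP z).symm y)
    (mfderiv 𝓘(ℝ, E) IP (extChartAt IP z).symm y a)
    (mfderiv 𝓘(ℝ, E) IP (extChartAt IP z).symm y b)

/-- The coordinate vector, in the preferred chart around `z`, of a tangent vector at `z'`. -/
def chartVec (IP : ModelWithCorners ℝ E H) (z : P) {z' : P} (a : TangentSpace IP z') : E :=
  mfderiv IP 𝓘(ℝ, E) (extChartAt IP z) z' a

/-- The Christoffel term (of the first kind)
`γ(Γ(a, c), b) = (∂_a γ(c, b) + ∂_c γ(a, b) - ∂_b γ(a, c)) / 2`
at `z`, in the preferred chart around `z`. -/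
def christoffel (γ : MetricField IP P) (z : P) (a c b : E) : ℝ :=
  (fderiv ℝ (chartMetric γ z c b) (extChartAt IP z z) a
    + fderiv ℝ (chartMetric γ z a b) (extChartAt IP z z) c
    - fderiv ℝ (chartMetric γ z a c) (extChartAt IP z z) b) / 2

/-- For a vector field `ν` along a map `φ : S → P`, a tangent vector `X` of `S` at `x` and a
tangent vector `b` of `P` at `φ x`: the inner product `γ(∇_X ν, b)`, where `∇` is the Levi-Civita
connection of `γ` (pulled back along `φ`), computed in the preferred chart around `φ x`. -/
def covDerivInner (IS : ModelWithCorners ℝ ES HS) (γ : MetricField IP P) (φ : S → P)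
    (ν : ∀ y : S, TangentSpace IP (φ y)) (x : S) (X : TangentSpace IS x)
    (b : TangentSpace IP (φ x)) : ℝ :=
  chartMetric γ (φ x)
      (mfderiv IS 𝓘(ℝ, E) (fun y : S => chartVec IP (φ x) (ν y)) x X)
      (chartVec IP (φ x) b) (extChartAt IP (φ x) (φ x))
    + christoffel γ (φ x) (chartVec IP (φ x) (mfderiv IS IP φ x X))
      (chartVec IP (φ x) (ν x)) (chartVec IP (φ x) b)

/-- `ν` is a smooth unit normal field along `φ` over the set `V`. -/
structure IsUnitNormalOn [IsManifold IP ∞ P] (IS : ModelWithCorners ℝ ES HS) (γ : MetricField IP P) (φ : S → P)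
    (ν : ∀ y : S, TangentSpace IP (φ y)) (V : Set S) : Prop where
  smooth : ContMDiffOn IS IP.tangent ∞ (fun y => (⟨φ y, ν y⟩ : TangentBundle IP P)) V
  unit : ∀ y ∈ V, γ (φ y) (ν y) (ν y) = 1
  normal : ∀ y ∈ V, ∀ X : TangentSpace IS y, γ (φ y) (ν y) (mfderiv IS IP φ y X) = 0

/-- The map `φ` is a smooth immersion on `U`. -/
def IsSmoothImmersionOn (IS : ModelWithCorners ℝ ES HS) (IP : ModelWithCorners ℝ E H)
    (φ : S → P) (U : Set S) : Prop :=
  ContMDiffOn IS IP ∞ φ U ∧ ∀ x ∈ U, Function.Injective (mfderiv IS IP φ x)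

/-- The hypersurface `φ` is totally umbilical on the open set `U`: every point of `U` has an open
neighbourhood with a smooth unit normal `ν` such that the shape operator
`S X = -∇_X ν` is, at every point `y`, equal to `l y` times the identity. -/
def IsTotallyUmbilicalOn [IsManifold IP ∞ P] (IS : ModelWithCorners ℝ ES HS) (γ : MetricField IP P) (φ : S → P)
    (U : Set S) : Prop :=
  ∀ x ∈ U, ∃ V : Set S, IsOpen V ∧ x ∈ V ∧ V ⊆ U ∧
    ∃ (ν : ∀ y : S, TangentSpace IP (φ y)) (l : S → ℝ), IsUnitNormalOn IS γ φ ν V ∧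
      ∀ y ∈ V, ∀ (X : TangentSpace IS y) (b : TangentSpace IP (φ y)),
        - covDerivInner IS γ φ ν y X b = l y * γ (φ y) (mfderiv IS IP φ y X) b

/-- `K` is a smooth Killing field of the metric `γ` on the open set `W`:
`γ(∇_X K, Y) + γ(∇_Y K, X) = 0`. -/
structure IsKillingOn [IsManifold IP ∞ P] (γ : MetricField IP P) (K : ∀ z : P, TangentSpace IP z) (W : Set P) :
    Prop where
  smooth : ContMDiffOn IP IP.tangent ∞ (fun z => (⟨z, K z⟩ : TangentBundle IP P)) W
  killing : ∀ z ∈ W, ∀ X Y : TangentSpace IP z,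
    covDerivInner IP γ (fun z' : P => z') K z X Y
      + covDerivInner IP γ (fun z' : P => z') K z Y X = 0

/-- `Φ`, restricted to times `|s| < ε` and to the open set `W`, is a local one-parameter group of
local isometries of `(P, γ)`. -/
structure IsLocalIsometryGroup (IP : ModelWithCorners ℝ E H) (γ : MetricField IP P) (ε : ℝ)
    (W : Set P) (Φ : ℝ → P → P) : Prop where
  pos : 0 < ε
  isOpen : IsOpen W
  smooth : ContMDiffOn (𝓘(ℝ, ℝ).prod IP) IP ∞ (fun a : ℝ × P => Φ a.1 a.2) (Ioo (-ε) ε ×ˢ W)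
  zero : ∀ z ∈ W, Φ 0 z = z
  add : ∀ s ∈ Ioo (-ε) ε, ∀ s' ∈ Ioo (-ε) ε, s + s' ∈ Ioo (-ε) ε →
    ∀ z ∈ W, Φ s' z ∈ W → Φ s (Φ s' z) = Φ (s + s') z
  injOn : ∀ s ∈ Ioo (-ε) ε, InjOn (Φ s) W
  isometry : ∀ s ∈ Ioo (-ε) ε, ∀ z ∈ W, ∀ X Y : TangentSpace IP z,
    γ (Φ s z) (mfderiv IP IP (Φ s) z X) (mfderiv IP IP (Φ s) z Y) = γ z X Y

end LeviCivita

section Product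

/-- Smooth Riemannian metrics on an `n`-dimensional manifold. -/
abbrev SmoothMetric (n : ℕ) (M : Type*) [TopologicalSpace M]
    [ChartedSpace (EuclideanSpace ℝ (Fin n)) M] [IsManifold (𝓡 n) ∞ M] :=
  Bundle.ContMDiffRiemannianMetric (𝓡 n) ∞ (EuclideanSpace ℝ (Fin n))
    (fun x : M => TangentSpace (𝓡 n) x)

variable {n : ℕ} {M : Type u} [TopologicalSpace M]
  [ChartedSpace (EuclideanSpace ℝ (Fin n)) M] [IsManifold (𝓡 n) ∞ M]

/-- A Riemannian metric as a field of inner products. -/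
def metricField (g : SmoothMetric n M) : MetricField (𝓡 n) M := fun x v w => g.inner x v w

/-- The Riemannian product metric `g + dt²` on `M × ℝ`. -/
def prodMetric (g : SmoothMetric n M) : MetricField ((𝓡 n).prod 𝓘(ℝ, ℝ)) (M × ℝ) :=
  fun z v w => g.inner z.1 v.1 w.1 + v.2 * w.2

/-- The unit field `ξ = ∂_t` on `M × ℝ`. -/
def unitField (z : M × ℝ) : TangentSpace ((𝓡 n).prod 𝓘(ℝ, ℝ)) z :=
  ((0 : EuclideanSpace ℝ (Fin n)), (1 : ℝ))

/-- The warped product metric `dx₁² + f(x₁)² gN` on `ℝ × N`. -/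
def warpedMetric {k : ℕ} {N : Type w} [TopologicalSpace N]
    [ChartedSpace (EuclideanSpace ℝ (Fin k)) N] [IsManifold (𝓡 k) ∞ N]
    (f : ℝ → ℝ) (gN : SmoothMetric k N) : MetricField (𝓘(ℝ, ℝ).prod (𝓡 k)) (ℝ × N) :=
  fun z v w => v.1 * w.1 + f z.1 ^ 2 * gN.inner z.2 v.2 w.2

variable {ES HS S : Type*} [NormedAddCommGroup ES] [NormedSpace ℝ ES] [TopologicalSpace HS]
  [TopologicalSpace S] [ChartedSpace HS S]

/-- The hypersurface `φ` is vertical at `x`: the field `ξ` is tangent to it. -/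
def IsVerticalAt (n : ℕ) {M : Type u} [TopologicalSpace M]
    [ChartedSpace (EuclideanSpace ℝ (Fin n)) M] (IS : ModelWithCorners ℝ ES HS) (φ : S → M × ℝ) (x : S) : Prop :=
  ∃ X : TangentSpace IS x, mfderiv IS ((𝓡 n).prod 𝓘(ℝ, ℝ)) φ x X = unitField (φ x)

/-- The hypersurface `φ` is horizontal at `x`: the field `ξ` is orthogonal to it. -/
def IsHorizontalAt (IS : ModelWithCorners ℝ ES HS) (g : SmoothMetric n M) (φ : S → M × ℝ)
    (x : S) : Prop :=
  ∀ X : TangentSpace IS x,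
    prodMetric g (φ x) (unitField (φ x)) (mfderiv IS ((𝓡 n).prod 𝓘(ℝ, ℝ)) φ x X) = 0

/-- A smooth immersed hypersurface of `M × I`, where `I` is an open interval: an `n`-manifold with
a smooth immersion into `M × ℝ` whose image lies in the open submanifold `M × I`. -/
structure Hypersurface (n : ℕ) (M : Type u) [TopologicalSpace M]
    [ChartedSpace (EuclideanSpace ℝ (Fin n)) M] (I : Set ℝ) where
  carrier : Type v
  [top : TopologicalSpace carrier]
  [t2 : T2Space carrier]
  [secondCountable : SecondCountableTopology carrier]
  [charted : ChartedSpace (EuclideanSpace ℝ (Fin n)) carrier]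
  [manifold : IsManifold (𝓡 n) ∞ carrier]
  map : carrier → M × ℝ
  mem : ∀ x, (map x).2 ∈ I
  immersion : IsSmoothImmersionOn (𝓡 n) ((𝓡 n).prod 𝓘(ℝ, ℝ)) map univ

attribute [instance] Hypersurface.top Hypersurface.t2 Hypersurface.secondCountable
  Hypersurface.charted Hypersurface.manifold

/-- The hypersurface is totally umbilical in the Riemannian product. -/
def Hypersurface.IsTotallyUmbilical {I : Set ℝ} (F : Hypersurface.{u, v} n M I)
    (g : SmoothMetric n M) : Prop :=
  IsTotallyUmbilicalOn (𝓡 n) (prodMetric g) F.map univ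

/-- `q` is a point of the hypersurface over `(p, t)` where it is neither vertical nor
horizontal. -/
def Hypersurface.IsObliqueAt {I : Set ℝ} (F : Hypersurface.{u, v} n M I)
    (g : SmoothMetric n M) (q : F.carrier) (p : M) (t : ℝ) : Prop :=
  F.map q = (p, t) ∧ ¬ IsVerticalAt n (𝓡 n) F.map q ∧ ¬ IsHorizontalAt (𝓡 n) g F.map q

/-- A warped product structure `J ×_f N` on an open neighbourhood of `p` in `(M, g)`: an open
interval `J`, an `(n-1)`-dimensional Riemannian manifold `(N, gN)`, a smooth positive function `f`
on `J`, and an isometry of `(J × N, dx₁² + f(x₁)² gN)` onto an open neighbourhood of `p`. -/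
structure WarpedProductNear (g : SmoothMetric n M) (p : M) where
  N : Type w
  [top : TopologicalSpace N]
  [t2 : T2Space N]
  [secondCountable : SecondCountableTopology N]
  [charted : ChartedSpace (EuclideanSpace ℝ (Fin (n - 1))) N]
  [manifold : IsManifold (𝓡 (n - 1)) ∞ N]
  gN : SmoothMetric (n - 1) N
  J : Set ℝ
  isOpen_J : IsOpen J
  ordConnected_J : J.OrdConnected
  f : ℝ → ℝ
  smooth_f : ContDiffOn ℝ ∞ f J
  pos_f : ∀ r ∈ J, 0 < f r
  Ψ : OpenPartialHomeomorph (ℝ × N) M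
  source_eq : Ψ.source = J ×ˢ univ
  mem_target : p ∈ Ψ.target
  smooth : ContMDiffOn (𝓘(ℝ, ℝ).prod (𝓡 (n - 1))) (𝓡 n) ∞ Ψ Ψ.source
  smooth_symm : ContMDiffOn (𝓡 n) (𝓘(ℝ, ℝ).prod (𝓡 (n - 1))) ∞ Ψ.symm Ψ.target
  isometry : ∀ z ∈ Ψ.source, ∀ X Y : TangentSpace (𝓘(ℝ, ℝ).prod (𝓡 (n - 1))) z,
    g.inner (Ψ z) (mfderiv (𝓘(ℝ, ℝ).prod (𝓡 (n - 1))) (𝓡 n) Ψ z X)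
      (mfderiv (𝓘(ℝ, ℝ).prod (𝓡 (n - 1))) (𝓡 n) Ψ z Y) = warpedMetric f gN z X Y

attribute [instance] WarpedProductNear.top WarpedProductNear.t2
  WarpedProductNear.secondCountable WarpedProductNear.charted WarpedProductNear.manifold

/-- `s ↦ (x₀ s, x₁ s)`, for `s` in the open interval `A`, is a curve in `I × J` with
`x₁' = σ √(1 - c² f(x₁)²) ≠ 0`, where `σ = ±1`, and `x₀' = c f(x₁) ≠ 0`. -/
structure IsProfileCurve (I J : Set ℝ) (f : ℝ → ℝ) (c σ : ℝ) (A : Set ℝ) (x₀ x₁ : ℝ → ℝ) :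
    Prop where
  c_ne : c ≠ 0
  sign : σ = 1 ∨ σ = -1
  isOpen : IsOpen A
  ordConnected : A.OrdConnected
  mapsTo₀ : MapsTo x₀ A I
  mapsTo₁ : MapsTo x₁ A J
  lt_one : ∀ s ∈ A, c ^ 2 * f (x₁ s) ^ 2 < 1
  deriv₀ : ∀ s ∈ A, HasDerivAt x₀ (c * f (x₁ s)) s
  deriv₁ : ∀ s ∈ A, HasDerivAt x₁ (σ * √(1 - c ^ 2 * f (x₁ s) ^ 2)) s

/-- The hypersurface `(s, u) ↦ ((x₁ s, u), x₀ s)` of `M × ℝ` generated by a curve, where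
`J ×_f N` is regarded as an open subset of `M`. -/
def WarpedProductNear.generated {g : SmoothMetric n M} {p : M}
    (W : WarpedProductNear.{u, w} g p) (x₀ x₁ : ℝ → ℝ) (a : ℝ × W.N) : M × ℝ :=
  (W.Ψ (x₁ a.1, a.2), x₀ a.1)

/-- Near `q`, the hypersurface `F` is the one generated by the curve `(x₀, x₁)` over `A`: some
diffeomorphism of `A × N` onto an open neighbourhood of `q` carries `F` to it. -/
def Hypersurface.IsGeneratedNear {I : Set ℝ} (F : Hypersurface.{u, v} n M I) (q : F.carrier)
    {g : SmoothMetric n M} {p : M} (W : WarpedProductNear.{u, w} g p) (A : Set ℝ)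
    (x₀ x₁ : ℝ → ℝ) : Prop :=
  ∃ χ : OpenPartialHomeomorph (ℝ × W.N) F.carrier, χ.source = A ×ˢ univ ∧ q ∈ χ.target ∧
    ContMDiffOn (𝓘(ℝ, ℝ).prod (𝓡 (n - 1))) (𝓡 n) ∞ χ χ.source ∧
    ContMDiffOn (𝓡 n) (𝓘(ℝ, ℝ).prod (𝓡 (n - 1))) ∞ χ.symm χ.target ∧
    ∀ a ∈ χ.source, F.map (χ a) = W.generated x₀ x₁ a

/-- Near `q`, a point over `(p, t)`, the hypersurface `F` is invariant under a nontrivial local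
one-parameter group of local isometries of `M × I` of the form `(z, r) ↦ (ψ_s z, r)`: the group
moves `p` with nonzero velocity, and it lifts to a local flow `χ` on `F` near `q`. -/
def Hypersurface.IsInvariantNear {I : Set ℝ} (F : Hypersurface.{u, v} n M I)
    (g : SmoothMetric n M) (q : F.carrier) (p : M) : Prop :=
  ∃ (ε : ℝ) (W : Set M) (ψ : ℝ → M → M),
    IsLocalIsometryGroup ((𝓡 n).prod 𝓘(ℝ, ℝ)) (prodMetric g) ε (W ×ˢ I)
      (fun s z => (ψ s z.1, z.2)) ∧
    IsOpen W ∧ p ∈ W ∧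
    mfderiv 𝓘(ℝ, ℝ) (𝓡 n) (fun s => ψ s p) 0 (1 : ℝ) ≠ 0 ∧
    ∃ (U : Set F.carrier) (χ : ℝ → F.carrier → F.carrier), IsOpen U ∧ q ∈ U ∧
      (∀ x ∈ U, (F.map x).1 ∈ W) ∧
      ContMDiffOn (𝓘(ℝ, ℝ).prod (𝓡 n)) (𝓡 n) ∞ (fun a : ℝ × F.carrier => χ a.1 a.2)
        (Ioo (-ε) ε ×ˢ U) ∧
      (∀ x ∈ U, χ 0 x = x) ∧
      ∀ s ∈ Ioo (-ε) ε, ∀ x ∈ U, F.map (χ s x) = (ψ s (F.map x).1, (F.map x).2)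

end Product

end

/-! Near an oblique point the hypersurface is the graph of a height function `h` over the base,
because it is not vertical there. Split the unit normal as `Y + N ξ` with `Y` tangent to `M`. Since
`ξ` is parallel in the product, the base component of the umbilicity equation says that `∇_a Y` is a
multiple of `a` with a factor independent of `a`: `Y` is a closed conformal field on the base.
Orthogonality to the graph gives `Y = -N grad h`, so `N ≠ 0`, and `Y ≠ 0` where the hypersurface is
not horizontal (`exists_closedConformal_of_umbilical`).

Put `ρ = |Y|`, `T = Y / ρ`. Then `dρ = l ⟨T, ·⟩` and `∇T = (l / ρ)(id - T ⊗ T)`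
(`isUnitConformal_of_closedConformal`). The flow of `T` therefore keeps the level sets of `h`
orthogonal to `T`, carries them to sets on which `ρ` is constant, and stretches their metric like
`ρ²` (`flow_isometry`). This is a warped product with `f = ρ`. As `ρ² + N² = 1`, the height depends
on `x₁` alone, with derivative `± f / √(1 - f²)`; running through `x₁` with speed `√(1 - f²)` makes
`x₀' = ± f`, which is the profile equation.

Conversely, the normal `-c f ∂₁ + x₁' ξ` of a generated hypersurface has covariant derivative `-c
f'` times the differential of the map, both along the profile and along `N`
(`WarpedProductNear.isTotallyUmbilicalOn_generated`). Profile curves through a given point exist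
once `|c|` is small.

On a surface, turning a nonvanishing Killing field by a right angle gives a closed conformal field
(`exists_isUnitConformal_of_killing`). In the other direction, the coordinates `dx² + f(x)² du²` of
a closed conformal field make `∂_u` a Killing field; its flow preserves the height function and so
lifts to the hypersurface.

Two tools support this: `covDerivInner_eq`, by which covariant derivatives may be computed in any
coordinates, and `exists_smooth_flow`, the smooth dependence of solutions of an ODE on initial data.
-/

noncomputable section

/-! ### Smooth dependence of ODE solutions on time and initial value. -/

section Flow

/-- Pointwise application of a continuous family of operators to a continuous function. -/
def ContinuousMap.pointwiseApply (K : Type*) [TopologicalSpace K] [CompactSpace K] (E F : Type*)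
    [NormedAddCommGroup E] [NormedSpace ℝ E] [NormedAddCommGroup F] [NormedSpace ℝ F] :
    C(K, E →L[ℝ] F) →L[ℝ] C(K, E) →L[ℝ] C(K, F) :=
  LinearMap.mkContinuous₂
    (LinearMap.mk₂ ℝ (fun (A : C(K, E →L[ℝ] F)) (h : C(K, E)) =>
        (⟨fun k => A k (h k), by fun_prop⟩ : C(K, F)))
      (fun _ _ _ => by ext; simp) (fun _ _ _ => by ext; simp)
      (fun _ _ _ => by ext; simp) (fun _ _ _ => by ext; simp)) 1
    (fun A h => by
      rw [one_mul, ContinuousMap.norm_le _ (by positivity)]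
      intro k
      exact (A k).le_of_opNorm_le_of_le (A.norm_coe_le_norm k) (h.norm_coe_le_norm k))

/-- The image of `α` is compact, so the derivative of `T` varies by less than `ε` within one fixed
distance `δ` of every point of it. The mean value inequality then bounds the remainder at each `k`
with the same `δ`, which is the estimate in the sup norm. -/
theorem hasFDerivAt_continuousMap_comp {K : Type*} [TopologicalSpace K] [CompactSpace K]
    {E F : Type*} [NormedAddCommGroup E] [NormedSpace ℝ E] [NormedAddCommGroup F]
    [NormedSpace ℝ F] (T : C(E, F)) (T' : C(E, E →L[ℝ] F)) (h : ∀ x, HasFDerivAt T (T' x) x)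
    (α : C(K, E)) :
    HasFDerivAt (fun α : C(K, E) => T.comp α)
      (ContinuousMap.pointwiseApply K E F (T'.comp α)) α := by
  rw [hasFDerivAt_iff_isLittleO_nhds_zero, Asymptotics.isLittleO_iff]
  intro ε hε
  have hc : IsCompact (range α) := isCompact_range α.continuous
  have key := hc.uniformContinuousAt_of_continuousAt T'
    (fun a _ => T'.continuous.continuousAt) (Metric.dist_mem_uniformity hε)
  obtain ⟨δ, hδ, hd⟩ := Metric.mem_uniformity_dist.1 key
  filter_upwards [Metric.ball_mem_nhds (0 : C(K, E)) hδ] with β hβ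
  rw [ContinuousMap.norm_le _ (by positivity)]
  intro k
  have hβk : ‖β k‖ < δ := (β.norm_coe_le_norm k).trans_lt (by simpa using hβ)
  have := (convex_ball (α k) δ).norm_image_sub_le_of_norm_hasFDerivWithin_le'
    (f := T) (f' := T') (φ := T' (α k)) (C := ε) (x := α k) (y := α k + β k)
    (fun x _ => (h x).hasFDerivWithinAt)
    (fun x hx => by
      have := hd (a := α k) (b := x) (by rw [dist_comm]; exact hx) ⟨k, rfl⟩
      rw [← dist_eq_norm, dist_comm]
      exact le_of_lt this)
    (Metric.mem_ball_self hδ) (by simpa using hβk)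
  simp only [add_sub_cancel_left] at this
  refine this.trans ?_
  gcongr
  exact β.norm_coe_le_norm k

/-- The derivative of a composition operator is again a composition operator, for `fderiv ℝ T`,
followed by a bounded linear map. This allows induction on the order, over all target spaces at once
because the target changes from `F` to `E →L[ℝ] F`. -/
theorem contDiff_continuousMap_comp {K : Type*} [TopologicalSpace K] [CompactSpace K]
    {E F : Type u} [NormedAddCommGroup E] [NormedSpace ℝ E] [NormedAddCommGroup F]
    [NormedSpace ℝ F] (T : C(E, F)) (hT : ContDiff ℝ ∞ T) :
    ContDiff ℝ ∞ (fun α : C(K, E) => T.comp α) := by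
  rw [contDiff_infty]
  intro m
  induction m generalizing F with
  | zero =>
    have : Continuous (fun α : C(K, E) => T.comp α) := by fun_prop
    simpa using contDiff_zero (𝕜 := ℝ) |>.2 this
  | succ m ih =>
    have h' : ContDiff ℝ ∞ (fderiv ℝ T) := hT.fderiv_right (by norm_cast)
    refine contDiff_succ_iff_hasFDerivAt.2
      ⟨fun α => ContinuousMap.pointwiseApply K E F
        ((⟨fderiv ℝ T, h'.continuous⟩ : C(E, E →L[ℝ] F)).comp α), ?_, fun α => ?_⟩
    · exact (ContinuousMap.pointwiseApply K E F).contDiff.comp (ih ⟨fderiv ℝ T, h'.continuous⟩ h')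
    · exact hasFDerivAt_continuousMap_comp T ⟨fderiv ℝ T, h'.continuous⟩
        (fun x => (hT.differentiable (by simp) x).hasFDerivAt) α

/-- The primitive vanishing at `0` of a continuous function on `[-1, 1]`. -/
def primitiveCLM (E : Type*) [NormedAddCommGroup E] [NormedSpace ℝ E] :
    C(Icc (-1 : ℝ) 1, E) →L[ℝ] C(Icc (-1 : ℝ) 1, E) :=
  LinearMap.mkContinuous
    { toFun := fun α => ⟨fun τ => ∫ r in (0 : ℝ)..τ, IccExtend (by norm_num) α r, by
        have : Continuous (IccExtend (by norm_num : (-1 : ℝ) ≤ 1) α) := α.continuous.Icc_extend'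
        exact (intervalIntegral.continuous_primitive
          (fun a b => this.intervalIntegrable a b) 0).comp continuous_subtype_val⟩
      map_add' := fun α β => by
        ext τ
        have h (γ : C(Icc (-1 : ℝ) 1, E)) :
          Continuous (IccExtend (by norm_num : (-1 : ℝ) ≤ 1) γ) := γ.continuous.Icc_extend'
        exact intervalIntegral.integral_add ((h α).intervalIntegrable _ _)
          ((h β).intervalIntegrable _ _)
      map_smul' := fun c α => by
        ext τ
        exact intervalIntegral.integral_smul c _ }
    1 (fun α => by
      rw [one_mul, ContinuousMap.norm_le _ (by positivity)]
      intro τ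
      refine (intervalIntegral.norm_integral_le_of_norm_le_const (C := ‖α‖)
        (fun r _ => α.norm_coe_le_norm _)).trans ?_
      have : |(τ : ℝ) - 0| ≤ 1 := by rw [sub_zero]; exact abs_le.2 τ.2
      exact mul_le_of_le_one_right (norm_nonneg _) this)

theorem primitiveCLM_apply {E : Type*} [NormedAddCommGroup E] [NormedSpace ℝ E]
    (α : C(Icc (-1 : ℝ) 1, E)) (τ : Icc (-1 : ℝ) 1) :
    primitiveCLM E α τ = ∫ r in (0 : ℝ)..τ, IccExtend (by norm_num) α r := rfl

/-- Constant functions, as a continuous linear map. -/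
def constCLM (K E : Type*) [TopologicalSpace K] [CompactSpace K] [NormedAddCommGroup E]
    [NormedSpace ℝ E] : E →L[ℝ] C(K, E) :=
  LinearMap.mkContinuous
    { toFun := ContinuousMap.const K
      map_add' := fun _ _ => rfl
      map_smul' := fun _ _ => rfl } 1 (fun y => by
      rw [one_mul, ContinuousMap.norm_le _ (by positivity)]
      exact fun _ => le_rfl)

theorem constCLM_apply {K E : Type*} [TopologicalSpace K] [CompactSpace K] [NormedAddCommGroup E]
    [NormedSpace ℝ E] (y : E) (k : K) : constCLM K E y k = y := rfl

/-- The inverse function theorem, with smoothness on a whole neighbourhood. -/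
theorem exists_smooth_openPartialHomeomorph {E F : Type*} [NormedAddCommGroup E] [NormedSpace ℝ E]
    [CompleteSpace E] [NormedAddCommGroup F] [NormedSpace ℝ F] [CompleteSpace F] {f : E → F}
    {U : Set E} (hU : IsOpen U) (hf : ContDiffOn ℝ ∞ f U) {a : E} (ha : a ∈ U) (f' : E ≃L[ℝ] F)
    (hf' : HasFDerivAt f (f' : E →L[ℝ] F) a) :
    ∃ e : OpenPartialHomeomorph E F, a ∈ e.source ∧ e.source ⊆ U ∧ (∀ x, e x = f x) ∧
      ContDiffOn ℝ ∞ e.symm e.target := by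
  have hfa : ContDiffAt ℝ ∞ f a := hf.contDiffAt (hU.mem_nhds ha)
  let e₀ := hfa.toOpenPartialHomeomorph f hf' (by simp)
  have hcont : ContinuousOn (fderiv ℝ f) U := (hf.continuousOn_fderiv_of_isOpen hU (by simp))
  -- Invertibility of the derivative is an open condition. Restricting to the points where it holds
  -- makes the inverse smooth on the whole target and not only at the image of `a`.
  have hopen : IsOpen (U ∩ fderiv ℝ f ⁻¹' range ((↑) : (E ≃L[ℝ] F) → E →L[ℝ] F)) :=
    hcont.isOpen_inter_preimage hU ContinuousLinearEquiv.isOpen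
  refine ⟨e₀.restrOpen _ hopen, ⟨hfa.mem_toOpenPartialHomeomorph_source hf' (by simp), ha, f', ?_⟩,
    fun x hx => hx.2.1, fun x => rfl, ?_⟩
  · exact hf'.fderiv.symm
  · intro y hy
    have hy' := (e₀.restrOpen _ hopen).map_target hy
    obtain ⟨g', hg'⟩ := hy'.2.2
    refine ((e₀.restrOpen _ hopen).contDiffAt_symm (f₀' := g') hy ?_ ?_).contDiffWithinAt
    · have hd : DifferentiableAt ℝ f ((e₀.restrOpen _ hopen).symm y) :=
        (hf.contDiffAt (hU.mem_nhds hy'.2.1)).differentiableAt (by simp)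
      rw [hg']
      exact hd.hasFDerivAt
    · exact hf.contDiffAt (hU.mem_nhds hy'.2.1)

/-- The space of continuous curves parametrized by `[-1, 1]`. -/
abbrev CurveSpace (E : Type*) [TopologicalSpace E] := C(Icc (-1 : ℝ) 1, E)

/-- The right end point of `[-1, 1]`. -/
def rightEnd : Icc (-1 : ℝ) 1 := ⟨1, by norm_num, le_rfl⟩

/-- Rescaling time turns the flow up to time `s` into a curve on the fixed interval `[-1, 1]` with
`α(τ) = y + s ∫₀^τ T(α)`. Both `s` and `y` are now parameters of an equation in the Banach space of
curves. At `s = 0` its derivative in `α` is the identity, so the inverse function theorem solves it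
smoothly in `(s, y)`; the flow is the value of `α` at `τ = 1`. -/
theorem exists_smooth_flow_of_contDiff {E : Type u} [NormedAddCommGroup E] [NormedSpace ℝ E]
    [CompleteSpace E] {T : E → E} (hT : ContDiff ℝ ∞ T) (y₀ : E) :
    ∃ ε > 0, ∃ Φ : ℝ × E → E, ContDiffOn ℝ ∞ Φ (Ioo (-ε) ε ×ˢ Metric.ball y₀ ε) ∧
      ∀ y ∈ Metric.ball y₀ ε, Φ (0, y) = y ∧
        ∀ s ∈ Ioo (-ε) ε, HasDerivAt (fun r => Φ (r, y)) (T (Φ (s, y))) s := by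
  let Tc : C(E, E) := ⟨T, hT.continuous⟩
  let G : (ℝ × E) × CurveSpace E → (ℝ × E) × CurveSpace E := fun z =>
    (z.1, z.2 - constCLM _ E z.1.2 - z.1.1 • primitiveCLM E (Tc.comp z.2))
  have hN : ContDiff ℝ ∞ (fun α  : CurveSpace E => Tc.comp α) := contDiff_continuousMap_comp Tc hT
  have hG : ContDiff ℝ ∞ G := by
    refine contDiff_fst.prodMk ((contDiff_snd.sub
      ((constCLM (Icc (-1 : ℝ) 1) E).contDiff.comp (contDiff_snd.comp contDiff_fst))).sub ?_)
    exact (contDiff_fst.comp contDiff_fst).smul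
      ((primitiveCLM E).contDiff.comp (hN.comp contDiff_snd))
  let c₀  : CurveSpace E := constCLM _ E y₀
  let a : (ℝ × E) × CurveSpace E := ((0, y₀), c₀)
  let w₀  : CurveSpace E := primitiveCLM E (Tc.comp c₀)
  -- At `s = 0` the term containing the derivative of the composition operator drops out. What
  -- remains is a shear with the identity in both diagonal blocks, hence an isomorphism.
  let B : (ℝ × E) →L[ℝ] CurveSpace E := - ((constCLM _ E).comp (ContinuousLinearMap.snd ℝ ℝ E))
    - (ContinuousLinearMap.fst ℝ ℝ E).smulRight w₀
  let G' : ((ℝ × E) × CurveSpace E) ≃L[ℝ] ((ℝ × E) × CurveSpace E) :=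
    (ContinuousLinearEquiv.refl ℝ (ℝ × E)).skewProd (ContinuousLinearEquiv.refl ℝ (CurveSpace E)) B
  have hG' : HasFDerivAt G (G' : ((ℝ × E) × CurveSpace E) →L[ℝ] ((ℝ × E) × CurveSpace E)) a := by
    have h1 : HasFDerivAt (fun z : (ℝ × E) × CurveSpace E => z.1)
      (ContinuousLinearMap.fst ℝ (ℝ × E) (CurveSpace E)) a := hasFDerivAt_fst
    have h2 : HasFDerivAt (fun z : (ℝ × E) × CurveSpace E => z.2)
      (ContinuousLinearMap.snd ℝ (ℝ × E) (CurveSpace E)) a := hasFDerivAt_snd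
    have h3 := (constCLM (Icc (-1 : ℝ) 1) E).hasFDerivAt.comp a (hasFDerivAt_snd.comp a h1)
    have h4 : HasFDerivAt (fun z : (ℝ × E) × CurveSpace E => primitiveCLM E (Tc.comp z.2))
        (fderiv ℝ (fun z : (ℝ × E) × CurveSpace E => primitiveCLM E (Tc.comp z.2)) a) a :=
      (((primitiveCLM E).contDiff.comp (hN.comp contDiff_snd)).differentiable
        (by simp) a).hasFDerivAt
    have h0 : HasFDerivAt (fun z : (ℝ × E) × CurveSpace E => z.1.1)
      ((ContinuousLinearMap.fst ℝ ℝ E).comp (ContinuousLinearMap.fst ℝ (ℝ × E) (CurveSpace E))) a :=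
      hasFDerivAt_fst.comp a h1
    have h5 := h0.smul h4
    have h6 := h1.prodMk ((h2.sub h3).sub h5)
    refine HasFDerivAt.congr_fderiv (f := G) h6 ?_
    apply ContinuousLinearMap.ext
    intro z
    refine Prod.ext rfl ?_
    change z.2 - constCLM _ E z.1.2 - ((0 : ℝ) • _ + z.1.1 • w₀) =
      z.2 + (- constCLM _ E z.1.2 - z.1.1 • w₀)
    rw [zero_smul, zero_add]
    abel
  obtain ⟨e, hae, -, heG, hes⟩ := exists_smooth_openPartialHomeomorph isOpen_univ
    hG.contDiffOn (mem_univ a) G' hG'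
  have hGa : G a = ((0, y₀), 0) := by
    simp [G, a, c₀]
  obtain ⟨δ, hδ, hδs⟩ := Metric.isOpen_iff.1 e.open_source a hae
  let S : ℝ × E → CurveSpace E := fun q => (e.symm (q, 0)).2
  have hS0 : S (0, y₀) = c₀ := by
    have : e.symm ((0, y₀), 0) = a := by rw [← hGa, ← heG, e.left_inv hae]
    simp only [S, this]; rfl
  let Ω : Set (ℝ × E) := (fun q => (q, (0  : CurveSpace E))) ⁻¹' e.target
  have hΩ : IsOpen Ω := e.open_target.preimage (by fun_prop)
  have hΩ0 : ((0 : ℝ), y₀) ∈ Ω := by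
    change ((0, y₀), (0  : CurveSpace E)) ∈ e.target
    rw [← hGa, ← heG]; exact e.map_source hae
  have hSs : ContDiffOn ℝ ∞ S Ω :=
    contDiff_snd.comp_contDiffOn (hes.comp (contDiff_prodMk_left _).contDiffOn fun q hq => hq)
  have hSG : ∀ q ∈ Ω, S q - constCLM _ E q.2 - q.1 • primitiveCLM E (Tc.comp (S q)) = 0 := by
    intro q hq
    have h1 : G (e.symm (q, 0)) = (q, 0) := by rw [← heG, e.right_inv hq]
    have h2 : (e.symm (q, 0)).1 = q := congrArg Prod.fst h1
    have h3 := congrArg Prod.snd h1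
    simp only [G, h2] at h3
    exact h3
  -- Injectivity of the local inverse is a uniqueness statement: a solution of the integral equation
  -- close to the constant curve is the one given by `S`.
  have huniq : ∀ (q : ℝ × E) (β  : CurveSpace E), dist q (0, y₀) < δ → dist β c₀ < δ →
      β - constCLM _ E q.2 - q.1 • primitiveCLM E (Tc.comp β) = 0 → S q = β := by
    intro q β hq hβ h
    have hs : (q, β) ∈ e.source := hδs (by
      rw [Metric.mem_ball, Prod.dist_eq]; exact max_lt hq hβ)
    have : e (q, β) = (q, 0) := by rw [heG]; simp only [G, h]
    simp only [S, ← this, e.left_inv hs]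
  obtain ⟨ε', hε', hball⟩ : ∃ ε > 0, ∀ q, dist q ((0 : ℝ), y₀) < ε → q ∈ Ω ∧ dist (S q) c₀ < δ := by
    have hc : ContinuousAt S (0, y₀) := hSs.continuousOn.continuousAt (hΩ.mem_nhds hΩ0)
    have h1 := hc.eventually (Metric.ball_mem_nhds _ hδ)
    rw [hS0] at h1
    obtain ⟨ε, hε, h⟩ := Metric.eventually_nhds_iff.1 (Filter.Eventually.and (hΩ.mem_nhds hΩ0) h1)
    exact ⟨ε, hε, fun q hq => h hq⟩
  let ε := min ε' δ
  have hε : 0 < ε := lt_min hε' hδ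
  have hdist : ∀ {s : ℝ} {y : E}, s ∈ Ioo (-ε) ε → y ∈ Metric.ball y₀ ε →
      dist (s, y) ((0 : ℝ), y₀) < ε := by
    intro s y hs hy
    rw [Prod.dist_eq]
    exact max_lt (by simpa [abs_lt] using hs) hy
  -- The curve `σ ↦ S (s, y) (τ σ)` solves the equation with parameter `s τ` and is no farther from
  -- `c₀` than `S (s, y)`. By uniqueness it is `S (s τ, y)`; evaluate at `σ = 1`.
  have hscale : ∀ s ∈ Ioo (-ε) ε, ∀ y ∈ Metric.ball y₀ ε, ∀ τ : Icc (-1 : ℝ) 1,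
      S (s * τ, y) rightEnd = S (s, y) τ := by
    intro s hs y hy τ
    have hq := hball _ ((hdist hs hy).trans_le (min_le_left _ _))
    have hτ : |(τ : ℝ)| ≤ 1 := abs_le.2 τ.2
    let m : C(Icc (-1 : ℝ) 1, Icc (-1 : ℝ) 1) := ⟨fun σ => ⟨τ * σ, abs_le.1 (by
      rw [abs_mul]; exact mul_le_one₀ hτ (abs_nonneg _) (abs_le.2 σ.2))⟩, by fun_prop⟩
    have hsτ : s * τ ∈ Ioo (-ε) ε := by
      rw [mem_Ioo, ← abs_lt, abs_mul]
      exact (mul_le_of_le_one_right (abs_nonneg _) hτ).trans_lt (abs_lt.2 hs)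
    have := huniq (s * τ, y) ((S (s, y)).comp m) ((hdist hsτ hy).trans_le (min_le_right _ _)) ?_ ?_
    · rw [this]
      exact congrArg (S (s, y)) (Subtype.ext (mul_one (τ : ℝ)))
    · refine (ContinuousMap.dist_lt_iff hδ).2 fun σ => ?_
      exact (ContinuousMap.dist_apply_le_dist (f := S (s, y)) (g := c₀) (m σ)).trans_lt hq.2
    · ext σ
      have h := congrArg (fun β  : CurveSpace E => β (m σ)) (hSG _ hq.1)
      have hprim : (τ : ℝ) • ∫ r in (0 : ℝ)..σ, IccExtend (by norm_num : (-1 : ℝ) ≤ 1)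
          (Tc.comp ((S (s, y)).comp m)) r = ∫ r in (0 : ℝ)..(τ * σ),
            IccExtend (by norm_num : (-1 : ℝ) ≤ 1) (Tc.comp (S (s, y))) r := by
        have h1 := intervalIntegral.smul_integral_comp_mul_left (a := 0) (b := (σ : ℝ))
          (IccExtend (by norm_num : (-1 : ℝ) ≤ 1) (Tc.comp (S (s, y)))) (τ : ℝ)
        rw [mul_zero] at h1
        rw [← h1]
        congr 1
        refine intervalIntegral.integral_congr fun r hr => ?_
        have hr' : r ∈ Icc (-1 : ℝ) 1 :=
          (uIcc_subset_Icc (by norm_num) σ.2) hr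
        have hτr : (τ : ℝ) * r ∈ Icc (-1 : ℝ) 1 := (m ⟨r, hr'⟩).2
        rw [IccExtend_of_mem _ _ hr', IccExtend_of_mem _ _ hτr]
        rfl
      simp only [ContinuousMap.sub_apply, ContinuousMap.smul_apply, primitiveCLM_apply,
        ContinuousMap.zero_apply, constCLM_apply] at h ⊢
      rw [mul_smul, hprim]
      exact h
  refine ⟨ε, hε, fun q => S q rightEnd, ?_, fun y hy => ⟨?_, fun s hs => ?_⟩⟩
  · refine (ContinuousMap.evalCLM ℝ (rightEnd)).contDiff.comp_contDiffOn
      (hSs.mono fun (q : ℝ × E) (hq : q ∈ Ioo (-ε) ε ×ˢ Metric.ball y₀ ε) =>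
        (hball q ((hdist hq.1 hq.2).trans_le (min_le_left _ _))).1)
  · have h0 : (0 : ℝ) ∈ Ioo (-ε) ε := ⟨by linarith, hε⟩
    have := hSG _ (hball _ ((hdist h0 hy).trans_le (min_le_left _ _))).1
    simp only [zero_smul, sub_zero, sub_eq_zero] at this
    exact congrArg (fun β : CurveSpace E => β rightEnd) this
  -- With `s₁` strictly between `|s|` and `ε`, the single curve `S (s₁, y)` describes the flow at
  -- all times near `s`, and its integral formula can be differentiated.
  · let s₁ := (|s| + ε) / 2
    have hsε : |s| < ε := abs_lt.2 hs
    have hs₁ : |s| < s₁ := by simp only [s₁]; linarith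
    have hs₁0 : 0 < s₁ := (abs_nonneg s).trans_lt hs₁
    have hs₁ε : s₁ ∈ Ioo (-ε) ε := ⟨by linarith, by simp only [s₁]; linarith⟩
    have hq := hball _ ((hdist hs₁ε hy).trans_le (min_le_left _ _))
    let α  : CurveSpace E := S (s₁, y)
    have hα : ∀ r ∈ Ioo (-s₁) s₁, S (r, y) rightEnd =
        y + s₁ • ∫ r' in (0 : ℝ)..(r / s₁), IccExtend (by norm_num : (-1 : ℝ) ≤ 1) (Tc.comp α) r' := by
      intro r hr
      have hmem : r / s₁ ∈ Icc (-1 : ℝ) 1 := by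
        rw [mem_Icc, ← abs_le, abs_div, abs_of_pos hs₁0, div_le_one hs₁0]
        exact (abs_lt.2 hr).le
      have h1 := hscale s₁ hs₁ε y hy ⟨r / s₁, hmem⟩
      rw [mul_div_cancel₀ r hs₁0.ne'] at h1
      rw [h1]
      have h2 := congrArg (fun β  : CurveSpace E => β ⟨r / s₁, hmem⟩) (hSG _ hq.1)
      simp only [ContinuousMap.sub_apply, ContinuousMap.zero_apply, sub_sub, sub_eq_zero] at h2
      exact h2
    have hmem : s / s₁ ∈ Icc (-1 : ℝ) 1 := by
      rw [mem_Icc, ← abs_le, abs_div, abs_of_pos hs₁0, div_le_one hs₁0]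
      exact hs₁.le
    have hcont : Continuous (IccExtend (by norm_num : (-1 : ℝ) ≤ 1) (Tc.comp α)) :=
      (Tc.comp α).continuous.Icc_extend'
    have hd := (intervalIntegral.integral_hasDerivAt_right (hcont.intervalIntegrable 0 (s / s₁))
      (hcont.stronglyMeasurableAtFilter _ _) hcont.continuousAt).scomp s
      ((hasDerivAt_id s).div_const s₁)
    have hd2 := (hd.const_smul s₁).const_add y
    rw [smul_smul, mul_one_div_cancel hs₁0.ne', one_smul, IccExtend_of_mem _ _ hmem] at hd2
    have hval : S (s, y) rightEnd = α ⟨s / s₁, hmem⟩ := by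
      have := hscale s₁ hs₁ε y hy ⟨s / s₁, hmem⟩
      rwa [mul_div_cancel₀ s hs₁0.ne'] at this
    simp only [hval]
    refine hd2.congr_of_eventuallyEq ?_
    filter_upwards [Ioo_mem_nhds (abs_lt.1 hs₁).1 (abs_lt.1 hs₁).2] with r hr
    exact hα r hr

/-- Multiplying by a bump function supported in `V` makes the field globally smooth. For short times
the flow stays in the ball where the bump is `1`, so it solves the original equation. -/
theorem exists_smooth_flow {E : Type u} [NormedAddCommGroup E] [NormedSpace ℝ E]
    [FiniteDimensional ℝ E] {T : E → E} {V : Set E} (hV : IsOpen V) (hT : ContDiffOn ℝ ∞ T V)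
    {y₀ : E} (hy₀ : y₀ ∈ V) :
    ∃ ε > 0, ∃ Φ : ℝ × E → E, ContDiffOn ℝ ∞ Φ (Ioo (-ε) ε ×ˢ Metric.ball y₀ ε) ∧
      ∀ y ∈ Metric.ball y₀ ε, Φ (0, y) = y ∧
        ∀ s ∈ Ioo (-ε) ε, Φ (s, y) ∈ V ∧
          HasDerivAt (fun r => Φ (r, y)) (T (Φ (s, y))) s := by
  have : CompleteSpace E := FiniteDimensional.complete ℝ E
  obtain ⟨b, hb⟩ : ∃ b : ContDiffBump y₀, Metric.closedBall y₀ b.rOut ⊆ V := by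
    obtain ⟨r, hr, h⟩ := Metric.nhds_basis_closedBall.mem_iff.1 (hV.mem_nhds hy₀)
    exact ⟨⟨r / 2, r, by linarith, by linarith⟩, h⟩
  have hbT : ContDiff ℝ ∞ (fun y => b y • T y) := by
    rw [contDiff_iff_contDiffAt]
    intro y
    by_cases hy : y ∈ Metric.closedBall y₀ b.rOut
    · exact b.contDiffAt.smul (hT.contDiffAt (hV.mem_nhds (hb hy)))
    · refine (contDiffAt_const (c := (0 : E))).congr_of_eventuallyEq ?_
      filter_upwards [Metric.isClosed_closedBall.isOpen_compl.mem_nhds hy] with z hz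
      rw [b.zero_of_le_dist (by simpa using (not_le.1 fun h => hz h).le), zero_smul]
  obtain ⟨ε, hε, Φ, hΦ, h⟩ := exists_smooth_flow_of_contDiff hbT y₀
  have hmem : ((0 : ℝ), y₀) ∈ Ioo (-ε) ε ×ˢ Metric.ball y₀ ε :=
    ⟨⟨by linarith, hε⟩, Metric.mem_ball_self hε⟩
  have hc : ContinuousAt Φ (0, y₀) :=
    hΦ.continuousOn.continuousAt ((isOpen_Ioo.prod Metric.isOpen_ball).mem_nhds hmem)
  have hev : ∀ᶠ q in 𝓝 ((0 : ℝ), y₀), Φ q ∈ Metric.ball y₀ b.rIn := by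
    refine hc.eventually ?_
    rw [(h y₀ hmem.2).1]
    exact Metric.ball_mem_nhds _ b.rIn_pos
  obtain ⟨ε', hε', h'⟩ := Metric.eventually_nhds_iff.1 hev
  refine ⟨min ε ε', lt_min hε hε', Φ, hΦ.mono ?_, fun y hy => ?_⟩
  · exact prod_mono (Ioo_subset_Ioo (neg_le_neg (min_le_left _ _)) (min_le_left _ _))
      (Metric.ball_subset_ball (min_le_left _ _))
  · obtain ⟨h1, h2⟩ := h y (Metric.ball_subset_ball (min_le_left _ _) hy)
    refine ⟨h1, fun s hs => ?_⟩
    have hin : Φ (s, y) ∈ Metric.ball y₀ b.rIn := h' (by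
      rw [Prod.dist_eq]
      refine max_lt ?_ (lt_of_lt_of_le hy (min_le_right _ _))
      have := abs_lt.2 hs
      simpa using this.trans_le (min_le_right _ _))
    have hlt : (Φ (s, y)) ∈ Metric.closedBall y₀ b.rIn := Metric.ball_subset_closedBall hin
    refine ⟨hb (Metric.closedBall_subset_closedBall b.rIn_lt_rOut.le hlt), ?_⟩
    have h3 := h2 s (Ioo_subset_Ioo (neg_le_neg (min_le_left _ _)) (min_le_left _ _) hs)
    rwa [b.one_of_mem_closedBall hlt, one_smul] at h3

end Flow
end

noncomputable section

/-! ### Riemannian metrics in coordinates and closed conformal fields. -/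

section Coordinates

variable {E : Type*} [NormedAddCommGroup E] [NormedSpace ℝ E]

/-- The Christoffel term of the first kind of a metric `G` on an open subset of a normed space. -/
def coordChristoffel (G : E → E →L[ℝ] E →L[ℝ] ℝ) (y a c b : E) : ℝ :=
  (fderiv ℝ G y a c b + fderiv ℝ G y c a b - fderiv ℝ G y b a c) / 2

/-- The covariant derivative `G(∇_a Y, b)` of a vector field on an open subset of a normed space. -/
def coordCovDeriv (G : E → E →L[ℝ] E →L[ℝ] ℝ) (Y : E → E) (y a b : E) : ℝ :=
  G y (fderiv ℝ Y y a) b + coordChristoffel G y a (Y y) b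

/-- A smooth Riemannian metric on the open set `V`, in coordinates. -/
structure IsCoordMetric (G : E → E →L[ℝ] E →L[ℝ] ℝ) (V : Set E) : Prop where
  isOpen : IsOpen V
  smooth : ContDiffOn ℝ ∞ G V
  symm : ∀ y ∈ V, ∀ a b, G y a b = G y b a
  pos : ∀ y ∈ V, ∀ a, a ≠ 0 → 0 < G y a a

namespace IsCoordMetric

variable {G : E → E →L[ℝ] E →L[ℝ] ℝ} {V : Set E}

theorem mono (hG : IsCoordMetric G V) {V' : Set E} (hV' : IsOpen V') (h : V' ⊆ V) :
    IsCoordMetric G V' :=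
  ⟨hV', hG.smooth.mono h, fun y hy => hG.symm y (h hy), fun y hy => hG.pos y (h hy)⟩

theorem differentiableAt (hG : IsCoordMetric G V) {y : E} (hy : y ∈ V) :
    DifferentiableAt ℝ G y :=
  (hG.smooth.contDiffAt (hG.isOpen.mem_nhds hy)).differentiableAt (by simp)

theorem fderiv_symm (hG : IsCoordMetric G V) {y : E} (hy : y ∈ V) (d a b : E) :
    fderiv ℝ G y d a b = fderiv ℝ G y d b a := by
  have h1 (a b : E) : HasFDerivAt (fun z => G z a b)
      (((fderiv ℝ G y).flip a).flip b) y := by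
    have := ((hG.differentiableAt hy).hasFDerivAt.clm_apply
      (hasFDerivAt_const a y)).clm_apply (hasFDerivAt_const b y)
    refine this.congr_fderiv ?_
    ext; simp
  have h2 : (fun z => G z a b) =ᶠ[𝓝 y] fun z => G z b a := by
    filter_upwards [hG.isOpen.mem_nhds hy] with z hz using hG.symm z hz a b
  have h3 := ((h1 a b).congr_of_eventuallyEq h2.symm).unique (h1 b a)
  exact DFunLike.congr_fun h3 d

theorem christoffel_symm (hG : IsCoordMetric G V) {y : E} (hy : y ∈ V) (a c b : E) :
    coordChristoffel G y a c b = coordChristoffel G y c a b := by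
  simp only [coordChristoffel, hG.fderiv_symm hy b a c]; ring

/-- Metric compatibility of the Levi-Civita connection; absence of torsion is `christoffel_symm`.
From it follow the product rules for inner products along curves and in open sets. -/
theorem christoffel_add (hG : IsCoordMetric G V) {y : E} (hy : y ∈ V) (a c b : E) :
    coordChristoffel G y a c b + coordChristoffel G y a b c = fderiv ℝ G y a c b := by
  simp only [coordChristoffel, hG.fderiv_symm hy a b c]; ring

theorem christoffel_smul (y a c b : E) (r : ℝ) :
    coordChristoffel G y a (r • c) b = r * coordChristoffel G y a c b := by
  simp only [coordChristoffel, map_smul, smul_apply, smul_eq_mul]; ring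

/-- The derivative of `G(P, Q)` along a curve. -/
theorem hasDerivAt_apply (hG : IsCoordMetric G V) {c P Q : ℝ → E} {c' P' Q' : E} {s : ℝ}
    (hs : c s ∈ V) (hc : HasDerivAt c c' s) (hP : HasDerivAt P P' s) (hQ : HasDerivAt Q Q' s) :
    HasDerivAt (fun r => G (c r) (P r) (Q r))
      ((G (c s) P' (Q s) + coordChristoffel G (c s) c' (P s) (Q s)) +
        (G (c s) Q' (P s) + coordChristoffel G (c s) c' (Q s) (P s))) s := by
  have h0 : HasDerivAt (fun r => G (c r)) (fderiv ℝ G (c s) c') s :=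
    HasFDerivAt.comp_hasDerivAt (E := E →L[ℝ] E →L[ℝ] ℝ) (l := G) (l' := fderiv ℝ G (c s)) s
      (hG.differentiableAt hs).hasFDerivAt hc
  have h1 : HasDerivAt (fun r => G (c r) (P r)) (fderiv ℝ G (c s) c' (P s) + G (c s) P') s :=
    h0.clm_apply hP
  have h : HasDerivAt (fun r => G (c r) (P r) (Q r))
      ((fderiv ℝ G (c s) c' (P s) + G (c s) P') (Q s) + G (c s) (P s) Q') s := h1.clm_apply hQ
  refine h.congr_deriv ?_
  have := hG.christoffel_add hs c' (P s) (Q s)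
  have h2 := hG.symm _ hs Q' (P s)
  rw [add_apply]
  linarith

theorem hasFDerivAt_apply (hG : IsCoordMetric G V) {P Q : E → E} {y : E} (hy : y ∈ V)
    (hP : DifferentiableAt ℝ P y) (hQ : DifferentiableAt ℝ Q y) (a : E) :
    fderiv ℝ (fun z => G z (P z) (Q z)) y a =
      coordCovDeriv G P y a (Q y) + coordCovDeriv G Q y a (P y) := by
  have h := ((hG.differentiableAt hy).hasFDerivAt.clm_apply hP.hasFDerivAt).clm_apply
    hQ.hasFDerivAt
  rw [h.fderiv]
  have := hG.christoffel_add hy a (P y) (Q y)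
  have h2 := hG.symm _ hy (fderiv ℝ Q y a) (P y)
  simp [coordCovDeriv]
  linarith

theorem contDiffOn_apply (hG : IsCoordMetric G V) {P Q : E → E} (hP : ContDiffOn ℝ ∞ P V)
    (hQ : ContDiffOn ℝ ∞ Q V) : ContDiffOn ℝ ∞ (fun z => G z (P z) (Q z)) V :=
  (hG.smooth.clm_apply hP).clm_apply hQ

end IsCoordMetric

/-- A unit field `T` and a positive function `ρ` on `V` such that `ρ T` is a closed conformal
field with conformal factor `l`. -/
structure IsUnitConformal (G : E → E →L[ℝ] E →L[ℝ] ℝ) (V : Set E) (T : E → E) (ρ l : E → ℝ) :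
    Prop where
  smooth_T : ContDiffOn ℝ ∞ T V
  smooth_ρ : ContDiffOn ℝ ∞ ρ V
  pos : ∀ y ∈ V, 0 < ρ y
  unit : ∀ y ∈ V, G y (T y) (T y) = 1
  deriv_ρ : ∀ y ∈ V, ∀ a, fderiv ℝ ρ y a = l y * G y (T y) a
  deriv_T : ∀ y ∈ V, ∀ a b, coordCovDeriv G T y a b =
    l y / ρ y * (G y a b - G y (T y) a * G y (T y) b)

/-- A nowhere vanishing closed conformal field, normalized. -/
theorem isUnitConformal_of_closedConformal {G : E → E →L[ℝ] E →L[ℝ] ℝ} {V : Set E}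
    (hG : IsCoordMetric G V) {Y : E → E} {l : E → ℝ} (hY : ContDiffOn ℝ ∞ Y V)
    (hne : ∀ y ∈ V, Y y ≠ 0) (hconf : ∀ y ∈ V, ∀ a b, coordCovDeriv G Y y a b = l y * G y a b) :
    IsUnitConformal G V (fun y => (√(G y (Y y) (Y y)))⁻¹ • Y y)
      (fun y => √(G y (Y y) (Y y))) l := by
  have hpos : ∀ y ∈ V, 0 < G y (Y y) (Y y) := fun y hy => hG.pos y hy _ (hne y hy)
  have hsq := hG.contDiffOn_apply hY hY
  have hρ : ContDiffOn ℝ ∞ (fun y => √(G y (Y y) (Y y))) V :=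
    hsq.sqrt fun y hy => (hpos y hy).ne'
  have hρpos : ∀ y ∈ V, 0 < √(G y (Y y) (Y y)) := fun y hy => Real.sqrt_pos.2 (hpos y hy)
  have hdiff : ∀ y ∈ V, DifferentiableAt ℝ Y y := fun y hy =>
    (hY.contDiffAt (hG.isOpen.mem_nhds hy)).differentiableAt (by simp)
  have hρdiff : ∀ y ∈ V, DifferentiableAt ℝ (fun y => √(G y (Y y) (Y y))) y := fun y hy =>
    (hρ.contDiffAt (hG.isOpen.mem_nhds hy)).differentiableAt (by simp)
  -- Differentiating `ρ² = G(Y, Y)` gives `ρ dρ(a) = G(∇_a Y, Y) = l G(a, Y)`.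
  have hdρ : ∀ y ∈ V, ∀ a, fderiv ℝ (fun y => √(G y (Y y) (Y y))) y a =
      l y * ((√(G y (Y y) (Y y)))⁻¹ * G y (Y y) a) := by
    intro y hy a
    have h1 := hG.hasFDerivAt_apply hy (hdiff y hy) (hdiff y hy) a
    have h2 := (((hsq.contDiffAt (hG.isOpen.mem_nhds hy)).differentiableAt
      (by simp)).hasFDerivAt.sqrt (hpos y hy).ne').fderiv
    rw [h2]
    simp only [smul_apply, h1, hconf y hy, smul_eq_mul, hG.symm y hy a (Y y)]
    have := (hρpos y hy).ne'
    field_simp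
    ring
  refine ⟨(hρ.inv fun y hy => (hρpos y hy).ne').smul hY, hρ, hρpos, fun y hy => ?_,
    fun y hy a => ?_, fun y hy a b => ?_⟩
  · simp only [map_smul, smul_apply, smul_eq_mul]
    have h := Real.mul_self_sqrt (hpos y hy).le
    have := (hρpos y hy).ne'
    field_simp
    rw [sq, h]
  · rw [hdρ y hy]
    simp
  · have h1 : fderiv ℝ (fun y => (√(G y (Y y) (Y y)))⁻¹ • Y y) y a =
        (√(G y (Y y) (Y y)))⁻¹ • fderiv ℝ Y y a +
          (-(√(G y (Y y) (Y y)) ^ 2)⁻¹ * (l y * ((√(G y (Y y) (Y y)))⁻¹ * G y (Y y) a))) • Y y := by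
      have := ((hasDerivAt_inv (hρpos y hy).ne').comp_hasFDerivAt y
        (hρdiff y hy).hasFDerivAt).smul (hdiff y hy).hasFDerivAt
      rw [HasFDerivAt.fderiv (f := fun y => (√(G y (Y y) (Y y)))⁻¹ • Y y) this]
      simp [hdρ y hy]
    have h2 := hconf y hy a b
    rw [coordCovDeriv] at h2 ⊢
    rw [h1, IsCoordMetric.christoffel_smul]
    simp only [map_smul, map_add, smul_apply, add_apply,
      smul_eq_mul]
    have := (hρpos y hy).ne'
    -- Solving the conformal equation for the Christoffel term cancels the derivative of `Y`; only
    -- `l / ρ` times the metric and the correction coming from `dρ` remain.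
    rw [show coordChristoffel G y a (Y y) b = l y * G y a b - G y (fderiv ℝ Y y a) b by linarith]
    field_simp
    ring

end Coordinates
end

noncomputable section

/-! ### The flow of a normalized closed conformal field gives warped product coordinates. -/

section WarpedCoordinates

variable {E F : Type u} [NormedAddCommGroup E] [NormedSpace ℝ E]
  [NormedAddCommGroup F] [NormedSpace ℝ F]

theorem fderiv_fderiv_symm {E F : Type*} [NormedAddCommGroup E] [NormedSpace ℝ E]
    [NormedAddCommGroup F] [NormedSpace ℝ F] {f : E → F} {U : Set E} (hU : IsOpen U)
    (hf : ContDiffOn ℝ ∞ f U) {z : E} (hz : z ∈ U) (X Y : E) :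
    fderiv ℝ (fderiv ℝ f) z X Y = fderiv ℝ (fderiv ℝ f) z Y X :=
  ((hf.contDiffAt (hU.mem_nhds hz)).isSymmSndFDerivAt
    (by simpa using (ENat.LEInfty.out : (2 : ℕ∞ω) ≤ ∞))).eq X Y

theorem contDiffOn_fderiv {E F : Type*} [NormedAddCommGroup E] [NormedSpace ℝ E]
    [NormedAddCommGroup F] [NormedSpace ℝ F] {f : E → F} {U : Set E} (hU : IsOpen U)
    (hf : ContDiffOn ℝ ∞ f U) : ContDiffOn ℝ ∞ (fderiv ℝ f) U :=
  hf.fderiv_of_isOpen hU (by norm_cast)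

theorem hasDerivAt_fst_slice {F E : Type*} [NormedAddCommGroup E] [NormedSpace ℝ E]
    [NormedAddCommGroup F] [NormedSpace ℝ F] {f : ℝ × F → E} {f' : ℝ × F →L[ℝ] E} {s : ℝ} {u : F}
    (hf : HasFDerivAt f f' (s, u)) : HasDerivAt (fun r => f (r, u)) (f' (1, 0)) s :=
  hf.comp_hasDerivAt s ((hasDerivAt_id s).prodMk (hasDerivAt_const s u))

theorem eqOn_Ioo_of_hasDerivAt_zero {ε : ℝ} {f : ℝ → ℝ}
    (hf : ∀ s ∈ Ioo (-ε) ε, HasDerivAt f 0 s) {s : ℝ} (hs : s ∈ Ioo (-ε) ε) : f s = f 0 := by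
  have h0 : (0 : ℝ) ∈ Ioo (-ε) ε := ⟨by linarith [hs.1, hs.2], by linarith [hs.1, hs.2]⟩
  refine (convex_Ioo (-ε) ε).is_const_of_fderivWithin_eq_zero (𝕜 := ℝ)
    (fun r hr => (hf r hr).differentiableAt.differentiableWithinAt) (fun r hr => ?_) hs h0
  rw [fderivWithin_of_isOpen isOpen_Ioo hr]
  ext
  simpa using (hf r hr).deriv

/-- The metric in the coordinates obtained by transporting a hypersurface orthogonal to the unit
field `T` along the flow of `T` is a warped product. -/
theorem flow_isometry {G : E → E →L[ℝ] E →L[ℝ] ℝ} {V : Set E} (hG : IsCoordMetric G V)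
    {T : E → E} {ρ l : E → ℝ} (h : IsUnitConformal G V T ρ l) {ε r : ℝ} {Ψ : ℝ × F → E}
    (hΨ : ContDiffOn ℝ ∞ Ψ (Ioo (-ε) ε ×ˢ Metric.ball 0 r))
    (hmem : ∀ z ∈ Ioo (-ε) ε ×ˢ Metric.ball (0 : F) r, Ψ z ∈ V)
    (hflow : ∀ z ∈ Ioo (-ε) ε ×ˢ Metric.ball (0 : F) r, fderiv ℝ Ψ z (1, 0) = T (Ψ z))
    (hperp : ∀ u ∈ Metric.ball (0 : F) r, ∀ a,
      G (Ψ (0, u)) (T (Ψ (0, u))) (fderiv ℝ Ψ (0, u) (0, a)) = 0) :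
    ∀ s ∈ Ioo (-ε) ε, ∀ u ∈ Metric.ball (0 : F) r,
      ρ (Ψ (s, u)) = ρ (Ψ (s, 0)) ∧ ∀ X Y : ℝ × F,
      G (Ψ (s, u)) (fderiv ℝ Ψ (s, u) X) (fderiv ℝ Ψ (s, u) Y) = X.1 * Y.1 +
        ρ (Ψ (s, 0)) ^ 2 * ((ρ (Ψ (0, 0)) ^ 2)⁻¹ *
          G (Ψ (0, u)) (fderiv ℝ Ψ (0, u) (0, X.2)) (fderiv ℝ Ψ (0, u) (0, Y.2))) := by
  set Ω : Set (ℝ × F) := Ioo (-ε) ε ×ˢ Metric.ball 0 r with hΩdef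
  have hΩ : IsOpen Ω := isOpen_Ioo.prod Metric.isOpen_ball
  have hΨd : ∀ z ∈ Ω, HasFDerivAt Ψ (fderiv ℝ Ψ z) z := fun z hz =>
    ((hΨ.contDiffAt (hΩ.mem_nhds hz)).differentiableAt (by simp)).hasFDerivAt
  have hTd : ∀ z ∈ Ω, HasFDerivAt T (fderiv ℝ T (Ψ z)) (Ψ z) := fun z hz =>
    ((h.smooth_T.contDiffAt (hG.isOpen.mem_nhds (hmem z hz))).differentiableAt
      (by simp)).hasFDerivAt
  have hρd : ∀ z ∈ Ω, HasFDerivAt ρ (fderiv ℝ ρ (Ψ z)) (Ψ z) := fun z hz =>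
    ((h.smooth_ρ.contDiffAt (hG.isOpen.mem_nhds (hmem z hz))).differentiableAt
      (by simp)).hasFDerivAt
  have hD2 : ∀ z ∈ Ω, HasFDerivAt (fderiv ℝ Ψ) (fderiv ℝ (fderiv ℝ Ψ) z) z := fun z hz =>
    (((contDiffOn_fderiv hΩ hΨ).contDiffAt (hΩ.mem_nhds hz)).differentiableAt
      (by simp)).hasFDerivAt
  -- the derivative of `DΨ X` along the flow lines
  have hP : ∀ s ∈ Ioo (-ε) ε, ∀ u ∈ Metric.ball (0 : F) r, ∀ X : ℝ × F,
      HasDerivAt (fun r => fderiv ℝ Ψ (r, u) X)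
        (fderiv ℝ T (Ψ (s, u)) (fderiv ℝ Ψ (s, u) X)) s := by
    intro s hs u hu X
    have hz : (s, u) ∈ Ω := ⟨hs, hu⟩
    have h1 : HasFDerivAt (fun z => fderiv ℝ Ψ z X)
        ((fderiv ℝ (fderiv ℝ Ψ) (s, u)).flip X) (s, u) := by
      refine ((hD2 _ hz).clm_apply (hasFDerivAt_const X _)).congr_fderiv ?_
      ext <;> simp
    refine (hasDerivAt_fst_slice h1).congr_deriv ?_
    rw [ContinuousLinearMap.flip_apply, fderiv_fderiv_symm hΩ hΨ hz]
    have h2 : HasFDerivAt (fun z => fderiv ℝ Ψ z (1, 0))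
        ((fderiv ℝ (fderiv ℝ Ψ) (s, u)).flip (1, 0)) (s, u) := by
      refine ((hD2 _ hz).clm_apply (hasFDerivAt_const _ _)).congr_fderiv ?_
      ext <;> simp
    have h3 : HasFDerivAt (fun z => fderiv ℝ Ψ z (1, 0))
        ((fderiv ℝ T (Ψ (s, u))).comp (fderiv ℝ Ψ (s, u))) (s, u) := by
      refine ((hTd _ hz).comp (s, u) (hΨd _ hz)).congr_of_eventuallyEq ?_
      filter_upwards [hΩ.mem_nhds hz] with z hz using hflow z hz
    exact DFunLike.congr_fun (h2.unique h3) X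
  -- the derivative of `G(DΨ X, DΨ Y)` along the flow lines
  have hA : ∀ s ∈ Ioo (-ε) ε, ∀ u ∈ Metric.ball (0 : F) r, ∀ X Y : ℝ × F,
      HasDerivAt (fun r => G (Ψ (r, u)) (fderiv ℝ Ψ (r, u) X) (fderiv ℝ Ψ (r, u) Y))
        (2 * (l (Ψ (s, u)) / ρ (Ψ (s, u))) *
          (G (Ψ (s, u)) (fderiv ℝ Ψ (s, u) X) (fderiv ℝ Ψ (s, u) Y) -
            G (Ψ (s, u)) (T (Ψ (s, u))) (fderiv ℝ Ψ (s, u) X) *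
            G (Ψ (s, u)) (T (Ψ (s, u))) (fderiv ℝ Ψ (s, u) Y))) s := by
    intro s hs u hu X Y
    have hz : (s, u) ∈ Ω := ⟨hs, hu⟩
    have hc : HasDerivAt (fun r => Ψ (r, u)) (T (Ψ (s, u))) s := by
      rw [← hflow _ hz]; exact hasDerivAt_fst_slice (hΨd _ hz)
    refine (hG.hasDerivAt_apply (hmem _ hz) hc (hP s hs u hu X) (hP s hs u hu Y)).congr_deriv ?_
    have h1 := h.deriv_T _ (hmem _ hz) (fderiv ℝ Ψ (s, u) X) (fderiv ℝ Ψ (s, u) Y)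
    have h2 := h.deriv_T _ (hmem _ hz) (fderiv ℝ Ψ (s, u) Y) (fderiv ℝ Ψ (s, u) X)
    rw [coordCovDeriv] at h1 h2
    rw [hG.christoffel_symm (hmem _ hz) (T (Ψ (s, u))), h1,
      hG.christoffel_symm (hmem _ hz) (T (Ψ (s, u))), h2,
      hG.symm _ (hmem _ hz) (fderiv ℝ Ψ (s, u) Y) (fderiv ℝ Ψ (s, u) X)]
    ring
  -- By `hA` with `DΨ(1, 0) = T`, the product of `T` with a slice vector has derivative proportional
  -- to `1 - G(T, T) = 0` along the flow, so it keeps its initial value zero.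
  have hA1 : ∀ s ∈ Ioo (-ε) ε, ∀ u ∈ Metric.ball (0 : F) r, ∀ a : F,
      G (Ψ (s, u)) (T (Ψ (s, u))) (fderiv ℝ Ψ (s, u) (0, a)) = 0 := by
    intro s hs u hu a
    have key := eqOn_Ioo_of_hasDerivAt_zero (f := fun r =>
      G (Ψ (r, u)) (fderiv ℝ Ψ (r, u) (1, 0)) (fderiv ℝ Ψ (r, u) (0, a))) (fun r hr => by
        refine (hA r hr u hu (1, 0) (0, a)).congr_deriv ?_
        rw [hflow _ ⟨hr, hu⟩, h.unit _ (hmem _ ⟨hr, hu⟩)]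
        ring) hs
    have h0 : (0 : ℝ) ∈ Ioo (-ε) ε := ⟨by linarith [hs.1, hs.2], by linarith [hs.1, hs.2]⟩
    beta_reduce at key
    rw [hflow _ ⟨hs, hu⟩, hflow _ ⟨h0, hu⟩, hperp u hu a] at key
    exact key
  -- The differential of `ρ` is a multiple of `G(T, ·)`, which vanishes on slice vectors by `hA1`.
  have hρu : ∀ s ∈ Ioo (-ε) ε, ∀ u ∈ Metric.ball (0 : F) r,
      ρ (Ψ (s, u)) = ρ (Ψ (s, 0)) := by
    intro s hs u hu
    have hr : 0 < r := (norm_nonneg u).trans_lt (by simpa using hu)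
    have hd : ∀ u ∈ Metric.ball (0 : F) r, HasFDerivAt (fun u => ρ (Ψ (s, u)))
        (0 : F →L[ℝ] ℝ) u := by
      intro u hu
      have hz : (s, u) ∈ Ω := ⟨hs, hu⟩
      have hi : HasFDerivAt (fun u : F => (s, u)) (ContinuousLinearMap.inr ℝ ℝ F) u :=
        hasFDerivAt_prodMk_right s u
      refine (((hρd _ hz).comp (s, u) (hΨd _ hz)).comp u hi).congr_fderiv ?_
      ext a
      simp [h.deriv_ρ _ (hmem _ hz), hA1 s hs u hu a]
    refine (convex_ball (0 : F) r).is_const_of_fderivWithin_eq_zero (𝕜 := ℝ)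
      (fun u hu => (hd u hu).differentiableAt.differentiableWithinAt) (fun u hu => ?_) hu
      (Metric.mem_ball_self hr)
    rw [fderivWithin_of_isOpen Metric.isOpen_ball hu, (hd u hu).fderiv]
  intro s hs u hu
  have h0 : (0 : ℝ) ∈ Ioo (-ε) ε := ⟨by linarith [hs.1, hs.2], by linarith [hs.1, hs.2]⟩
  refine ⟨hρu s hs u hu, fun X Y => ?_⟩
  have hz : (s, u) ∈ Ω := ⟨hs, hu⟩
  -- Along a flow line `ρ' = l`, while inner products of slice vectors grow at the rate `2 l / ρ`,
  -- exactly like `ρ²`. The quotient is therefore constant.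
  have hB : ∀ a b : F, G (Ψ (s, u)) (fderiv ℝ Ψ (s, u) (0, a)) (fderiv ℝ Ψ (s, u) (0, b)) /
      ρ (Ψ (s, u)) ^ 2 = G (Ψ (0, u)) (fderiv ℝ Ψ (0, u) (0, a)) (fderiv ℝ Ψ (0, u) (0, b)) /
      ρ (Ψ (0, u)) ^ 2 := by
    intro a b
    refine eqOn_Ioo_of_hasDerivAt_zero (f := fun r =>
      G (Ψ (r, u)) (fderiv ℝ Ψ (r, u) (0, a)) (fderiv ℝ Ψ (r, u) (0, b)) / ρ (Ψ (r, u)) ^ 2)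
      (fun r hr => ?_) hs
    have hz : (r, u) ∈ Ω := ⟨hr, hu⟩
    have hρ0 := (h.pos _ (hmem _ hz)).ne'
    have hρ' : HasDerivAt (fun r => ρ (Ψ (r, u))) (l (Ψ (r, u))) r := by
      refine (hasDerivAt_fst_slice ((hρd _ hz).comp (r, u) (hΨd _ hz))).congr_deriv ?_
      rw [ContinuousLinearMap.comp_apply, hflow _ hz, h.deriv_ρ _ (hmem _ hz),
        h.unit _ (hmem _ hz), mul_one]
    refine ((hA r hr u hu (0, a) (0, b)).div (hρ'.pow 2) (pow_ne_zero 2 hρ0)).congr_deriv ?_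
    rw [hA1 r hr u hu a]
    simp only [Pi.pow_apply]
    field_simp
    ring
  have hX : ∀ X : ℝ × F, fderiv ℝ Ψ (s, u) X =
      X.1 • T (Ψ (s, u)) + fderiv ℝ Ψ (s, u) (0, X.2) := by
    intro X
    rw [← hflow _ hz, ← map_smul, ← map_add]
    simp
  have hsym := hG.symm _ (hmem _ hz) (fderiv ℝ Ψ (s, u) (0, X.2)) (T (Ψ (s, u)))
  have hBs := hB X.2 Y.2
  rw [hρu s hs u hu, hρu 0 h0 u hu, div_eq_iff (pow_ne_zero 2
    (by rw [← hρu s hs u hu]; exact (h.pos _ (hmem _ hz)).ne'))] at hBs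
  rw [hX X, hX Y]
  simp only [map_add, map_smul, add_apply, smul_apply, smul_eq_mul, hsym, hA1 s hs u hu,
    h.unit _ (hmem _ hz), hBs]
  ring

/-- Small balls around `0` are contained in a neighbourhood of `(0, 0)`. -/
theorem exists_Ioo_prod_ball_subset {F : Type*} [NormedAddCommGroup F] {U : Set (ℝ × F)}
    (hU : U ∈ 𝓝 (0 : ℝ × F)) : ∃ δ > 0, Ioo (-δ) δ ×ˢ Metric.ball (0 : F) δ ⊆ U := by
  obtain ⟨δ, hδ, h⟩ := Metric.mem_nhds_iff.1 hU
  refine ⟨δ, hδ, fun z hz => h ?_⟩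
  rw [Metric.mem_ball, Prod.dist_eq]
  exact max_lt (by simpa [abs_lt] using hz.1) hz.2

/-- Local warped product coordinates, from a unit field `T` as in `IsUnitConformal` and a
hypersurface `ι` orthogonal to it. -/
theorem exists_warped_coordinates [FiniteDimensional ℝ E] [FiniteDimensional ℝ F]
    {G : E → E →L[ℝ] E →L[ℝ] ℝ} {V : Set E} (hG : IsCoordMetric G V)
    {T : E → E} {ρ l : E → ℝ} (h : IsUnitConformal G V T ρ l)
    (hdim : Module.finrank ℝ F + 1 = Module.finrank ℝ E) {ι : F → E} {r : ℝ} (hr : 0 < r)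
    (hι : ContDiffOn ℝ ∞ ι (Metric.ball 0 r)) (hι0 : ι 0 ∈ V)
    (hperp : ∀ u ∈ Metric.ball (0 : F) r, ι u ∈ V → ∀ a,
      G (ι u) (T (ι u)) (fderiv ℝ ι u a) = 0)
    (hinj : ∀ a, fderiv ℝ ι 0 a = 0 → a = 0) :
    ∃ δ, 0 < δ ∧ δ ≤ r ∧ ∃ e : OpenPartialHomeomorph (ℝ × F) E,
      e.source = Ioo (-δ) δ ×ˢ Metric.ball 0 δ ∧ e.target ⊆ V ∧
      ContDiffOn ℝ ∞ e e.source ∧ ContDiffOn ℝ ∞ e.symm e.target ∧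
      (∀ u ∈ Metric.ball (0 : F) δ, e (0, u) = ι u) ∧
      (∀ z ∈ e.source, fderiv ℝ e z (1, 0) = T (e z)) ∧
      ∀ s ∈ Ioo (-δ) δ, ∀ u ∈ Metric.ball (0 : F) δ,
        ρ (e (s, u)) = ρ (e (s, 0)) ∧ ∀ X Y : ℝ × F,
        G (e (s, u)) (fderiv ℝ e (s, u) X) (fderiv ℝ e (s, u) Y) = X.1 * Y.1 +
          ρ (e (s, 0)) ^ 2 * ((ρ (ι 0) ^ 2)⁻¹ *
            G (ι u) (fderiv ℝ ι u X.2) (fderiv ℝ ι u Y.2)) := by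
  have : CompleteSpace E := FiniteDimensional.complete ℝ E
  have : CompleteSpace F := FiniteDimensional.complete ℝ F
  obtain ⟨ε, hε, Φ, hΦ, hflow⟩ := exists_smooth_flow hG.isOpen h.smooth_T hι0
  have hιc : ContinuousOn ι (Metric.ball 0 r) := hι.continuousOn
  let B : Set F := Metric.ball 0 r ∩ ι ⁻¹' Metric.ball (ι 0) ε
  have hB : IsOpen B := hιc.isOpen_inter_preimage Metric.isOpen_ball Metric.isOpen_ball
  have hB0 : (0 : F) ∈ B := ⟨Metric.mem_ball_self hr, Metric.mem_ball_self hε⟩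
  let Ψ : ℝ × F → E := fun z => Φ (z.1, ι z.2)
  let Ω : Set (ℝ × F) := Ioo (-ε) ε ×ˢ B
  have hΩ : IsOpen Ω := isOpen_Ioo.prod hB
  have h0ε : (0 : ℝ) ∈ Ioo (-ε) ε := ⟨by linarith, hε⟩
  have hΩ0 : (0 : ℝ × F) ∈ Ω := ⟨h0ε, hB0⟩
  have hΨ : ContDiffOn ℝ ∞ Ψ Ω := hΦ.comp
    (contDiff_fst.contDiffOn.prodMk (hι.comp contDiff_snd.contDiffOn fun z hz => hz.2.1))
    fun z hz => ⟨hz.1, hz.2.2⟩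
  have hΨd : ∀ z ∈ Ω, HasFDerivAt Ψ (fderiv ℝ Ψ z) z := fun z hz =>
    ((hΨ.contDiffAt (hΩ.mem_nhds hz)).differentiableAt (by simp)).hasFDerivAt
  have hΨT : ∀ z ∈ Ω, fderiv ℝ Ψ z (1, 0) = T (Ψ z) := by
    intro z hz
    exact (hasDerivAt_fst_slice (hΨd z hz)).unique ((hflow _ hz.2.2).2 _ hz.1).2
  have hΨ0 : ∀ u ∈ B, Ψ (0, u) = ι u := fun u hu => (hflow _ hu.2).1
  have hΨι : ∀ u ∈ B, ∀ a, fderiv ℝ Ψ (0, u) (0, a) = fderiv ℝ ι u a := by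
    intro u hu a
    have h1 : HasFDerivAt (fun u : F => Ψ (0, u))
        ((fderiv ℝ Ψ (0, u)).comp (ContinuousLinearMap.inr ℝ ℝ F)) u :=
      (hΨd (0, u) ⟨h0ε, hu⟩).comp u (hasFDerivAt_prodMk_right 0 u)
    have h2 : HasFDerivAt ι ((fderiv ℝ Ψ (0, u)).comp (ContinuousLinearMap.inr ℝ ℝ F)) u := by
      refine h1.congr_of_eventuallyEq ?_
      filter_upwards [hB.mem_nhds hu] with u hu using (hΨ0 u hu).symm
    rw [h2.fderiv]; rfl
  have hιV : ∀ u ∈ B, ι u ∈ V := fun u hu => by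
    have := ((hflow _ hu.2).2 0 h0ε).1
    rwa [(hflow _ hu.2).1] at this
  -- Pairing with `T` separates the flow direction from the orthogonal hypersurface, on which `Dι`
  -- is injective. Equality of dimensions then makes the derivative an isomorphism.
  have hinj' : Function.Injective (fderiv ℝ Ψ 0) := by
    rw [injective_iff_map_eq_zero]
    intro X hX
    have hdec : X.1 • T (ι 0) + fderiv ℝ ι 0 X.2 = 0 := by
      rw [← hX, ← hΨι 0 hB0, ← hΨ0 0 hB0, ← hΨT (0, 0) hΩ0, ← map_smul, ← map_add]
      simp only [Prod.smul_mk, smul_eq_mul, mul_one, smul_zero, Prod.mk_add_mk, add_zero, zero_add]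
      rfl
    have hX1 : X.1 = 0 := by
      have := congrArg (G (ι 0) (T (ι 0))) hdec
      simpa [hperp 0 hB0.1 hι0, h.unit _ hι0] using this
    rw [hX1, zero_smul, zero_add] at hdec
    exact Prod.ext hX1 (hinj _ hdec)
  have hfr : Module.finrank ℝ (ℝ × F) = Module.finrank ℝ E := by
    rw [Module.finrank_prod, Module.finrank_self, ← hdim, add_comm]
  let f' : (ℝ × F) ≃L[ℝ] E := (LinearEquiv.ofInjectiveOfFinrankEq
    (fderiv ℝ Ψ 0 : ℝ × F →ₗ[ℝ] E) hinj' hfr).toContinuousLinearEquiv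
  have hf' : HasFDerivAt Ψ (f' : ℝ × F →L[ℝ] E) 0 :=
    (hΨd 0 hΩ0).congr_fderiv (by ext <;> rfl)
  obtain ⟨e, he0, heΩ, heΨ, hes⟩ := exists_smooth_openPartialHomeomorph hΩ hΨ hΩ0 f' hf'
  obtain ⟨δ, hδ, hsub⟩ := exists_Ioo_prod_ball_subset (e.open_source.mem_nhds he0)
  have hδB : Metric.ball (0 : F) δ ⊆ B := fun u hu => (heΩ (hsub (a := (0, u))
    ⟨⟨by linarith, hδ⟩, hu⟩)).2
  let δ' := min δ r
  have hδ' : 0 < δ' := lt_min hδ hr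
  have hsub' : Ioo (-δ') δ' ×ˢ Metric.ball (0 : F) δ' ⊆ Ioo (-δ) δ ×ˢ Metric.ball 0 δ :=
    prod_mono (Ioo_subset_Ioo (neg_le_neg (min_le_left _ _)) (min_le_left _ _))
      (Metric.ball_subset_ball (min_le_left _ _))
  have hopen : IsOpen (Ioo (-δ') δ' ×ˢ Metric.ball (0 : F) δ') := isOpen_Ioo.prod Metric.isOpen_ball
  let e' := e.restrOpen _ hopen
  have hsrc : e'.source = Ioo (-δ') δ' ×ˢ Metric.ball 0 δ' :=
    inter_eq_right.2 (hsub'.trans hsub)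
  have he' : (e' : ℝ × F → E) = Ψ := funext heΨ
  have hsΩ : Ioo (-δ') δ' ×ˢ Metric.ball (0 : F) δ' ⊆ Ω := (hsub'.trans hsub).trans heΩ
  have hδB' : Metric.ball (0 : F) δ' ⊆ B := (Metric.ball_subset_ball (min_le_left _ _)).trans hδB
  have hV : ∀ z ∈ Ω, Ψ z ∈ V := fun z hz => ((hflow _ hz.2.2).2 _ hz.1).1
  refine ⟨δ', hδ', min_le_right _ _, e', hsrc, ?_, ?_, ?_, ?_, ?_, ?_⟩
  · intro y hy
    have := e'.map_target hy
    rw [← e'.right_inv hy, he']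
    exact hV _ (hsΩ (hsrc ▸ this))
  · rw [he', hsrc]; exact hΨ.mono hsΩ
  · exact hes.mono fun y hy => hy.1
  · intro u hu
    rw [he']; exact hΨ0 u (hδB' hu)
  · intro z hz
    rw [he']; exact hΨT z (hsΩ (hsrc ▸ hz))
  · rw [he']
    intro s hs u hu
    have key := flow_isometry hG h (hΨ.mono hsΩ) (fun z hz => hV z (hsΩ hz))
      (fun z hz => hΨT z (hsΩ hz)) (fun u hu a => by
        rw [hΨ0 u (hδB' hu), hΨι u (hδB' hu)]
        exact hperp u (hδB' hu).1 (hιV u (hδB' hu)) a) s hs u hu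
    rw [hΨ0 0 hB0, hΨ0 u (hδB' hu)] at key
    simp only [hΨι u (hδB' hu)] at key
    exact key

end WarpedCoordinates
end

noncomputable section

/-! ### Independence of the covariant derivative from the coordinates. -/

section ChangeOfCoordinates

theorem fderiv_pullback_metric {E E' : Type*} [NormedAddCommGroup E] [NormedSpace ℝ E]
    [NormedAddCommGroup E'] [NormedSpace ℝ E'] {G : E' → E' →L[ℝ] E' →L[ℝ] ℝ} {V : Set E'}
    (hG : IsCoordMetric G V) {τ : E → E'} {U : Set E} (hU : IsOpen U) (hτ : ContDiffOn ℝ ∞ τ U)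
    {y : E} (hy : y ∈ U) (hyV : τ y ∈ V) (d a b : E) :
    fderiv ℝ (fun z => G (τ z) (fderiv ℝ τ z a) (fderiv ℝ τ z b)) y d =
      fderiv ℝ G (τ y) (fderiv ℝ τ y d) (fderiv ℝ τ y a) (fderiv ℝ τ y b) +
        G (τ y) (fderiv ℝ (fderiv ℝ τ) y d a) (fderiv ℝ τ y b) +
        G (τ y) (fderiv ℝ τ y a) (fderiv ℝ (fderiv ℝ τ) y d b) := by
  have hτd : HasFDerivAt τ (fderiv ℝ τ y) y :=
    ((hτ.contDiffAt (hU.mem_nhds hy)).differentiableAt (by simp)).hasFDerivAt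
  have hτ2 : HasFDerivAt (fderiv ℝ τ) (fderiv ℝ (fderiv ℝ τ) y) y :=
    (((contDiffOn_fderiv hU hτ).contDiffAt (hU.mem_nhds hy)).differentiableAt
      (by simp)).hasFDerivAt
  have h0 : HasFDerivAt (fun z => G (τ z)) ((fderiv ℝ G (τ y)).comp (fderiv ℝ τ y)) y :=
    HasFDerivAt.comp (g := G) (g' := fderiv ℝ G (τ y)) y (hG.differentiableAt hyV).hasFDerivAt hτd
  have h1 (c : E) : HasFDerivAt (fun z => fderiv ℝ τ z c) ((fderiv ℝ (fderiv ℝ τ) y).flip c) y := by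
    refine (hτ2.clm_apply (hasFDerivAt_const c y)).congr_fderiv ?_
    ext; simp
  rw [((h0.clm_apply (h1 a)).clm_apply (h1 b)).fderiv]
  simp
  ring

/-- The transformation law of Christoffel symbols. Of the six terms with second derivatives of `τ`,
four cancel by symmetry of `D²τ`, and the two with `D²τ(a, c)` add up to the inhomogeneous term. -/
theorem christoffel_pullback_metric {E E' : Type*} [NormedAddCommGroup E] [NormedSpace ℝ E]
    [NormedAddCommGroup E'] [NormedSpace ℝ E'] {G : E' → E' →L[ℝ] E' →L[ℝ] ℝ} {V : Set E'}
    (hG : IsCoordMetric G V) {τ : E → E'} {U : Set E} (hU : IsOpen U) (hτ : ContDiffOn ℝ ∞ τ U)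
    {y : E} (hy : y ∈ U) (hyV : τ y ∈ V) (a c b : E) :
    (fderiv ℝ (fun z => G (τ z) (fderiv ℝ τ z c) (fderiv ℝ τ z b)) y a +
      fderiv ℝ (fun z => G (τ z) (fderiv ℝ τ z a) (fderiv ℝ τ z b)) y c -
      fderiv ℝ (fun z => G (τ z) (fderiv ℝ τ z a) (fderiv ℝ τ z c)) y b) / 2 =
    coordChristoffel G (τ y) (fderiv ℝ τ y a) (fderiv ℝ τ y c) (fderiv ℝ τ y b) +
      G (τ y) (fderiv ℝ (fderiv ℝ τ) y a c) (fderiv ℝ τ y b) := by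
  simp only [fderiv_pullback_metric hG hU hτ hy hyV, coordChristoffel]
  rw [fderiv_fderiv_symm hU hτ hy c a, fderiv_fderiv_symm hU hτ hy b a,
    fderiv_fderiv_symm hU hτ hy c b,
    hG.symm _ hyV (fderiv ℝ τ y c) (fderiv ℝ (fderiv ℝ τ) y a b)]
  ring

variable {E H P : Type*} [NormedAddCommGroup E] [NormedSpace ℝ E] [TopologicalSpace H]
  {IP : ModelWithCorners ℝ E H} [TopologicalSpace P] [ChartedSpace H P]
  {ES HS S : Type*} [NormedAddCommGroup ES] [NormedSpace ℝ ES] [TopologicalSpace HS]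
  {IS : ModelWithCorners ℝ ES HS} [TopologicalSpace S] [ChartedSpace HS S]
  {E' : Type*} [NormedAddCommGroup E'] [NormedSpace ℝ E']

/-- The coordinate vector, in the coordinate system `e`, of a tangent vector at `z`. -/
def coordVec (IP : ModelWithCorners ℝ E H) (e : P → E') {z : P} (a : TangentSpace IP z) : E' :=
  mfderiv IP 𝓘(ℝ, E') e z a

/-- `e` is a smooth coordinate system on an open subset of `P`. -/
structure IsSmoothCoord (IP : ModelWithCorners ℝ E H) (e : OpenPartialHomeomorph P E') : Prop where
  smooth : ContMDiffOn IP 𝓘(ℝ, E') ∞ e e.source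
  smooth_symm : ContMDiffOn 𝓘(ℝ, E') IP ∞ e.symm e.target

/-- `G` is the expression of the metric `γ` in the coordinate system `e`. -/
structure IsMetricIn (γ : MetricField IP P) (e : OpenPartialHomeomorph P E')
    (G : E' → E' →L[ℝ] E' →L[ℝ] ℝ) : Prop where
  coord : IsSmoothCoord IP e
  metric : IsCoordMetric G e.target
  eq : ∀ z ∈ e.source, ∀ X Y : TangentSpace IP z,
    γ z X Y = G (e z) (coordVec IP e X) (coordVec IP e Y)

theorem IsSmoothCoord.mdifferentiableAt {e : OpenPartialHomeomorph P E'} (he : IsSmoothCoord IP e)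
    {z : P} (hz : z ∈ e.source) : MDifferentiableAt IP 𝓘(ℝ, E') e z :=
  (he.smooth.contMDiffAt (e.open_source.mem_nhds hz)).mdifferentiableAt (by simp)

theorem IsSmoothCoord.mdifferentiableAt_symm {e : OpenPartialHomeomorph P E'}
    (he : IsSmoothCoord IP e) {y : E'} (hy : y ∈ e.target) :
    MDifferentiableAt 𝓘(ℝ, E') IP e.symm y :=
  (he.smooth_symm.contMDiffAt (e.open_target.mem_nhds hy)).mdifferentiableAt (by simp)

/-- A smooth vector field along a map has smooth components. -/
theorem ContMDiffOn.mfderiv_apply_section [IsManifold IP ∞ P] {φ : S → P}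
    {ν : ∀ y : S, TangentSpace IP (φ y)} {V : Set S}
    (hν : ContMDiffOn IS IP.tangent ∞ (fun y => (⟨φ y, ν y⟩ : TangentBundle IP P)) V)
    {e : P → E'} {U : Set P} (hU : IsOpen U) (he : ContMDiffOn IP 𝓘(ℝ, E') ∞ e U)
    (hφ : MapsTo φ V U) :
    ContMDiffOn IS 𝓘(ℝ, E') ∞ (fun y => coordVec IP e (ν y)) V := by
  have : IsManifold IP 1 P := IsManifold.of_le (n := ∞) (by simp)
  have h1 := (he.contMDiffOn_tangentMapWithin (m := ∞) (by simp) hU.uniqueMDiffOn).comp hν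
    (fun y hy => hφ hy)
  have h2 := (contMDiff_snd_tangentBundle_modelSpace E' 𝓘(ℝ, E') (n := ∞)).comp_contMDiffOn h1
  refine h2.congr fun y hy => ?_
  exact DFunLike.congr_fun (mfderivWithin_of_mem_nhds (hU.mem_nhds (hφ hy))).symm (ν y)

/-- A vector field along a map with smooth components is smooth. -/
theorem contMDiffOn_section_of_coord [IsManifold IP ∞ P] {φ : S → P} {V : Set S}
    (hφ : ContMDiffOn IS IP ∞ φ V) {e : OpenPartialHomeomorph P E'} (he : IsSmoothCoord IP e)
    (hm : MapsTo φ V e.source) {v : S → E'} (hv : ContMDiffOn IS 𝓘(ℝ, E') ∞ v V) :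
    ContMDiffOn IS IP.tangent ∞
      (fun y => (⟨φ y, mfderiv 𝓘(ℝ, E') IP e.symm (e (φ y)) (v y)⟩ : TangentBundle IP P)) V := by
  have : IsManifold IP 1 P := IsManifold.of_le (n := ∞) (by simp)
  have h0 : ContMDiffOn IS 𝓘(ℝ, E').tangent ∞
      (fun y => (⟨e (φ y), v y⟩ : TangentBundle 𝓘(ℝ, E') E')) V := by
    intro y hy
    refine Bundle.contMDiffWithinAt_totalSpace.2 ⟨(he.smooth.comp hφ hm) y hy, ?_⟩
    refine (hv y hy).congr (fun y' _ => ?_) ?_ <;> simp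
  have h1 := (he.smooth_symm.contMDiffOn_tangentMapWithin (m := ∞) (by simp)
    e.open_target.uniqueMDiffOn).comp h0 (fun y hy => e.map_source (hm hy))
  refine h1.congr fun y hy => ?_
  have h2 : mfderivWithin 𝓘(ℝ, E') IP e.symm e.target (e (φ y)) =
      mfderiv 𝓘(ℝ, E') IP e.symm (e (φ y)) :=
    mfderivWithin_of_mem_nhds (e.open_target.mem_nhds (e.map_source (hm hy)))
  simp only [Function.comp_apply, tangentMapWithin, h2]
  -- The base points `e.symm (e (φ y))` and `φ y` are equal but not by definition. All tangent
  -- spaces being the model space `E`, the statement can be proved for a variable base point.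
  have h3 : ∀ (p q : P) (_ : p = q) (w : E),
      (⟨p, w⟩ : TangentBundle IP P) = (⟨q, w⟩ : TangentBundle IP P) := by rintro p _ rfl w; rfl
  exact h3 _ _ (e.left_inv (hm hy)).symm _

theorem ContMDiffOn.of_section [IsManifold IP ∞ P] {φ : S → P}
    {ν : ∀ y : S, TangentSpace IP (φ y)} {V : Set S}
    (hν : ContMDiffOn IS IP.tangent ∞ (fun y => (⟨φ y, ν y⟩ : TangentBundle IP P)) V) :
    ContMDiffOn IS IP ∞ φ V :=
  fun y hy => (Bundle.contMDiffWithinAt_totalSpace.1 (hν y hy)).1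

/-- The covariant derivative can be computed in any coordinate system. -/
theorem covDerivInner_eq [IP.Boundaryless] [IsManifold IP ∞ P] {γ : MetricField IP P}
    {e : OpenPartialHomeomorph P E'} {G : E' → E' →L[ℝ] E' →L[ℝ] ℝ} (h : IsMetricIn γ e G)
    {φ : S → P} {ν : ∀ y : S, TangentSpace IP (φ y)} {V : Set S} (hV : IsOpen V)
    (hν : ContMDiffOn IS IP.tangent ∞ (fun y => (⟨φ y, ν y⟩ : TangentBundle IP P)) V) {x : S}
    (hx : x ∈ V) (hxe : φ x ∈ e.source) (X : TangentSpace IS x) (b : TangentSpace IP (φ x)) :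
    covDerivInner IS γ φ ν x X b =
      G (e (φ x)) (mfderiv IS 𝓘(ℝ, E') (fun y => coordVec IP e (ν y)) x X) (coordVec IP e b) +
        coordChristoffel G (e (φ x)) (coordVec IP e (mfderiv IS IP φ x X))
          (coordVec IP e (ν x)) (coordVec IP e b) := by
  have hφ : ContMDiffOn IS IP ∞ φ V := hν.of_section
  have hφx : MDifferentiableAt IS IP φ x :=
    (hφ.contMDiffAt (hV.mem_nhds hx)).mdifferentiableAt (by simp)
  let z : P := φ x
  let κ := extChartAt IP z
  have hzκ : z ∈ κ.source := mem_extChartAt_source z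
  -- The transition map from the preferred chart, in which `covDerivInner` is defined, to the given
  -- coordinates.
  let τ : E → E' := e ∘ κ.symm
  let U : Set E := κ.target ∩ κ.symm ⁻¹' e.source
  have hU : IsOpen U := (continuousOn_extChartAt_symm z).isOpen_inter_preimage
    (isOpen_extChartAt_target z) e.open_source
  have hκs : ContMDiffOn 𝓘(ℝ, E) IP ∞ κ.symm κ.target := contMDiffOn_extChartAt_symm z
  have hκd : ∀ z' ∈ κ.source, MDifferentiableAt IP 𝓘(ℝ, E) κ z' := fun z' hz' =>
    ((contMDiffAt_extChartAt' (by rwa [← extChartAt_source IP])).mdifferentiableAt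
      (n := ∞) (by simp))
  have hτ : ContDiffOn ℝ ∞ τ U := contMDiffOn_iff_contDiffOn.1
    (h.coord.smooth.comp (hκs.mono inter_subset_left) fun y hy => hy.2)
  have hUκ : ∀ z' ∈ κ.source, z' ∈ e.source → κ z' ∈ U := fun z' h1 h2 =>
    ⟨κ.map_source h1, by rw [mem_preimage, κ.left_inv h1]; exact h2⟩
  have hτd : ∀ y ∈ U, HasFDerivAt τ (fderiv ℝ τ y) y := fun y hy =>
    ((hτ.contDiffAt (hU.mem_nhds hy)).differentiableAt (by simp)).hasFDerivAt
  have hvec : ∀ z' ∈ κ.source, z' ∈ e.source → ∀ a : TangentSpace IP z',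
      coordVec IP e a = fderiv ℝ τ (κ z') (chartVec IP z a) := by
    intro z' h1 h2 a
    have hc : HasMFDerivAt IP 𝓘(ℝ, E') (τ ∘ κ) z'
        ((fderiv ℝ τ (κ z')).comp (mfderiv IP 𝓘(ℝ, E) κ z')) :=
      (hτd _ (hUκ z' h1 h2)).hasMFDerivAt.comp z' (hκd z' h1).hasMFDerivAt
    have heq : (e : P → E') =ᶠ[𝓝 z'] τ ∘ κ := by
      filter_upwards [(isOpen_extChartAt_source z).mem_nhds h1] with w hw
      simp only [τ, Function.comp_apply]
      rw [κ.left_inv hw]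
    exact DFunLike.congr_fun (hc.congr_of_eventuallyEq heq).mfderiv a
  have hmet : ∀ y ∈ U, ∀ a b : E, chartMetric γ z a b y =
      G (τ y) (fderiv ℝ τ y a) (fderiv ℝ τ y b) := by
    intro y hy a b
    have hd : MDifferentiableAt 𝓘(ℝ, E) IP κ.symm y :=
      (hκs.contMDiffAt ((isOpen_extChartAt_target z).mem_nhds hy.1)).mdifferentiableAt (by simp)
    have hcomp : ∀ a : E, coordVec IP e (mfderiv 𝓘(ℝ, E) IP κ.symm y a) = fderiv ℝ τ y a := by
      intro a
      have h1 := mfderiv_comp y (h.coord.mdifferentiableAt hy.2) hd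
      rw [← mfderiv_eq_fderiv]
      exact (DFunLike.congr_fun h1 a).symm
    rw [chartMetric, h.eq _ hy.2]
    exact congrArg₂ (fun v w => G (τ y) v w) (hcomp a) (hcomp b)
  have hyU : κ z ∈ U := hUκ z hzκ hxe
  have hτz : τ (κ z) = e z := by simp only [τ, Function.comp_apply]; rw [κ.left_inv hzκ]
  have hfd : ∀ a b : E, fderiv ℝ (chartMetric γ z a b) (κ z) =
      fderiv ℝ (fun y => G (τ y) (fderiv ℝ τ y a) (fderiv ℝ τ y b)) (κ z) := by
    intro a b
    refine Filter.EventuallyEq.fderiv_eq ?_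
    filter_upwards [hU.mem_nhds hyU] with y hy using hmet y hy a b
  have hchr : ∀ a c b : E, christoffel γ z a c b = coordChristoffel G (τ (κ z))
      (fderiv ℝ τ (κ z) a) (fderiv ℝ τ (κ z) c) (fderiv ℝ τ (κ z) b) +
      G (τ (κ z)) (fderiv ℝ (fderiv ℝ τ) (κ z) a c) (fderiv ℝ τ (κ z) b) := by
    intro a c b
    rw [christoffel, hfd, hfd, hfd]
    exact christoffel_pullback_metric h.metric hU hτ hyU
      (by rw [hτz]; exact e.map_source hxe) a c b
  -- components of `ν`
  let V' : Set S := V ∩ φ ⁻¹' (κ.source ∩ e.source)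
  have hV' : IsOpen V' := hφ.continuousOn.isOpen_inter_preimage hV
    ((isOpen_extChartAt_source z).inter e.open_source)
  have hxV' : x ∈ V' := ⟨hx, hzκ, hxe⟩
  have hκν : MDifferentiableAt IS 𝓘(ℝ, E) (fun y => chartVec IP z (ν y)) x := by
    have h1 := ContMDiffOn.mfderiv_apply_section (hν.mono (inter_subset_left : V' ⊆ V))
      (isOpen_extChartAt_source z) (contMDiffOn_extChartAt (I := IP) (x := z) (n := ∞) |>.mono
        (by rw [extChartAt_source])) (fun y hy => hy.2.1)
    exact (h1.contMDiffAt (hV'.mem_nhds hxV')).mdifferentiableAt (by simp)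
  have hτ2 : HasFDerivAt (fderiv ℝ τ) (fderiv ℝ (fderiv ℝ τ) (κ z)) (κ z) :=
    (((contDiffOn_fderiv hU hτ).contDiffAt (hU.mem_nhds hyU)).differentiableAt
      (by simp)).hasFDerivAt
  -- The components of `ν` in `e` are `Dτ` applied to those in the chart. The product rule yields a
  -- term `D²τ(dφ X, ν)`, precisely the inhomogeneous term of `hchr`, so the two sides agree.
  have hνe : mfderiv IS 𝓘(ℝ, E') (fun y => coordVec IP e (ν y)) x X =
      fderiv ℝ (fderiv ℝ τ) (κ z) (chartVec IP z (mfderiv IS IP φ x X)) (chartVec IP z (ν x)) +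
      fderiv ℝ τ (κ z) (mfderiv IS 𝓘(ℝ, E) (fun y => chartVec IP z (ν y)) x X) := by
    let B : E × E → E' := fun q => fderiv ℝ τ q.1 q.2
    let w₀ : E := chartVec IP z (ν x)
    have hB : HasFDerivAt B ((fderiv ℝ τ (κ z)).comp (ContinuousLinearMap.snd ℝ E E) +
        ((fderiv ℝ (fderiv ℝ τ) (κ z)).comp (ContinuousLinearMap.fst ℝ E E)).flip w₀)
        (κ z, w₀) :=
      HasFDerivAt.clm_apply (HasFDerivAt.comp (g := fderiv ℝ τ) (κ z, w₀)
        hτ2 hasFDerivAt_fst) hasFDerivAt_snd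
    have hc : HasMFDerivAt IS 𝓘(ℝ, E) (κ ∘ φ) x
        ((mfderiv IP 𝓘(ℝ, E) κ z).comp (mfderiv IS IP φ x)) :=
      (hκd z hzκ).hasMFDerivAt.comp x hφx.hasMFDerivAt
    have hpair : HasMFDerivAt IS 𝓘(ℝ, E × E) (fun y => ((κ ∘ φ) y, chartVec IP z (ν y))) x
        (((mfderiv IP 𝓘(ℝ, E) κ z).comp (mfderiv IS IP φ x)).prod
          (mfderiv IS 𝓘(ℝ, E) (fun y => chartVec IP z (ν y)) x)) :=
      ⟨hc.1.prodMk hκν.hasMFDerivAt.1, hc.2.prodMk hκν.hasMFDerivAt.2⟩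
    have hcomp := HasMFDerivAt.comp (g := B) x hB.hasMFDerivAt hpair
    have heq : (fun y => coordVec IP e (ν y)) =ᶠ[𝓝 x]
        B ∘ fun y => ((κ ∘ φ) y, chartVec IP z (ν y)) := by
      filter_upwards [hV'.mem_nhds hxV'] with y hy using hvec _ hy.2.1 hy.2.2 _
    have := DFunLike.congr_fun (hcomp.congr_of_eventuallyEq heq).mfderiv X
    refine this.trans ?_
    exact add_comm _ _
  let w : E := mfderiv IS 𝓘(ℝ, E) (fun y => chartVec IP z (ν y)) x X
  let w' : E' := mfderiv IS 𝓘(ℝ, E') (fun y => coordVec IP e (ν y)) x X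
  have hw : w' = fderiv ℝ (fderiv ℝ τ) (κ z) (chartVec IP z (mfderiv IS IP φ x X))
    (chartVec IP z (ν x)) + fderiv ℝ τ (κ z) w := hνe
  change chartMetric γ z w (chartVec IP z b) (κ z) +
    christoffel γ z (chartVec IP z (mfderiv IS IP φ x X)) (chartVec IP z (ν x)) (chartVec IP z b) =
    G (e z) w' (coordVec IP e b) + coordChristoffel G (e z) (coordVec IP e (mfderiv IS IP φ x X))
      (coordVec IP e (ν x)) (coordVec IP e b)
  rw [hmet _ hyU, hchr, hw, hvec z hzκ hxe b,
    hvec z hzκ hxe (ν x), hvec z hzκ hxe (mfderiv IS IP φ x X), hτz, map_add, add_apply]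
  ring

end ChangeOfCoordinates
end

noncomputable section

section SmoothCoord

variable {E H P : Type*} [NormedAddCommGroup E] [NormedSpace ℝ E]
  [TopologicalSpace H] {IP : ModelWithCorners ℝ E H} [TopologicalSpace P] [ChartedSpace H P]
  {E' : Type*} [NormedAddCommGroup E'] [NormedSpace ℝ E']

theorem IsSmoothCoord.symm_coordVec {e : OpenPartialHomeomorph P E'} (he : IsSmoothCoord IP e) {z : P} (hz : z ∈ e.source)
    (X : TangentSpace IP z) : mfderiv 𝓘(ℝ, E') IP e.symm (e z) (coordVec IP e X : E') = X := by
  have h1 := mfderiv_comp z (he.mdifferentiableAt_symm (e.map_source hz)) (he.mdifferentiableAt hz)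
  have h2 : mfderiv IP IP (e.symm ∘ e) z = mfderiv IP IP id z :=
    Filter.EventuallyEq.mfderiv_eq (by
      filter_upwards [e.open_source.mem_nhds hz] with w hw using e.left_inv hw)
  rw [mfderiv_id, h1] at h2
  exact DFunLike.congr_fun h2 X

theorem IsSmoothCoord.coordVec_symm {e : OpenPartialHomeomorph P E'} (he : IsSmoothCoord IP e) {y : E'} (hy : y ∈ e.target)
    (a : E') : coordVec IP e (mfderiv 𝓘(ℝ, E') IP e.symm y a) = a := by
  have h1 := mfderiv_comp y (he.mdifferentiableAt (e.map_target hy)) (he.mdifferentiableAt_symm hy)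
  have h2 : mfderiv 𝓘(ℝ, E') 𝓘(ℝ, E') (e ∘ e.symm) y = mfderiv 𝓘(ℝ, E') 𝓘(ℝ, E') id y :=
    Filter.EventuallyEq.mfderiv_eq (by
      filter_upwards [e.open_target.mem_nhds hy] with w hw using e.right_inv hw)
  rw [mfderiv_id, h1] at h2
  exact DFunLike.congr_fun h2 a

theorem IsSmoothCoord.coordVec_surjective {e : OpenPartialHomeomorph P E'} (he : IsSmoothCoord IP e) {z : P} (hz : z ∈ e.source) (a : E') :
    ∃ X : TangentSpace IP z, coordVec IP e X = a := by
  have h := he.coordVec_symm (e.map_source hz) a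
  have h3 : ∀ (z' : P) (_ : z' = z) (X : TangentSpace IP z'), coordVec IP e X = a →
      ∃ X : TangentSpace IP z, coordVec IP e X = a := by
    rintro z' rfl X hX; exact ⟨X, hX⟩
  exact h3 _ (e.left_inv hz) _ h

end SmoothCoord

/-! ### Coefficients of a Riemannian metric in arbitrary coordinates. -/

section MetricCoordinates

variable {n : ℕ} {M : Type*} [TopologicalSpace M]
  [ChartedSpace (EuclideanSpace ℝ (Fin n)) M] [IsManifold (𝓡 n) ∞ M]
  {E' : Type*} [NormedAddCommGroup E'] [NormedSpace ℝ E'] [FiniteDimensional ℝ E']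

/-- The coefficients of a Riemannian metric in the coordinate system `e`. -/
def coordMetric (g : SmoothMetric n M) (e : OpenPartialHomeomorph M E') (y : E') :
    E' →L[ℝ] E' →L[ℝ] ℝ :=
  LinearMap.toContinuousLinearMap
    { toFun := fun a => (g.inner (e.symm y) (mfderiv 𝓘(ℝ, E') (𝓡 n) e.symm y a)).comp
        (mfderiv 𝓘(ℝ, E') (𝓡 n) e.symm y)
      map_add' := fun a b => by
        apply ContinuousLinearMap.ext
        intro c
        have : mfderiv 𝓘(ℝ, E') (𝓡 n) e.symm y (a + b) =
          mfderiv 𝓘(ℝ, E') (𝓡 n) e.symm y a + mfderiv 𝓘(ℝ, E') (𝓡 n) e.symm y b := map_add _ _ _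
        simp only [this, map_add]
        rfl
      map_smul' := fun r a => by
        apply ContinuousLinearMap.ext
        intro c
        have : mfderiv 𝓘(ℝ, E') (𝓡 n) e.symm y (r • a) =
          r • mfderiv 𝓘(ℝ, E') (𝓡 n) e.symm y a := map_smul _ _ _
        simp only [this, map_smul]
        rfl }

theorem coordMetric_apply (g : SmoothMetric n M) (e : OpenPartialHomeomorph M E') (y a b : E') :
    coordMetric g e y a b = g.inner (e.symm y) (mfderiv 𝓘(ℝ, E') (𝓡 n) e.symm y a)
      (mfderiv 𝓘(ℝ, E') (𝓡 n) e.symm y b) := rfl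

/-- Every Riemannian metric has an expression in every smooth coordinate system. -/
theorem isMetricIn_coordMetric (g : SmoothMetric n M) {e : OpenPartialHomeomorph M E'}
    (he : IsSmoothCoord (𝓡 n) e) : IsMetricIn (metricField g) e (coordMetric g e) := by
  have : IsManifold (𝓡 n) 1 M := IsManifold.of_le (n := ∞) (by simp)
  refine ⟨he, ⟨e.open_target, ?_, ?_, ?_⟩, ?_⟩
  · rw [contDiffOn_clm_apply]
    intro a
    rw [contDiffOn_clm_apply]
    intro b
    rw [← contMDiffOn_iff_contDiffOn]
    have hsec : ∀ a : E', ContMDiffOn 𝓘(ℝ, E') (𝓡 n).tangent ∞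
        (fun y => (⟨e.symm y, mfderiv 𝓘(ℝ, E') (𝓡 n) e.symm y a⟩ : TangentBundle (𝓡 n) M))
        e.target := by
      intro a
      have h0 : ContMDiffOn 𝓘(ℝ, E') 𝓘(ℝ, E').tangent ∞
          (fun y => (⟨y, a⟩ : TangentBundle 𝓘(ℝ, E') E')) e.target := by
        intro y hy
        refine Bundle.contMDiffWithinAt_totalSpace.2 ⟨contMDiffWithinAt_id, ?_⟩
        refine (contMDiffWithinAt_const (c := a)).congr (fun y' _ => ?_) ?_ <;> simp
      have h1 := (he.smooth_symm.contMDiffOn_tangentMapWithin (m := ∞) (by simp)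
        e.open_target.uniqueMDiffOn).comp h0 (fun y hy => hy)
      refine h1.congr fun y hy => ?_
      simp only [Function.comp_apply, tangentMapWithin]
      congr 2
      exact (mfderivWithin_of_mem_nhds (e.open_target.mem_nhds hy)).symm
    intro y hy
    have key : ContMDiffWithinAt 𝓘(ℝ, E') ((𝓡 n).prod 𝓘(ℝ, ℝ)) ∞
        (fun y => Bundle.TotalSpace.mk' ℝ (E := Bundle.Trivial M ℝ) (e.symm y)
          (g.inner (e.symm y) (mfderiv 𝓘(ℝ, E') (𝓡 n) e.symm y a)
            (mfderiv 𝓘(ℝ, E') (𝓡 n) e.symm y b))) e.target y := by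
      apply ContMDiffWithinAt.clm_bundle_apply₂ (F₁ := EuclideanSpace ℝ (Fin n))
        (F₂ := EuclideanSpace ℝ (Fin n))
      · exact ContMDiffAt.comp_contMDiffWithinAt y g.contMDiff.contMDiffAt (he.smooth_symm y hy)
      · exact hsec a y hy
      · exact hsec b y hy
    rw [Bundle.contMDiffWithinAt_totalSpace] at key
    exact key.2
  · intro y hy a b
    exact g.symm _ _ _
  · intro y hy a ha
    refine g.pos _ _ fun h => ha ?_
    rw [← he.coordVec_symm hy a, h]
    exact map_zero _
  · intro z hz X Y
    rw [coordMetric_apply]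
    have h3 : ∀ (z' : M) (_ : z' = z) (X' Y' : EuclideanSpace ℝ (Fin n)), X' = X → Y' = Y →
        metricField g z X Y = metricField g z' X' Y' := by
      rintro _ rfl _ _ rfl rfl; rfl
    exact h3 _ (e.left_inv hz) _ _ (he.symm_coordVec hz X) (he.symm_coordVec hz Y)

end MetricCoordinates
end

noncomputable section

/-! ### Total umbilicity in coordinates and under reparametrization. -/

section Umbilical

variable {E H P : Type*} [NormedAddCommGroup E] [NormedSpace ℝ E]
  [TopologicalSpace H] {IP : ModelWithCorners ℝ E H} [TopologicalSpace P] [ChartedSpace H P]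
  {ES HS S : Type*} [NormedAddCommGroup ES] [NormedSpace ℝ ES] [TopologicalSpace HS]
  {IS : ModelWithCorners ℝ ES HS} [TopologicalSpace S] [ChartedSpace HS S]
  {ES' HS' S' : Type*} [NormedAddCommGroup ES'] [NormedSpace ℝ ES'] [TopologicalSpace HS']
  {IS' : ModelWithCorners ℝ ES' HS'} [TopologicalSpace S'] [ChartedSpace HS' S']
  {E' : Type*} [NormedAddCommGroup E'] [NormedSpace ℝ E']

theorem IsSmoothCoord.coordVec_symm_self {e : OpenPartialHomeomorph P E'}
    (he : IsSmoothCoord IP e) {z : P} (hz : z ∈ e.source) (a : E') :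
    coordVec IP e (z := z) (mfderiv 𝓘(ℝ, E') IP e.symm (e z) a : E) = a := by
  have h3 : ∀ (z' : P) (_ : z' = z) (X : E), coordVec IP e (z := z') X = a →
      coordVec IP e (z := z) X = a := by
    rintro z' rfl X hX; exact hX
  exact h3 _ (e.left_inv hz) _ (he.coordVec_symm (e.map_source hz) a)

/-- The composition of a totally umbilical map with a smooth map is totally umbilical. -/
theorem IsTotallyUmbilicalOn.comp [IsManifold IP ∞ P] {γ : MetricField IP P} {φ : S → P}
    {U : Set S} (h : IsTotallyUmbilicalOn IS γ φ U) {χ : S' → S} {U' : Set S'} (hU' : IsOpen U')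
    (hχ : ContMDiffOn IS' IS ∞ χ U') (hm : MapsTo χ U' U) :
    IsTotallyUmbilicalOn IS' γ (φ ∘ χ) U' := by
  intro x hx
  obtain ⟨V, hV, hxV, -, ν, l, hν, hl⟩ := h (χ x) (hm hx)
  have hV' : IsOpen (U' ∩ χ ⁻¹' V) := hχ.continuousOn.isOpen_inter_preimage hU' hV
  have hχd : ∀ y ∈ U' ∩ χ ⁻¹' V, MDifferentiableAt IS' IS χ y := fun y hy =>
    (hχ.contMDiffAt (hU'.mem_nhds hy.1)).mdifferentiableAt (by simp)
  have hφd : ∀ y ∈ V, MDifferentiableAt IS IP φ y := fun y hy =>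
    (hν.smooth.of_section.contMDiffAt (hV.mem_nhds hy)).mdifferentiableAt (by simp)
  have hcomp : ∀ y ∈ U' ∩ χ ⁻¹' V, ∀ X : TangentSpace IS' y,
      mfderiv IS' IP (φ ∘ χ) y X = mfderiv IS IP φ (χ y) (mfderiv IS' IS χ y X) := by
    intro y hy X
    exact DFunLike.congr_fun (mfderiv_comp y (hφd _ hy.2) (hχd y hy)) X
  refine ⟨U' ∩ χ ⁻¹' V, hV', ⟨hx, hxV⟩, inter_subset_left, fun y => ν (χ y), fun y => l (χ y),
    ⟨?_, fun y hy => hν.unit _ hy.2, fun y hy X => ?_⟩, fun y hy X b => ?_⟩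
  · exact hν.smooth.comp (hχ.mono inter_subset_left) fun y hy => hy.2
  · rw [hcomp y hy]; exact hν.normal _ hy.2 _
  · rw [hcomp y hy]
    refine Eq.trans ?_ (hl (χ y) hy.2 (mfderiv IS' IS χ y X) b)
    have hd : MDifferentiableAt IS 𝓘(ℝ, E) (fun w => chartVec IP (φ (χ y)) (ν w)) (χ y) := by
      have hV'' : IsOpen (V ∩ φ ⁻¹' (extChartAt IP (φ (χ y))).source) :=
        hν.smooth.of_section.continuousOn.isOpen_inter_preimage hV (isOpen_extChartAt_source _)
      have h1 := ContMDiffOn.mfderiv_apply_section (hν.smooth.mono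
        (inter_subset_left : V ∩ φ ⁻¹' (extChartAt IP (φ (χ y))).source ⊆ V))
        (isOpen_extChartAt_source (φ (χ y))) (contMDiffOn_extChartAt (I := IP)
          (x := φ (χ y)) (n := ∞) |>.mono (by rw [extChartAt_source])) (fun y hy => hy.2)
      exact (h1.contMDiffAt (hV''.mem_nhds ⟨hy.2, mem_extChartAt_source _⟩)).mdifferentiableAt
        (by simp)
    have h2 : mfderiv IS' 𝓘(ℝ, E) (fun w => chartVec IP (φ (χ y)) (ν (χ w))) y X =
        mfderiv IS 𝓘(ℝ, E) (fun w => chartVec IP (φ (χ y)) (ν w)) (χ y)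
          (mfderiv IS' IS χ y X) :=
      DFunLike.congr_fun (mfderiv_comp y hd (hχd y hy)) X
    simp only [covDerivInner]
    rw [hcomp y hy]
    exact congrArg (fun w : E => -(chartMetric γ (φ (χ y)) w _ _ + _)) h2

/-- Total umbilicity in coordinates, for a hypersurface parametrized by an open subset of a normed
space. -/
theorem IsTotallyUmbilicalOn.exists_coord [IP.Boundaryless] [IsManifold IP ∞ P]
    {γ : MetricField IP P} {e : OpenPartialHomeomorph P E'} {G : E' → E' →L[ℝ] E' →L[ℝ] ℝ}
    (he : IsMetricIn γ e G) {φ : ES → P} {U : Set ES} (hm : MapsTo φ U e.source)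
    (h : IsTotallyUmbilicalOn 𝓘(ℝ, ES) γ φ U) {x : ES} (hx : x ∈ U) :
    ∃ V : Set ES, IsOpen V ∧ x ∈ V ∧ V ⊆ U ∧ ∃ (v : ES → E') (l : ES → ℝ),
      ContDiffOn ℝ ∞ v V ∧ ∀ y ∈ V, G (e (φ y)) (v y) (v y) = 1 ∧
        (∀ a, G (e (φ y)) (v y) (fderiv ℝ (e ∘ φ) y a) = 0) ∧
        ∀ a b, G (e (φ y)) (fderiv ℝ v y a) b +
          coordChristoffel G (e (φ y)) (fderiv ℝ (e ∘ φ) y a) (v y) b =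
            - l y * G (e (φ y)) (fderiv ℝ (e ∘ φ) y a) b := by
  obtain ⟨V, hV, hxV, hVU, ν, l, hν, hl⟩ := h x hx
  have hφ := hν.smooth.of_section
  have hcomp : ∀ y ∈ V, ∀ a : ES, coordVec IP e (mfderiv 𝓘(ℝ, ES) IP φ y a) =
      fderiv ℝ (e ∘ φ) y a := by
    intro y hy a
    have h1 := mfderiv_comp y (he.coord.mdifferentiableAt (hm (hVU hy)))
      ((hφ.contMDiffAt (hV.mem_nhds hy)).mdifferentiableAt (by simp))
    rw [← mfderiv_eq_fderiv]
    exact (DFunLike.congr_fun h1 a).symm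
  refine ⟨V, hV, hxV, hVU, fun y => coordVec IP e (ν y), l, ?_, fun y hy => ⟨?_, fun a => ?_,
    fun a b => ?_⟩⟩
  · exact contMDiffOn_iff_contDiffOn.1 (ContMDiffOn.mfderiv_apply_section hν.smooth e.open_source
      he.coord.smooth (hm.mono_left hVU))
  · rw [← he.eq _ (hm (hVU hy))]; exact hν.unit y hy
  · rw [← hcomp y hy, ← he.eq _ (hm (hVU hy))]; exact hν.normal y hy a
  · obtain ⟨b, rfl⟩ := he.coord.coordVec_surjective (hm (hVU hy)) b
    have h2 : covDerivInner 𝓘(ℝ, ES) γ φ ν y a b =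
        G (e (φ y)) (fderiv ℝ (fun y => coordVec IP e (ν y)) y a) (coordVec IP e b) +
        coordChristoffel G (e (φ y)) (fderiv ℝ (e ∘ φ) y a) (coordVec IP e (ν y))
          (coordVec IP e b) := by
      rw [← hcomp y hy a, ← mfderiv_eq_fderiv]
      exact covDerivInner_eq he hV hν.smooth hy (hm (hVU hy)) _ _
    have h3 : γ (φ y) (mfderiv 𝓘(ℝ, ES) IP φ y a) b =
        G (e (φ y)) (fderiv ℝ (e ∘ φ) y a) (coordVec IP e b) := by
      rw [← hcomp y hy a]
      exact he.eq _ (hm (hVU hy)) _ _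
    rw [← h2, ← h3, neg_mul, ← neg_eq_iff_eq_neg]
    exact hl y hy a b

/-- A criterion for total umbilicity, in coordinates. -/
theorem isTotallyUmbilicalOn_of_coord [IP.Boundaryless] [IsManifold IP ∞ P]
    {γ : MetricField IP P} {φ : S → P} {U : Set S}
    (h : ∀ x ∈ U, ∃ (e : OpenPartialHomeomorph P E') (G : E' → E' →L[ℝ] E' →L[ℝ] ℝ) (V : Set S)
      (v : S → E') (l : S → ℝ), IsMetricIn γ e G ∧ IsOpen V ∧ x ∈ V ∧ V ⊆ U ∧
      MapsTo φ V e.source ∧ ContMDiffOn IS IP ∞ φ V ∧ ContMDiffOn IS 𝓘(ℝ, E') ∞ v V ∧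
      ∀ y ∈ V, G (e (φ y)) (v y) (v y) = 1 ∧
        ∀ X : TangentSpace IS y,
          G (e (φ y)) (v y) (coordVec IP e (mfderiv IS IP φ y X)) = 0 ∧
          ∀ b, G (e (φ y)) (mfderiv IS 𝓘(ℝ, E') v y X) b +
            coordChristoffel G (e (φ y)) (coordVec IP e (mfderiv IS IP φ y X)) (v y) b =
              - l y * G (e (φ y)) (coordVec IP e (mfderiv IS IP φ y X)) b) :
    IsTotallyUmbilicalOn IS γ φ U := by
  intro x hx
  obtain ⟨e, G, V, v, l, he, hV, hxV, hVU, hm, hφ, hv, hall⟩ := h x hx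
  -- The normal field is rebuilt from its components; outside `V` its values are irrelevant.
  let ν : ∀ y : S, TangentSpace IP (φ y) := fun y =>
    (mfderiv 𝓘(ℝ, E') IP e.symm (e (φ y)) (v y) : E)
  have hνv : ∀ y ∈ V, coordVec IP e (ν y) = v y := fun y hy =>
    he.coord.coordVec_symm_self (hm hy) (v y)
  have hs : ContMDiffOn IS IP.tangent ∞ (fun y => (⟨φ y, ν y⟩ : TangentBundle IP P)) V :=
    contMDiffOn_section_of_coord hφ he.coord hm hv
  refine ⟨V, hV, hxV, hVU, ν, l, ⟨hs, fun y hy => ?_, fun y hy X => ?_⟩, fun y hy X b => ?_⟩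
  · rw [he.eq _ (hm hy), hνv y hy]; exact (hall y hy).1
  · rw [he.eq _ (hm hy), hνv y hy]; exact ((hall y hy).2 X).1
  · rw [covDerivInner_eq he hV hs hy (hm hy), he.eq _ (hm hy), hνv y hy]
    have h1 : mfderiv IS 𝓘(ℝ, E') (fun y => coordVec IP e (ν y)) y = mfderiv IS 𝓘(ℝ, E') v y :=
      Filter.EventuallyEq.mfderiv_eq (by filter_upwards [hV.mem_nhds hy] with w hw using hνv w hw)
    have h2 := ((hall y hy).2 X).2 (coordVec IP e b)
    have h3 : (mfderiv IS 𝓘(ℝ, E') (fun y => coordVec IP e (ν y)) y X : E') =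
      (mfderiv IS 𝓘(ℝ, E') v y X : E') := DFunLike.congr_fun h1 X
    have h5 : -(G (e (φ y)) (mfderiv IS 𝓘(ℝ, E') v y X) (coordVec IP e b) +
        coordChristoffel G (e (φ y)) (coordVec IP e (mfderiv IS IP φ y X)) (v y)
          (coordVec IP e b)) =
        l y * G (e (φ y)) (coordVec IP e (mfderiv IS IP φ y X)) (coordVec IP e b) := by
      rw [neg_eq_iff_eq_neg, ← neg_mul]; exact h2
    exact (congrArg (fun w : E' => -(G (e (φ y)) w (coordVec IP e b) +
      coordChristoffel G (e (φ y)) (coordVec IP e (mfderiv IS IP φ y X)) (v y)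
        (coordVec IP e b))) h3).trans h5

end Umbilical

/-! ### The product with a line, in coordinates. -/

section Product

variable {E' : Type*} [NormedAddCommGroup E'] [NormedSpace ℝ E']

theorem fderiv_apply_apply {E F : Type*} [NormedAddCommGroup E] [NormedSpace ℝ E]
    [NormedAddCommGroup F] [NormedSpace ℝ F] {G : E → F →L[ℝ] F →L[ℝ] ℝ}
    {y : E} (hG : DifferentiableAt ℝ G y) (d : E) (a b : F) :
    fderiv ℝ G y d a b = fderiv ℝ (fun z => G z a b) y d := by
  have := ((hG.hasFDerivAt.clm_apply (hasFDerivAt_const a y)).clm_apply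
    (hasFDerivAt_const b y)).fderiv
  rw [this]
  simp

/-- The product of a metric with the standard metric of the line, in coordinates. -/
def prodCoordMetric (G : E' → E' →L[ℝ] E' →L[ℝ] ℝ) (y : E' × ℝ) :
    (E' × ℝ) →L[ℝ] (E' × ℝ) →L[ℝ] ℝ :=
  (G y.1).bilinearComp (ContinuousLinearMap.fst ℝ E' ℝ) (ContinuousLinearMap.fst ℝ E' ℝ) +
    (ContinuousLinearMap.mul ℝ ℝ).bilinearComp (ContinuousLinearMap.snd ℝ E' ℝ)
      (ContinuousLinearMap.snd ℝ E' ℝ)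

theorem prodCoordMetric_apply (G : E' → E' →L[ℝ] E' →L[ℝ] ℝ) (y a b : E' × ℝ) :
    prodCoordMetric G y a b = G y.1 a.1 b.1 + a.2 * b.2 := rfl

theorem IsCoordMetric.prod [FiniteDimensional ℝ E'] {G : E' → E' →L[ℝ] E' →L[ℝ] ℝ} {V : Set E'}
    (hG : IsCoordMetric G V) : IsCoordMetric (prodCoordMetric G) (V ×ˢ univ) := by
  refine ⟨hG.isOpen.prod isOpen_univ, ?_, fun y hy a b => ?_, fun y hy a ha => ?_⟩
  · rw [contDiffOn_clm_apply]
    intro a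
    rw [contDiffOn_clm_apply]
    intro b
    simp only [prodCoordMetric_apply]
    refine ContDiffOn.add ?_ contDiffOn_const
    have : ContDiffOn ℝ ∞ (fun y => G y a.1 b.1) V :=
      (hG.smooth.clm_apply contDiffOn_const).clm_apply contDiffOn_const
    exact this.comp contDiff_fst.contDiffOn fun y hy => hy.1
  · rw [prodCoordMetric_apply, prodCoordMetric_apply, hG.symm _ hy.1, mul_comm]
  · rw [prodCoordMetric_apply]
    by_cases h1 : a.1 = 0
    · have h2 : a.2 ≠ 0 := fun h2 => ha (Prod.ext h1 h2)
      rw [h1, map_zero, zero_add]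
      exact mul_self_pos.2 h2
    · exact add_pos_of_pos_of_nonneg (hG.pos _ hy.1 _ h1) (mul_self_nonneg _)

/-- The coefficients do not depend on the last coordinate and the line contributes a constant
summand. This is where the parallelism of `ξ` enters. -/
theorem coordChristoffel_prod [FiniteDimensional ℝ E'] {G : E' → E' →L[ℝ] E' →L[ℝ] ℝ} {V : Set E'}
    (hG : IsCoordMetric G V) {y : E' × ℝ} (hy : y.1 ∈ V) (a c b : E' × ℝ) :
    coordChristoffel (prodCoordMetric G) y a c b = coordChristoffel G y.1 a.1 c.1 b.1 := by
  have key : ∀ d a b : E' × ℝ, fderiv ℝ (prodCoordMetric G) y d a b =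
      fderiv ℝ G y.1 d.1 a.1 b.1 := by
    intro d a b
    rw [fderiv_apply_apply (hG.prod.differentiableAt ⟨hy, mem_univ _⟩),
      fderiv_apply_apply (hG.differentiableAt hy)]
    simp only [prodCoordMetric_apply]
    have h1 : HasFDerivAt (fun z => G z a.1 b.1) (fderiv ℝ (fun z => G z a.1 b.1) y.1) y.1 :=
      (((hG.differentiableAt hy).clm_apply (differentiableAt_const _)).clm_apply
        (differentiableAt_const _)).hasFDerivAt
    have h2 := (HasFDerivAt.comp (g := fun z => G z a.1 b.1) y h1 hasFDerivAt_fst).add_const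
      (a.2 * b.2)
    rw [HasFDerivAt.fderiv (f := fun z : E' × ℝ => G z.1 a.1 b.1 + a.2 * b.2) h2]
    rfl
  simp only [coordChristoffel, key]

variable {n : ℕ} {M : Type*} [TopologicalSpace M]
  [ChartedSpace (EuclideanSpace ℝ (Fin n)) M] [IsManifold (𝓡 n) ∞ M]

/-- The coordinate system on `M × ℝ` obtained from one on `M`. -/
def prodCoord (e : OpenPartialHomeomorph M E') : OpenPartialHomeomorph (M × ℝ) (E' × ℝ) :=
  e.prod (OpenPartialHomeomorph.refl ℝ)

theorem mem_prodCoord_source {e : OpenPartialHomeomorph M E'} {z : M × ℝ} :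
    z ∈ (prodCoord e).source ↔ z.1 ∈ e.source := by
  simp [prodCoord]

theorem IsSmoothCoord.prod {e : OpenPartialHomeomorph M E'} (he : IsSmoothCoord (𝓡 n) e) :
    IsSmoothCoord ((𝓡 n).prod 𝓘(ℝ, ℝ)) (prodCoord e) := by
  constructor
  · exact (he.smooth.comp contMDiff_fst.contMDiffOn fun z hz => hz.1).prodMk_space
      contMDiff_snd.contMDiffOn
  · exact (he.smooth_symm.comp (contDiff_fst (𝕜 := ℝ) (E := E') (F := ℝ)).contMDiff.contMDiffOn
      fun z hz => hz.1).prodMk (contDiff_snd (𝕜 := ℝ) (E := E') (F := ℝ)).contMDiff.contMDiffOn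

theorem coordVec_prodCoord {e : OpenPartialHomeomorph M E'} (he : IsSmoothCoord (𝓡 n) e)
    {z : M × ℝ} (hz : z.1 ∈ e.source) (X : TangentSpace ((𝓡 n).prod 𝓘(ℝ, ℝ)) z) :
    coordVec ((𝓡 n).prod 𝓘(ℝ, ℝ)) (prodCoord e) X =
      (coordVec (𝓡 n) e (z := z.1) X.1, X.2) := by
  have h1 : HasMFDerivAt ((𝓡 n).prod 𝓘(ℝ, ℝ)) 𝓘(ℝ, E') (e ∘ Prod.fst) z
      ((mfderiv (𝓡 n) 𝓘(ℝ, E') e z.1).comp (ContinuousLinearMap.fst ℝ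
        (TangentSpace (𝓡 n) z.1) (TangentSpace 𝓘(ℝ, ℝ) z.2))) :=
    (he.mdifferentiableAt hz).hasMFDerivAt.comp z (hasMFDerivAt_fst z)
  have h2 : HasMFDerivAt ((𝓡 n).prod 𝓘(ℝ, ℝ)) 𝓘(ℝ, ℝ) (Prod.snd : M × ℝ → ℝ) z
      (ContinuousLinearMap.snd ℝ
        (TangentSpace (𝓡 n) z.1) (TangentSpace 𝓘(ℝ, ℝ) z.2)) := hasMFDerivAt_snd z
  have h3 : HasMFDerivAt ((𝓡 n).prod 𝓘(ℝ, ℝ)) 𝓘(ℝ, E' × ℝ)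
      (fun z : M × ℝ => ((e ∘ Prod.fst) z, z.2)) z
      (((mfderiv (𝓡 n) 𝓘(ℝ, E') e z.1).comp (ContinuousLinearMap.fst ℝ
        (TangentSpace (𝓡 n) z.1) (TangentSpace 𝓘(ℝ, ℝ) z.2))).prod
        (ContinuousLinearMap.snd ℝ
        (TangentSpace (𝓡 n) z.1) (TangentSpace 𝓘(ℝ, ℝ) z.2))) := ⟨h1.1.prodMk h2.1, h1.2.prodMk h2.2⟩
  exact DFunLike.congr_fun h3.mfderiv X

theorem IsMetricIn.prod [FiniteDimensional ℝ E'] {g : SmoothMetric n M}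
    {e : OpenPartialHomeomorph M E'} {G : E' → E' →L[ℝ] E' →L[ℝ] ℝ}
    (h : IsMetricIn (metricField g) e G) :
    IsMetricIn (prodMetric g) (prodCoord e) (prodCoordMetric G) := by
  refine ⟨h.coord.prod, h.metric.prod, fun z hz X Y => ?_⟩
  rw [mem_prodCoord_source] at hz
  rw [coordVec_prodCoord h.coord hz, coordVec_prodCoord h.coord hz, prodCoordMetric_apply]
  have := h.eq z.1 hz X.1 Y.1
  exact congrArg (fun r : ℝ => r + X.2 * Y.2) this

end Product
end

noncomputable section

/-! ### Parametrization of regular level sets. -/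

section LevelSet

/-- A regular level set of a smooth function has a local parametrization. -/
theorem exists_levelSet_param {E F : Type*} [NormedAddCommGroup E] [NormedSpace ℝ E]
    [FiniteDimensional ℝ E] [NormedAddCommGroup F] [NormedSpace ℝ F] [FiniteDimensional ℝ F]
    (hdim : Module.finrank ℝ F + 1 = Module.finrank ℝ E) {h : E → ℝ} {V : Set E} (hV : IsOpen V)
    (hh : ContDiffOn ℝ ∞ h V) {y₀ : E} (hy₀ : y₀ ∈ V) (hne : fderiv ℝ h y₀ ≠ 0) :
    ∃ r > 0, ∃ ι : F → E, ContDiffOn ℝ ∞ ι (Metric.ball 0 r) ∧ ι 0 = y₀ ∧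
      (∀ u ∈ Metric.ball (0 : F) r, ι u ∈ V ∧ ∀ a, fderiv ℝ h (ι u) (fderiv ℝ ι u a) = 0) ∧
      ∀ a, fderiv ℝ ι 0 a = 0 → a = 0 := by
  have : CompleteSpace F := FiniteDimensional.complete ℝ F
  obtain ⟨w, hw⟩ : ∃ w, fderiv ℝ h y₀ w = 1 := by
    obtain ⟨w, hw⟩ : ∃ w, fderiv ℝ h y₀ w ≠ 0 := by
      by_contra! hcon
      exact hne (ContinuousLinearMap.ext hcon)
    exact ⟨(fderiv ℝ h y₀ w)⁻¹ • w, by simp [hw]⟩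
  have hsurj : Function.Surjective (fderiv ℝ h y₀ : E →ₗ[ℝ] ℝ) := fun r => ⟨r • w, by simp [hw]⟩
  have hker : Module.finrank ℝ F = Module.finrank ℝ (LinearMap.ker (fderiv ℝ h y₀ : E →ₗ[ℝ] ℝ)) := by
    have := LinearMap.finrank_range_add_finrank_ker (fderiv ℝ h y₀ : E →ₗ[ℝ] ℝ)
    rw [LinearMap.range_eq_top.2 hsurj, finrank_top, Module.finrank_self] at this
    omega
  let A₀ : F ≃ₗ[ℝ] LinearMap.ker (fderiv ℝ h y₀ : E →ₗ[ℝ] ℝ) := LinearEquiv.ofFinrankEq _ _ hker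
  let A : F →L[ℝ] E := LinearMap.toContinuousLinearMap ((Submodule.subtype _).comp A₀.toLinearMap)
  have hA : ∀ u, fderiv ℝ h y₀ (A u) = 0 := fun u => (A₀ u).2
  have hAinj : ∀ u, A u = 0 → u = 0 := fun u hu => by
    have : A₀ u = 0 := Subtype.ext hu
    simpa using this
  let Θ : ℝ × F → E := fun z => y₀ + z.1 • w + A z.2
  have hΘ : ContDiff ℝ ∞ Θ := (contDiff_const.add (contDiff_fst.smul contDiff_const)).add
    (A.contDiff.comp contDiff_snd)
  have hΘ0 : Θ 0 = y₀ := by simp [Θ]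
  have hΘd : HasFDerivAt Θ ((ContinuousLinearMap.fst ℝ ℝ F).smulRight w +
      A.comp (ContinuousLinearMap.snd ℝ ℝ F)) 0 := by
    have h1 : HasFDerivAt (fun z : ℝ × F => z.1 • w)
      ((ContinuousLinearMap.fst ℝ ℝ F).smulRight w) 0 :=
      ((ContinuousLinearMap.fst ℝ ℝ F).smulRight w).hasFDerivAt
    have h2 : HasFDerivAt (fun z : ℝ × F => A z.2) (A.comp (ContinuousLinearMap.snd ℝ ℝ F)) 0 :=
      (A.comp (ContinuousLinearMap.snd ℝ ℝ F)).hasFDerivAt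
    exact (h1.const_add y₀).add h2
  let Ω : Set (ℝ × F) := Θ ⁻¹' V
  have hΩ : IsOpen Ω := hV.preimage hΘ.continuous
  have hΩ0 : (0 : ℝ × F) ∈ Ω := by change Θ 0 ∈ V; rwa [hΘ0]
  -- In the affine coordinates `Θ`, with `dh(w) = 1` and `A` onto the kernel of `dh`, this map has
  -- the identity as its derivative at `0`. Its local inverse straightens the level set to `{0} ×
  -- F`.
  let Q : ℝ × F → ℝ × F := fun z => (h (Θ z) - h y₀, z.2)
  have hhΘ : ContDiffOn ℝ ∞ (fun z => h (Θ z)) Ω := hh.comp hΘ.contDiffOn fun z hz => hz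
  have hQ : ContDiffOn ℝ ∞ Q Ω := (hhΘ.sub contDiffOn_const).prodMk contDiff_snd.contDiffOn
  have hhd : HasFDerivAt h (fderiv ℝ h y₀) (Θ 0) := by
    rw [hΘ0]
    exact ((hh.contDiffAt (hV.mem_nhds hy₀)).differentiableAt (by simp)).hasFDerivAt
  have hQ' : HasFDerivAt Q ((ContinuousLinearEquiv.refl ℝ (ℝ × F) :
      (ℝ × F) ≃L[ℝ] (ℝ × F)) : ℝ × F →L[ℝ] ℝ × F) 0 := by
    refine HasFDerivAt.congr_fderiv (f := Q)
      ((((hhd.comp 0 hΘd)).sub_const (h y₀)).prodMk hasFDerivAt_snd) ?_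
    apply ContinuousLinearMap.ext
    intro z
    refine Prod.ext ?_ rfl
    change fderiv ℝ h y₀ (z.1 • w + A z.2) = z.1
    rw [map_add, map_smul, hw, hA]
    simp
  obtain ⟨e, he0, heΩ, heQ, hes⟩ := exists_smooth_openPartialHomeomorph hΩ hQ hΩ0 _ hQ'
  have hQ0 : Q 0 = 0 := by simp [Q, hΘ0]
  let D : Set F := (fun u => ((0 : ℝ), u)) ⁻¹' e.target
  have hD : D ∈ 𝓝 (0 : F) := by
    refine (e.open_target.preimage (by fun_prop)).mem_nhds ?_
    change (0 : ℝ × F) ∈ e.target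
    rw [← hQ0, ← heQ]; exact e.map_source he0
  obtain ⟨r, hr, hrD⟩ := Metric.mem_nhds_iff.1 hD
  let ι : F → E := fun u => Θ (e.symm (0, u))
  have hι : ContDiffOn ℝ ∞ ι (Metric.ball 0 r) := hΘ.comp_contDiffOn
    (hes.comp (contDiff_prodMk_right _).contDiffOn fun u hu => hrD hu)
  have hval : ∀ u ∈ Metric.ball (0 : F) r, h (ι u) = h y₀ ∧ (e.symm (0, u)).2 = u := by
    intro u hu
    have h1 : Q (e.symm (0, u)) = (0, u) := by rw [← heQ, e.right_inv (hrD hu)]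
    exact ⟨sub_eq_zero.1 (congrArg Prod.fst h1), congrArg Prod.snd h1⟩
  have hιV : ∀ u ∈ Metric.ball (0 : F) r, ι u ∈ V := fun u hu =>
    heΩ (e.map_target (hrD hu))
  have hι0 : ι 0 = y₀ := by
    have : e.symm (0, 0) = 0 := by
      have h1 : ((0 : ℝ), (0 : F)) = e 0 := by rw [heQ, hQ0]; rfl
      rw [h1, e.left_inv he0]
    simp only [ι, this, hΘ0]
  have hdι : ∀ u ∈ Metric.ball (0 : F) r, HasFDerivAt ι (fderiv ℝ ι u) u := fun u hu =>
    ((hι.contDiffAt (Metric.isOpen_ball.mem_nhds hu)).differentiableAt (by simp)).hasFDerivAt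
  have hperp : ∀ u ∈ Metric.ball (0 : F) r, ∀ a, fderiv ℝ h (ι u) (fderiv ℝ ι u a) = 0 := by
    intro u hu a
    have h1 := ((hh.contDiffAt (hV.mem_nhds (hιV u hu))).differentiableAt
      (by simp)).hasFDerivAt.comp u (hdι u hu)
    have h2 : HasFDerivAt (h ∘ ι) (0 : F →L[ℝ] ℝ) u := by
      refine (hasFDerivAt_const (h y₀) u).congr_of_eventuallyEq ?_
      filter_upwards [Metric.isOpen_ball.mem_nhds hu] with u' hu' using (hval u' hu').1
    exact DFunLike.congr_fun (h1.unique h2) a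
  refine ⟨r, hr, ι, hι, hι0, fun u hu => ⟨hιV u hu, hperp u hu⟩, fun a ha => ?_⟩
  have h0 : (0 : F) ∈ Metric.ball (0 : F) r := Metric.mem_ball_self hr
  let s : F → ℝ := fun u => (e.symm (0, u)).1
  have hs : ContDiffOn ℝ ∞ s (Metric.ball 0 r) := contDiff_fst.comp_contDiffOn
    (hes.comp (contDiff_prodMk_right _).contDiffOn fun u hu => hrD hu)
  have hsd : HasFDerivAt s (fderiv ℝ s 0) 0 :=
    ((hs.contDiffAt (Metric.isOpen_ball.mem_nhds h0)).differentiableAt (by simp)).hasFDerivAt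
  have hιeq : HasFDerivAt ι ((fderiv ℝ s 0).smulRight w + A) 0 := by
    have h1 : HasFDerivAt (fun u => y₀ + s u • w + A u) ((fderiv ℝ s 0).smulRight w + A) 0 :=
      ((hsd.smul_const w).const_add y₀).add A.hasFDerivAt
    refine h1.congr_of_eventuallyEq ?_
    filter_upwards [Metric.isOpen_ball.mem_nhds h0] with u hu
    simp only [ι, Θ, (hval u hu).2, s]
  have hda : fderiv ℝ s 0 a • w + A a = 0 := by
    rw [← ha, hιeq.fderiv]; simp
  have hsa : fderiv ℝ s 0 a = 0 := by
    have := congrArg (fderiv ℝ h y₀) hda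
    simpa [hw, hA] using this
  rw [hsa, zero_smul, zero_add] at hda
  exact hAinj a hda

end LevelSet

/-! ### Metrics on `ℝᵏ` from their coefficients. -/

section EuclideanMetric

/-- The constant is the minimum of the quadratic form on the compact unit sphere. It supplies the
boundedness of unit balls demanded in the definition of a bundle metric. -/
theorem exists_pos_le_of_posDef {E : Type*} [NormedAddCommGroup E] [NormedSpace ℝ E]
    [FiniteDimensional ℝ E] (B : E →L[ℝ] E →L[ℝ] ℝ) (hB : ∀ a, a ≠ 0 → 0 < B a a) :
    ∃ m > 0, ∀ a, m * ‖a‖ ^ 2 ≤ B a a := by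
  have : ProperSpace E := FiniteDimensional.proper ℝ E
  -- The sphere is empty when `E` is trivial, which does occur: the fibre of a warped product is
  -- zero-dimensional if `n = 1`.
  rcases (Metric.sphere (0 : E) 1).eq_empty_or_nonempty with hs | hs
  · refine ⟨1, one_pos, fun a => ?_⟩
    by_cases ha : a = 0
    · simp [ha]
    · exfalso
      have : ‖a‖⁻¹ • a ∈ Metric.sphere (0 : E) 1 := by
        simp [norm_smul, ha]
      rw [hs] at this
      exact this
  · obtain ⟨v, hv, hmin⟩ := (isCompact_sphere (0 : E) 1).exists_isMinOn hs
      (f := fun a => B a a) (by fun_prop)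
    have hv0 : v ≠ 0 := by rintro rfl; simp at hv
    refine ⟨B v v, hB v hv0, fun a => ?_⟩
    by_cases ha : a = 0
    · simp [ha]
    have ha' : 0 < ‖a‖ := norm_pos_iff.2 ha
    have h1 : B v v ≤ B (‖a‖⁻¹ • a) (‖a‖⁻¹ • a) := hmin (show ‖a‖⁻¹ • a ∈ Metric.sphere (0 : E) 1 by
      simp [norm_smul, ha])
    simp only [map_smul, smul_apply, smul_eq_mul] at h1
    calc B v v * ‖a‖ ^ 2 ≤ (‖a‖⁻¹ * (‖a‖⁻¹ * B a a)) * ‖a‖ ^ 2 := by gcongr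
      _ = B a a := by field_simp

/-- A Riemannian metric on `ℝᵏ`, from its coefficients. -/
def metricOfCoord {k : ℕ} (G : EuclideanSpace ℝ (Fin k) →
      EuclideanSpace ℝ (Fin k) →L[ℝ] EuclideanSpace ℝ (Fin k) →L[ℝ] ℝ)
    (hG : IsCoordMetric G univ) : SmoothMetric k (EuclideanSpace ℝ (Fin k)) where
  inner x := G x
  symm x v w := hG.symm x (mem_univ _) v w
  pos x v hv := hG.pos x (mem_univ _) v hv
  isVonNBounded x := by
    change Bornology.IsVonNBounded ℝ {v : EuclideanSpace ℝ (Fin k) | G x v v < 1}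
    obtain ⟨m, hm, h⟩ := exists_pos_le_of_posDef (G x) (hG.pos x (mem_univ _))
    refine (NormedSpace.isVonNBounded_ball ℝ (EuclideanSpace ℝ (Fin k)) (√(m⁻¹) + 1)).subset ?_
    intro v hv
    rw [Metric.mem_ball, dist_zero_right]
    have h1 : m * ‖v‖ ^ 2 < 1 := (h v).trans_lt hv
    have h2 : ‖v‖ ^ 2 ≤ m⁻¹ := by
      rw [← one_div, le_div_iff₀ hm]; linarith
    have := Real.le_sqrt_of_sq_le h2
    linarith
  contMDiff := by
    intro x
    refine Bundle.contMDiffAt_totalSpace.2 ⟨contMDiffAt_id, ?_⟩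
    have h : ContMDiffAt (𝓡 k) 𝓘(ℝ, EuclideanSpace ℝ (Fin k) →L[ℝ]
        EuclideanSpace ℝ (Fin k) →L[ℝ] ℝ) ∞ G x :=
      (hG.smooth.contDiffAt Filter.univ_mem).contMDiffAt
    refine h.congr_of_eventuallyEq (Filter.Eventually.of_forall fun y => ?_)
    apply ContinuousLinearMap.ext
    intro v
    apply ContinuousLinearMap.ext
    intro w
    beta_reduce
    rw [hom_trivializationAt_apply]
    have h0 : y ∈ (trivializationAt (EuclideanSpace ℝ (Fin k))
        (TangentSpace (𝓡 k) (M := EuclideanSpace ℝ (Fin k))) x).baseSet := by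
      rw [TangentBundle.trivializationAt_baseSet, chartAt_self_eq]; exact mem_univ y
    have h2 := inCoordinates_apply_eq₂ (𝕜 := ℝ) (F₁ := EuclideanSpace ℝ (Fin k))
      (F₂ := EuclideanSpace ℝ (Fin k)) (F₃ := ℝ)
      (E₁ := TangentSpace (𝓡 k) (M := EuclideanSpace ℝ (Fin k)))
      (E₂ := TangentSpace (𝓡 k) (M := EuclideanSpace ℝ (Fin k)))
      (E₃ := fun _ : EuclideanSpace ℝ (Fin k) => ℝ)
      (x₀ := x) (x := y) (ϕ := G y) (v := v) (w := w) h0 h0 (mem_univ y)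
    refine h2.trans ?_
    have h3 : ∀ v, (trivializationAt (EuclideanSpace ℝ (Fin k))
        (TangentSpace (𝓡 k) (M := EuclideanSpace ℝ (Fin k))) x).symm y v = v := by
      intro v
      rw [← Bundle.Trivialization.symmL_apply (R := ℝ) _ h0]
      simp only [TangentBundle.symmL_model_space]
      rfl
    rw [h3, h3]
    simp
    rfl

end EuclideanMetric
end

noncomputable section

/-! ### From an umbilical graph to a closed conformal field. -/

section Graph

variable {n : ℕ} {M : Type u} [TopologicalSpace M]
  [ChartedSpace (EuclideanSpace ℝ (Fin n)) M] [IsManifold (𝓡 n) ∞ M]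
  {S : Type v} [TopologicalSpace S]
  [ChartedSpace (EuclideanSpace ℝ (Fin n)) S] [IsManifold (𝓡 n) ∞ S]

theorem isSmoothCoord_chartAt (p : M) :
    IsSmoothCoord (𝓡 n) (chartAt (EuclideanSpace ℝ (Fin n)) p) :=
  ⟨contMDiffOn_chart, contMDiffOn_chart_symm⟩

/-- Near a point where it is not vertical, a hypersurface is a graph over the base. -/
theorem exists_graph_param {φ : S → M × ℝ}
    (hφ : IsSmoothImmersionOn (𝓡 n) ((𝓡 n).prod 𝓘(ℝ, ℝ)) φ univ) {q : S}
    (hq : ¬ IsVerticalAt n (𝓡 n) φ q)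
    {κ : OpenPartialHomeomorph M (EuclideanSpace ℝ (Fin n))} (hκ : IsSmoothCoord (𝓡 n) κ)
    (hqκ : (φ q).1 ∈ κ.source) :
    ∃ χ : OpenPartialHomeomorph (EuclideanSpace ℝ (Fin n)) S, q ∈ χ.target ∧
      ContMDiffOn (𝓡 n) (𝓡 n) ∞ χ χ.source ∧ ContMDiffOn (𝓡 n) (𝓡 n) ∞ χ.symm χ.target ∧
      ∀ y ∈ χ.source, (φ (χ y)).1 ∈ κ.source ∧ κ (φ (χ y)).1 = y := by
  let E := EuclideanSpace ℝ (Fin n)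
  let k := chartAt E q
  have hk : IsSmoothCoord (𝓡 n) k := isSmoothCoord_chartAt q
  have hφs : ContMDiff (𝓡 n) ((𝓡 n).prod 𝓘(ℝ, ℝ)) ∞ φ := contMDiffOn_univ.1 hφ.1
  let U : Set E := k.target ∩ k.symm ⁻¹' ((fun x => (φ x).1) ⁻¹' κ.source)
  have hU : IsOpen U := k.symm.continuousOn.isOpen_inter_preimage k.open_target
    (κ.open_source.preimage (continuous_fst.comp hφs.continuous))
  let f : E → E := fun y => κ (φ (k.symm y)).1
  have hφ1 : ContMDiff (𝓡 n) (𝓡 n) ∞ (fun x => (φ x).1) := contMDiff_fst.comp hφs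
  have hf : ContDiffOn ℝ ∞ f U := contMDiffOn_iff_contDiffOn.1
    (hκ.smooth.comp (hφ1.comp_contMDiffOn (hk.smooth_symm.mono inter_subset_left))
      fun y hy => hy.2)
  have hqk : q ∈ k.source := mem_chart_source E q
  have hkq : k q ∈ U := ⟨k.map_source hqk, by
    rw [mem_preimage, k.left_inv hqk]; exact hqκ⟩
  have hfd : HasFDerivAt f (fderiv ℝ f (k q)) (k q) :=
    ((hf.contDiffAt (hU.mem_nhds hkq)).differentiableAt (by simp)).hasFDerivAt
  -- A tangent vector killed by the projection to `M` is mapped to a multiple of `ξ`. The multiple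
  -- is zero because the hypersurface is not vertical, and then the vector is zero because `φ` is an
  -- immersion.
  have hinj : ∀ a, fderiv ℝ f (k q) a = 0 → a = 0 := by
    intro a ha
    obtain ⟨X, rfl⟩ := hk.coordVec_surjective hqk a
    have hφd := (hφs.mdifferentiableAt (x := q) (by simp)).hasMFDerivAt
    have h1 : HasMFDerivAt (𝓡 n) 𝓘(ℝ, E) (f ∘ k) q
        ((fderiv ℝ f (k q)).comp (mfderiv (𝓡 n) 𝓘(ℝ, E) k q)) :=
      hfd.hasMFDerivAt.comp q (hk.mdifferentiableAt hqk).hasMFDerivAt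
    have h2 : HasMFDerivAt (𝓡 n) 𝓘(ℝ, E) (κ ∘ (Prod.fst ∘ φ)) q
        ((mfderiv (𝓡 n) 𝓘(ℝ, E) κ (φ q).1).comp ((ContinuousLinearMap.fst ℝ
        (TangentSpace (𝓡 n) (φ q).1) (TangentSpace 𝓘(ℝ, ℝ) (φ q).2)).comp
          (mfderiv (𝓡 n) ((𝓡 n).prod 𝓘(ℝ, ℝ)) φ q))) :=
      (hκ.mdifferentiableAt hqκ).hasMFDerivAt.comp q ((hasMFDerivAt_fst (φ q)).comp q hφd)
    have h3 : f ∘ k =ᶠ[𝓝 q] κ ∘ (Prod.fst ∘ φ) := by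
      filter_upwards [k.open_source.mem_nhds hqk] with x hx
      simp only [f, Function.comp_apply, k.left_inv hx]
    have h4 := DFunLike.congr_fun (h1.mfderiv.symm.trans ((h3.mfderiv_eq).trans h2.mfderiv)) X
    have h5 : coordVec (𝓡 n) κ (z := (φ q).1)
        (mfderiv (𝓡 n) ((𝓡 n).prod 𝓘(ℝ, ℝ)) φ q X).1 = 0 := h4.symm.trans ha
    have h6 : (mfderiv (𝓡 n) ((𝓡 n).prod 𝓘(ℝ, ℝ)) φ q X).1 = 0 := by
      rw [← hκ.symm_coordVec hqκ (mfderiv (𝓡 n) ((𝓡 n).prod 𝓘(ℝ, ℝ)) φ q X).1, h5]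
      exact map_zero _
    have h7 : (mfderiv (𝓡 n) ((𝓡 n).prod 𝓘(ℝ, ℝ)) φ q X).2 = (0 : ℝ) := by
      by_contra hne
      let r : ℝ := (mfderiv (𝓡 n) ((𝓡 n).prod 𝓘(ℝ, ℝ)) φ q X).2
      refine hq ⟨r⁻¹ • X, ?_⟩
      rw [map_smul]
      refine Prod.ext ?_ ?_
      · exact (congrArg (fun w : E => r⁻¹ • w) h6).trans (smul_zero _)
      · exact inv_mul_cancel₀ hne
    have h8 : mfderiv (𝓡 n) ((𝓡 n).prod 𝓘(ℝ, ℝ)) φ q X = 0 := Prod.ext h6 h7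
    have h9 : X = 0 := hφ.2 q (mem_univ q) (h8.trans (map_zero _).symm)
    rw [h9]
    exact map_zero _
  let f' : E ≃L[ℝ] E := (LinearEquiv.ofInjectiveEndo (fderiv ℝ f (k q) : E →ₗ[ℝ] E)
    (LinearMap.ker_eq_bot.1 (LinearMap.ker_eq_bot'.2 hinj))).toContinuousLinearEquiv
  have hf' : HasFDerivAt f (f' : E →L[ℝ] E) (k q) := by
    convert hfd using 1
    ext1 a; rfl
  obtain ⟨e, hqe, heU, hef, hes⟩ := exists_smooth_openPartialHomeomorph hU hf hkq f' hf'
  have hek : ∀ y ∈ e.target, e.symm y ∈ U := fun y hy => heU (e.map_target hy)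
  refine ⟨e.symm.trans k.symm, ?_, ?_, ?_, fun y hy => ?_⟩
  · rw [OpenPartialHomeomorph.trans_target]
    exact ⟨hqk, hqe⟩
  · exact hk.smooth_symm.comp (hes.contMDiffOn.mono inter_subset_left) fun y hy => hy.2
  · have h1 : ContMDiffOn (𝓡 n) (𝓡 n) ∞ e e.source := by
      refine ContDiffOn.contMDiffOn ((hf.mono heU).congr fun y _ => hef y)
    refine h1.comp (hk.smooth.mono ?_) ?_
    · exact fun x hx => hx.1
    · exact fun x hx => hx.2
  · have hy' : y ∈ e.target := hy.1
    refine ⟨(hek y hy').2, ?_⟩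
    change f (e.symm y) = y
    rw [← hef, e.right_inv hy']

/-- The horizontal part of the unit normal of a totally umbilical graph is a closed conformal
field, and it determines the differential of the height function. -/
theorem exists_closedConformal_of_umbilical {g : SmoothMetric n M} {φ : S → M × ℝ}
    (hφ : ContMDiff (𝓡 n) ((𝓡 n).prod 𝓘(ℝ, ℝ)) ∞ φ)
    (humb : IsTotallyUmbilicalOn (𝓡 n) (prodMetric g) φ univ)
    {κ : OpenPartialHomeomorph M (EuclideanSpace ℝ (Fin n))}
    {G : EuclideanSpace ℝ (Fin n) → EuclideanSpace ℝ (Fin n) →L[ℝ]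
      EuclideanSpace ℝ (Fin n) →L[ℝ] ℝ}
    (hG : IsMetricIn (metricField g) κ G)
    {χ : OpenPartialHomeomorph (EuclideanSpace ℝ (Fin n)) S}
    (hχ : ContMDiffOn (𝓡 n) (𝓡 n) ∞ χ χ.source)
    (hχs : ContMDiffOn (𝓡 n) (𝓡 n) ∞ χ.symm χ.target)
    (hχκ : ∀ y ∈ χ.source, (φ (χ y)).1 ∈ κ.source ∧ κ (φ (χ y)).1 = y)
    {y₀ : EuclideanSpace ℝ (Fin n)} (hy₀ : y₀ ∈ χ.source)
    (hhor : ¬ IsHorizontalAt (𝓡 n) g φ (χ y₀)) :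
    fderiv ℝ (fun y => (φ (χ y)).2) y₀ ≠ 0 ∧
    ∃ V, IsOpen V ∧ y₀ ∈ V ∧ V ⊆ χ.source ∧
      ∃ (Y : EuclideanSpace ℝ (Fin n) → EuclideanSpace ℝ (Fin n))
        (l : EuclideanSpace ℝ (Fin n) → ℝ) (c : ℝ), c ^ 2 = 1 ∧ ContDiffOn ℝ ∞ Y V ∧
        ∀ y ∈ V, Y y ≠ 0 ∧ G y (Y y) (Y y) < 1 ∧
          (∀ a b, coordCovDeriv G Y y a b = l y * G y a b) ∧
          ∀ a, √(1 - G y (Y y) (Y y)) * fderiv ℝ (fun y => (φ (χ y)).2) y a = c * G y (Y y) a := by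
  let E := EuclideanSpace ℝ (Fin n)
  let h : E → ℝ := fun y => (φ (χ y)).2
  have hsub : ∀ y ∈ χ.source, y ∈ κ.target := fun y hy => by
    rw [← (hχκ y hy).2]; exact κ.map_source (hχκ y hy).1
  have hφχ : ContMDiffOn (𝓡 n) ((𝓡 n).prod 𝓘(ℝ, ℝ)) ∞ (φ ∘ χ) χ.source :=
    hφ.comp_contMDiffOn hχ
  have hh : ContDiffOn ℝ ∞ h χ.source := contMDiffOn_iff_contDiffOn.1
    (contMDiff_snd.comp_contMDiffOn hφχ)
  have hhd : ∀ y ∈ χ.source, HasFDerivAt h (fderiv ℝ h y) y := fun y hy =>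
    ((hh.contDiffAt (χ.open_source.mem_nhds hy)).differentiableAt (by simp)).hasFDerivAt
  have heφ : ∀ y ∈ χ.source, ∀ a, fderiv ℝ (prodCoord κ ∘ fun y => φ (χ y)) y a =
      (a, fderiv ℝ h y a) := by
    intro y hy a
    have h1 : HasFDerivAt (fun y => (y, h y)) ((ContinuousLinearMap.id ℝ E).prod (fderiv ℝ h y)) y :=
      (hasFDerivAt_id y).prodMk (hhd y hy)
    have h2 : (prodCoord κ ∘ fun y => φ (χ y)) =ᶠ[𝓝 y] fun y => (y, h y) := by
      filter_upwards [χ.open_source.mem_nhds hy] with w hw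
      exact Prod.ext (hχκ w hw).2 rfl
    rw [(h1.congr_of_eventuallyEq h2).fderiv]
    rfl
  -- If `dh` vanished, every tangent vector of the hypersurface would have zero `ξ`-component, so it
  -- would be horizontal at this point.
  have hDh : fderiv ℝ h y₀ ≠ 0 := by
    intro h0
    apply hhor
    intro X
    let X' : E := mfderiv (𝓡 n) (𝓡 n) χ.symm (χ y₀) X
    have hxt := χ.map_source hy₀
    have hφd := (hφ.mdifferentiableAt (x := χ y₀) (by simp)).hasMFDerivAt
    have hsd : HasMFDerivAt (𝓡 n) (𝓡 n) χ.symm (χ y₀)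
        (mfderiv (𝓡 n) (𝓡 n) χ.symm (χ y₀)) :=
      ((hχs.contMDiffAt (χ.open_target.mem_nhds hxt)).mdifferentiableAt (by simp)).hasMFDerivAt
    have hhd' : HasFDerivAt h (0 : E →L[ℝ] ℝ) (χ.symm (χ y₀)) := by
      rw [χ.left_inv hy₀, ← h0]; exact hhd y₀ hy₀
    have h1 := hhd'.hasMFDerivAt.comp (χ y₀) hsd
    have h2 : HasMFDerivAt (𝓡 n) 𝓘(ℝ, ℝ) (Prod.snd ∘ φ) (χ y₀) _ :=
      (hasMFDerivAt_snd (φ (χ y₀))).comp (χ y₀) hφd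
    have h3 : h ∘ χ.symm =ᶠ[𝓝 (χ y₀)] Prod.snd ∘ φ := by
      filter_upwards [χ.open_target.mem_nhds hxt] with x hx
      simp only [h, Function.comp_apply, χ.right_inv hx]
    have h4 := DFunLike.congr_fun (h1.mfderiv.symm.trans ((h3.mfderiv_eq).trans h2.mfderiv)) X
    have h5 : (mfderiv (𝓡 n) ((𝓡 n).prod 𝓘(ℝ, ℝ)) φ (χ y₀) X).2 = (0 : ℝ) := h4.symm
    have h6 : prodMetric g (φ (χ y₀)) (unitField (φ (χ y₀)))
        (mfderiv (𝓡 n) ((𝓡 n).prod 𝓘(ℝ, ℝ)) φ (χ y₀) X) = 0 + 1 * (0 : ℝ) := by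
      refine congrArg₂ (fun a b : ℝ => a + 1 * b) ?_ h5
      exact DFunLike.congr_fun (map_zero (g.inner (φ (χ y₀)).1)) _
    simpa using h6
  refine ⟨hDh, ?_⟩
  have humb' : IsTotallyUmbilicalOn 𝓘(ℝ, E) (prodMetric g) (φ ∘ χ) χ.source :=
    humb.comp χ.open_source hχ (fun _ _ => mem_univ _)
  obtain ⟨V, hV, hy₀V, hVχ, v, l, hv, hall⟩ := humb'.exists_coord hG.prod
    (fun y hy => mem_prodCoord_source.2 (hχκ y hy).1) hy₀
  have hev : ∀ y ∈ V, (prodCoord κ (φ (χ y))).1 = y := fun y hy => (hχκ y (hVχ hy)).2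
  let Y : E → E := fun y => (v y).1
  let N : E → ℝ := fun y => (v y).2
  have hY : ContDiffOn ℝ ∞ Y V := contDiff_fst.comp_contDiffOn hv
  have hN : ContDiffOn ℝ ∞ N V := contDiff_snd.comp_contDiffOn hv
  have hunit : ∀ y ∈ V, G y (Y y) (Y y) + N y * N y = 1 := fun y hy => by
    have := (hall y hy).1
    rwa [prodCoordMetric_apply, hev y hy] at this
  have hnorm : ∀ y ∈ V, ∀ a, G y (Y y) a + N y * fderiv ℝ h y a = 0 := fun y hy a => by
    have := (hall y hy).2.1 a
    rwa [heφ y (hVχ hy), prodCoordMetric_apply, hev y hy] at this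
  -- The tangent vectors of the graph are `(a, dh(a))`. Testing the umbilicity equation against
  -- vectors `(b, 0)` removes everything that involves `N` or `h`.
  have hconf : ∀ y ∈ V, ∀ a b, coordCovDeriv G Y y a b = -l y * G y a b := fun y hy a b => by
    have h1 := (hall y hy).2.2 a (b, 0)
    rw [heφ y (hVχ hy), prodCoordMetric_apply, prodCoordMetric_apply,
      coordChristoffel_prod hG.metric (by rw [hev y hy]; exact hsub y (hVχ hy)), hev y hy] at h1
    have hvd : HasFDerivAt v (fderiv ℝ v y) y :=
      ((hv.contDiffAt (hV.mem_nhds hy)).differentiableAt (by simp)).hasFDerivAt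
    have h2 : fderiv ℝ Y y a = (fderiv ℝ v y a).1 := by
      have h3 : HasFDerivAt Y _ y := hasFDerivAt_fst.comp y hvd
      rw [h3.fderiv]; rfl
    simp only [mul_zero, add_zero] at h1
    rw [coordCovDeriv, h2]
    exact h1
  -- If `N = 0`, orthogonality tested on `a = Y` gives `G(Y, Y) = 0`, whereas the normal has length
  -- one.
  have hN0 : ∀ y ∈ V, N y ≠ 0 := fun y hy h0 => by
    have h1 := hnorm y hy (Y y)
    have h2 := hunit y hy
    rw [h0] at h1 h2
    linarith
  have hY0 : Y y₀ ≠ 0 := fun h0 => by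
    apply hDh
    ext1 a
    have h1 := hnorm y₀ hy₀V a
    rw [h0, map_zero] at h1
    have h2 : N y₀ * fderiv ℝ h y₀ a = 0 := by simpa using h1
    simpa [hN0 y₀ hy₀V] using h2
  -- With `s` the sign of `N`, the relation `G(Y, Y) + N² = 1` reads `s N = √(1 - G(Y, Y))`.
  -- Orthogonality then expresses `dh` through `Y` alone, with the sign `c = -s`.
  obtain ⟨s, hs, hsN⟩ : ∃ s : ℝ, s ^ 2 = 1 ∧ 0 < s * N y₀ := by
    rcases lt_or_gt_of_ne (hN0 y₀ hy₀V) with h | h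
    · exact ⟨-1, by norm_num, by linarith⟩
    · exact ⟨1, by norm_num, by linarith⟩
  let V₁ : Set E := (V ∩ (fun y => s * N y) ⁻¹' Ioi 0) ∩ (V ∩ Y ⁻¹' {0}ᶜ)
  have hV₁ : IsOpen V₁ :=
    ((continuousOn_const.mul hN.continuousOn).isOpen_inter_preimage hV isOpen_Ioi).inter
      (hY.continuousOn.isOpen_inter_preimage hV isOpen_compl_singleton)
  have hV₁V : V₁ ⊆ V := fun y hy => hy.1.1
  refine ⟨V₁, hV₁, ⟨⟨hy₀V, hsN⟩, hy₀V, hY0⟩, hV₁V.trans hVχ, Y, fun y => -l y, -s, by simpa using hs,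
    hY.mono hV₁V, fun y hy => ⟨hy.2.2, ?_, hconf y (hV₁V hy), fun a => ?_⟩⟩
  · have h1 := hunit y (hV₁V hy)
    have h2 := mul_self_pos.2 (hN0 y (hV₁V hy))
    linarith
  · have h1 := hunit y (hV₁V hy)
    have h2 : 1 - G y (Y y) (Y y) = (s * N y) ^ 2 := by rw [mul_pow, hs]; linarith
    have h3 : (0 : ℝ) < s * N y := hy.1.2
    rw [h2, Real.sqrt_sq h3.le]
    have h4 := hnorm y (hV₁V hy) a
    change s * N y * fderiv ℝ h y a = -s * G y (Y y) a
    linear_combination s * h4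

end Graph
end

noncomputable section

/-! ### Warped product structures from coordinates. -/

section WarpedChart

theorem OpenPartialHomeomorph.eq_zero_of_fderiv_eq_zero {E F : Type*} [NormedAddCommGroup E]
    [NormedSpace ℝ E] [NormedAddCommGroup F] [NormedSpace ℝ F] {e : OpenPartialHomeomorph E F}
    (he : ContDiffOn ℝ ∞ e e.source) (hes : ContDiffOn ℝ ∞ e.symm e.target) {z : E}
    (hz : z ∈ e.source) {a : E} (ha : fderiv ℝ e z a = 0) : a = 0 := by
  have h1 : HasFDerivAt e (fderiv ℝ e z) z :=
    ((he.contDiffAt (e.open_source.mem_nhds hz)).differentiableAt (by simp)).hasFDerivAt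
  have h2 : HasFDerivAt e.symm (fderiv ℝ e.symm (e z)) (e z) :=
    ((hes.contDiffAt (e.open_target.mem_nhds (e.map_source hz))).differentiableAt
      (by simp)).hasFDerivAt
  have h3 : HasFDerivAt (e.symm ∘ e) (ContinuousLinearMap.id ℝ E) z := by
    refine (hasFDerivAt_id z).congr_of_eventuallyEq ?_
    filter_upwards [e.open_source.mem_nhds hz] with w hw using e.left_inv hw
  have h4 := DFunLike.congr_fun ((h2.comp z h1).unique h3) a
  simpa [ha] using h4.symm

theorem IsCoordMetric.pullback {E F : Type*} [NormedAddCommGroup E] [NormedSpace ℝ E]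
    [NormedAddCommGroup F] [NormedSpace ℝ F] [FiniteDimensional ℝ F]
    {G : E → E →L[ℝ] E →L[ℝ] ℝ} {V : Set E} (hG : IsCoordMetric G V) {τ : F → E} {U : Set F}
    (hU : IsOpen U) (hτ : ContDiffOn ℝ ∞ τ U) (hm : MapsTo τ U V)
    (hinj : ∀ u ∈ U, ∀ a, fderiv ℝ τ u a = 0 → a = 0) {m : ℝ} (hm0 : 0 < m) :
    IsCoordMetric (fun u => m • (G (τ u)).bilinearComp (fderiv ℝ τ u) (fderiv ℝ τ u)) U := by
  refine ⟨hU, ?_, fun u hu a b => ?_, fun u hu a ha => ?_⟩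
  · rw [contDiffOn_clm_apply]
    intro a
    rw [contDiffOn_clm_apply]
    intro b
    have h1 (c : F) : ContDiffOn ℝ ∞ (fun u => fderiv ℝ τ u c) U :=
      (contDiffOn_fderiv hU hτ).clm_apply contDiffOn_const
    exact contDiffOn_const.mul (((hG.smooth.comp hτ hm).clm_apply (h1 a)).clm_apply (h1 b))
  · change m * G (τ u) (fderiv ℝ τ u a) (fderiv ℝ τ u b) =
      m * G (τ u) (fderiv ℝ τ u b) (fderiv ℝ τ u a)
    rw [hG.symm _ (hm hu)]
  · exact mul_pos hm0 (hG.pos _ (hm hu) _ fun h => ha (hinj u hu a h))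

/-- Coordinates of warped product type, over an interval times the whole of `ℝᵏ`. -/
theorem exists_warped_coordinates_univ {E : Type} [NormedAddCommGroup E] [NormedSpace ℝ E]
    [FiniteDimensional ℝ E] {k : ℕ}
    {G : E → E →L[ℝ] E →L[ℝ] ℝ} {V : Set E} (hG : IsCoordMetric G V)
    {T : E → E} {ρ l : E → ℝ} (h : IsUnitConformal G V T ρ l)
    (hdim : k + 1 = Module.finrank ℝ E) {ι : EuclideanSpace ℝ (Fin k) → E} {r : ℝ} (hr : 0 < r)
    (hι : ContDiffOn ℝ ∞ ι (Metric.ball 0 r)) (hι0 : ι 0 ∈ V)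
    (hperp : ∀ u ∈ Metric.ball (0 : EuclideanSpace ℝ (Fin k)) r, ι u ∈ V → ∀ a,
      G (ι u) (T (ι u)) (fderiv ℝ ι u a) = 0)
    (hinj : ∀ a, fderiv ℝ ι 0 a = 0 → a = 0) :
    ∃ δ, 0 < δ ∧ ∃ (e : OpenPartialHomeomorph (ℝ × EuclideanSpace ℝ (Fin k)) E)
      (G₀ : EuclideanSpace ℝ (Fin k) → EuclideanSpace ℝ (Fin k) →L[ℝ]
        EuclideanSpace ℝ (Fin k) →L[ℝ] ℝ),
      e.source = Ioo (-δ) δ ×ˢ univ ∧ e.target ⊆ V ∧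
      ContDiffOn ℝ ∞ e e.source ∧ ContDiffOn ℝ ∞ e.symm e.target ∧ e (0, 0) = ι 0 ∧
      IsCoordMetric G₀ univ ∧
      ∀ z ∈ e.source, fderiv ℝ e z (1, 0) = T (e z) ∧ ρ (e z) = ρ (e (z.1, 0)) ∧
        ∀ X Y : ℝ × EuclideanSpace ℝ (Fin k),
          G (e z) (fderiv ℝ e z X) (fderiv ℝ e z Y) = X.1 * Y.1 +
            ρ (e (z.1, 0)) ^ 2 * G₀ z.2 X.2 Y.2 := by
  obtain ⟨δ, hδ, -, e₁, hsrc, htgt, he, hes, he0, heT, hall⟩ :=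
    exists_warped_coordinates (F := EuclideanSpace ℝ (Fin k)) hG h (by simpa using hdim) hr hι hι0
      hperp hinj
  -- Stretching the ball to all of `ℝᵏ` allows the fibre `N` to be the model space itself.
  let b := OpenPartialHomeomorph.univBall (0 : EuclideanSpace ℝ (Fin k)) δ
  have hbs : b.source = univ := OpenPartialHomeomorph.univBall_source _ _
  have hbt : b.target = Metric.ball 0 δ := OpenPartialHomeomorph.univBall_target _ hδ
  have hb0 : b 0 = 0 := OpenPartialHomeomorph.univBall_apply_zero _ _
  have hb : ContDiff ℝ ∞ b := OpenPartialHomeomorph.contDiff_univBall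
  have hbm : ∀ u, b u ∈ Metric.ball (0 : EuclideanSpace ℝ (Fin k)) δ := fun u => by
    rw [← hbt]; exact b.map_source (by rw [hbs]; exact mem_univ u)
  let β : OpenPartialHomeomorph (ℝ × EuclideanSpace ℝ (Fin k)) (ℝ × EuclideanSpace ℝ (Fin k)) :=
    (OpenPartialHomeomorph.refl ℝ).prod b
  have hβ : ContDiff ℝ ∞ β := contDiff_fst.prodMk (hb.comp contDiff_snd)
  let e := β.trans e₁
  have hesrc : e.source = Ioo (-δ) δ ×ˢ univ := by
    ext z
    simp only [e, β, OpenPartialHomeomorph.trans_source, OpenPartialHomeomorph.prod_source,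
      OpenPartialHomeomorph.refl_source, hbs, hsrc, mem_inter_iff, mem_preimage, mem_prod,
      mem_univ, and_true, true_and]
    exact ⟨fun h => h.1, fun h => ⟨h, hbm z.2⟩⟩
  have hez : ∀ z, e z = e₁ (z.1, b z.2) := fun z => rfl
  have hβm : ∀ z ∈ e.source, β z ∈ e₁.source := fun z hz => hz.2
  have heC : ContDiffOn ℝ ∞ e e.source := he.comp hβ.contDiffOn hβm
  have hesC : ContDiffOn ℝ ∞ e.symm e.target := by
    have h1 : ContDiffOn ℝ ∞ β.symm (univ ×ˢ Metric.ball 0 δ) :=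
      contDiff_fst.contDiffOn.prodMk (OpenPartialHomeomorph.contDiffOn_univBall_symm.comp
        contDiff_snd.contDiffOn fun z hz => hz.2)
    refine h1.comp (hes.mono ?_) fun z hz => ?_
    · exact fun z hz => hz.1
    · have : e₁.symm z ∈ e₁.source := e₁.map_target hz.1
      rw [hsrc] at this
      exact ⟨mem_univ _, this.2⟩
  have hbd : ∀ u, HasFDerivAt b (fderiv ℝ b u) u := fun u =>
    ((hb.differentiable (by simp)) u).hasFDerivAt
  have hed : ∀ z ∈ e.source, ∀ X : ℝ × EuclideanSpace ℝ (Fin k), fderiv ℝ e z X =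
      fderiv ℝ e₁ (z.1, b z.2) (X.1, fderiv ℝ b z.2 X.2) := by
    intro z hz X
    have h1 : HasFDerivAt e₁ (fderiv ℝ e₁ (z.1, b z.2)) (β z) :=
      ((he.contDiffAt (e₁.open_source.mem_nhds (hβm z hz))).differentiableAt
        (by simp)).hasFDerivAt
    have h2 : HasFDerivAt β _ z := hasFDerivAt_fst.prodMk ((hbd z.2).comp z hasFDerivAt_snd)
    have h3 : HasFDerivAt e _ z := h1.comp z h2
    rw [h3.fderiv]; rfl
  have h00 : ((0 : ℝ), (0 : EuclideanSpace ℝ (Fin k))) ∈ e.source := by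
    rw [hesrc]; exact ⟨⟨by simpa using hδ, hδ⟩, mem_univ _⟩
  have he00 : e (0, 0) = ι 0 := by
    rw [hez, hb0]; exact he0 0 (Metric.mem_ball_self hδ)
  have h0s : ∀ u : EuclideanSpace ℝ (Fin k), ((0 : ℝ), u) ∈ e.source := fun u => by
    rw [hesrc]; exact ⟨⟨by simpa using hδ, hδ⟩, mem_univ _⟩
  let τ : EuclideanSpace ℝ (Fin k) → E := fun u => e (0, u)
  have hτd : ∀ u a, fderiv ℝ τ u a = fderiv ℝ e (0, u) (0, a) := by
    intro u a
    have h1 : HasFDerivAt e (fderiv ℝ e (0, u)) (0, u) :=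
      ((heC.contDiffAt (e.open_source.mem_nhds (h0s u))).differentiableAt
        (by simp)).hasFDerivAt
    have h2 : HasFDerivAt τ _ u := h1.comp u ((hasFDerivAt_const (0 : ℝ) u).prodMk (hasFDerivAt_id u))
    rw [h2.fderiv]; rfl
  have htV : ∀ z ∈ e.source, e z ∈ V := fun z hz => htgt (e₁.map_source (hβm z hz))
  have hρ0 : 0 < ρ (ι 0) := h.pos _ hι0
  -- The factor `ρ(ι 0)⁻²` normalizes the fibre metric so that the warping function is `ρ` itself,
  -- with no extra constant.
  have hG₀ := hG.pullback (τ := τ) isOpen_univ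
    (heC.comp (contDiff_prodMk_right _).contDiffOn fun u _ => h0s u)
    (fun u _ => htV _ (h0s u)) (fun u _ a ha => by
      rw [hτd] at ha
      exact congrArg Prod.snd (OpenPartialHomeomorph.eq_zero_of_fderiv_eq_zero heC hesC (h0s u) ha))
    (m := (ρ (ι 0) ^ 2)⁻¹) (by positivity)
  refine ⟨δ, hδ, e, _, hesrc, ?_, heC, hesC, he00, hG₀, fun z hz => ?_⟩
  · exact fun y hy => htgt hy.1
  have hz1 : z.1 ∈ Ioo (-δ) δ := by rw [hesrc] at hz; exact hz.1
  obtain ⟨h1, h2⟩ := hall z.1 hz1 (b z.2) (hbm z.2)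
  have hρz : ρ (e (z.1, 0)) = ρ (e₁ (z.1, 0)) := by rw [hez, hb0]
  refine ⟨?_, ?_, fun X Y => ?_⟩
  · rw [hed z hz, map_zero]; exact heT _ (hβm z hz)
  · rw [hρz]; exact h1
  · rw [hed z hz, hed z hz, hρz]
    refine (h2 _ _).trans ?_
    change _ = X.1 * Y.1 + ρ (e₁ (z.1, 0)) ^ 2 * ((ρ (ι 0) ^ 2)⁻¹ *
      G (e (0, z.2)) (fderiv ℝ τ z.2 X.2) (fderiv ℝ τ z.2 Y.2))
    rw [hτd, hτd, hed _ (h0s z.2), hed _ (h0s z.2)]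
    have h3 := (hall 0 ⟨by simpa using hδ, hδ⟩ (b z.2) (hbm z.2)).2 (0, fderiv ℝ b z.2 X.2)
      (0, fderiv ℝ b z.2 Y.2)
    have h4 : e₁ (0, 0) = ι 0 := he0 0 (Metric.mem_ball_self hδ)
    rw [h4] at h3
    change _ = X.1 * Y.1 + ρ (e₁ (z.1, 0)) ^ 2 * ((ρ (ι 0) ^ 2)⁻¹ * G (e₁ (0, b z.2))
      (fderiv ℝ e₁ (0, b z.2) (0, fderiv ℝ b z.2 X.2))
      (fderiv ℝ e₁ (0, b z.2) (0, fderiv ℝ b z.2 Y.2)))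
    rw [h3]
    field_simp
    ring

end WarpedChart

section WarpedStructure

variable {N : Type w} [TopologicalSpace N] {k : ℕ} [ChartedSpace (EuclideanSpace ℝ (Fin k)) N]

theorem hasMFDerivAt_prod_right {ψ : N → EuclideanSpace ℝ (Fin k)} {z : ℝ × N}
    (hψ : MDifferentiableAt (𝓡 k) (𝓡 k) ψ z.2) :
    HasMFDerivAt (𝓘(ℝ, ℝ).prod (𝓡 k)) 𝓘(ℝ, ℝ × EuclideanSpace ℝ (Fin k))
      (fun z : ℝ × N => (z.1, ψ z.2)) z
      ((ContinuousLinearMap.fst ℝ (TangentSpace 𝓘(ℝ, ℝ) z.1) (TangentSpace (𝓡 k) z.2)).prod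
        ((mfderiv (𝓡 k) (𝓡 k) ψ z.2).comp (ContinuousLinearMap.snd ℝ
          (TangentSpace 𝓘(ℝ, ℝ) z.1) (TangentSpace (𝓡 k) z.2)))) := by
  have h1 : HasMFDerivAt (𝓘(ℝ, ℝ).prod (𝓡 k)) 𝓘(ℝ, ℝ) (Prod.fst : ℝ × N → ℝ) z _ :=
    hasMFDerivAt_fst z
  have h2 : HasMFDerivAt (𝓘(ℝ, ℝ).prod (𝓡 k)) (𝓡 k) (ψ ∘ Prod.snd) z _ :=
    hψ.hasMFDerivAt.comp z (hasMFDerivAt_snd z)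
  exact ⟨h1.1.prodMk h2.1, h1.2.prodMk h2.2⟩

theorem contMDiff_prod_self {k : ℕ} : ContMDiff (𝓘(ℝ, ℝ).prod (𝓡 k))
    𝓘(ℝ, ℝ × EuclideanSpace ℝ (Fin k)) ∞ (fun z : ℝ × EuclideanSpace ℝ (Fin k) => z) :=
  contMDiff_fst.prodMk_space contMDiff_snd

/-- The product of the models of `ℝ` and `ℝᵏ` is formally not the model of the normed space `ℝ ×
ℝᵏ`. Composing with the identity, viewed as a map from one to the other, bridges the two. -/
theorem hasMFDerivAt_of_prod {k : ℕ} {E : Type*} [NormedAddCommGroup E] [NormedSpace ℝ E]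
    {f : ℝ × EuclideanSpace ℝ (Fin k) → E} {f' : ℝ × EuclideanSpace ℝ (Fin k) →L[ℝ] E}
    {z : ℝ × EuclideanSpace ℝ (Fin k)} (h : HasFDerivAt f f' z) :
    HasMFDerivAt (𝓘(ℝ, ℝ).prod (𝓡 k)) 𝓘(ℝ, E) f z f' := by
  have h1 := hasMFDerivAt_prod_right (ψ := id) (z := z) mdifferentiableAt_id
  have h2 := HasMFDerivAt.comp (g := f) z h.hasMFDerivAt h1
  refine h2.congr_mfderiv ?_
  rw [mfderiv_id]
  rfl

/-- A warped product structure from coordinates of warped product type. -/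
def WarpedProductNear.ofCoord {n : ℕ} {M : Type u} [TopologicalSpace M]
    [ChartedSpace (EuclideanSpace ℝ (Fin n)) M] [IsManifold (𝓡 n) ∞ M] {g : SmoothMetric n M}
    {p : M} {κ : OpenPartialHomeomorph M (EuclideanSpace ℝ (Fin n))}
    {G : EuclideanSpace ℝ (Fin n) → EuclideanSpace ℝ (Fin n) →L[ℝ]
      EuclideanSpace ℝ (Fin n) →L[ℝ] ℝ} (hG : IsMetricIn (metricField g) κ G)
    (hp : p ∈ κ.source)
    (e : OpenPartialHomeomorph (ℝ × EuclideanSpace ℝ (Fin (n - 1))) (EuclideanSpace ℝ (Fin n)))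
    (J : Set ℝ) (hJ : IsOpen J) (hJ' : J.OrdConnected) (hsrc : e.source = J ×ˢ univ)
    (htgt : e.target ⊆ κ.target) (he : ContDiffOn ℝ ∞ e e.source)
    (hes : ContDiffOn ℝ ∞ e.symm e.target) (hpe : κ p ∈ e.target)
    (f : ℝ → ℝ) (hf : ContDiffOn ℝ ∞ f J) (hf0 : ∀ r ∈ J, 0 < f r)
    (G₀ : EuclideanSpace ℝ (Fin (n - 1)) → EuclideanSpace ℝ (Fin (n - 1)) →L[ℝ]
      EuclideanSpace ℝ (Fin (n - 1)) →L[ℝ] ℝ) (hG₀ : IsCoordMetric G₀ univ)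
    (hmet : ∀ z ∈ e.source, ∀ X Y, G (e z) (fderiv ℝ e z X) (fderiv ℝ e z Y) =
      X.1 * Y.1 + f z.1 ^ 2 * G₀ z.2 X.2 Y.2) : WarpedProductNear.{u, 0} g p where
  N := EuclideanSpace ℝ (Fin (n - 1))
  gN := metricOfCoord G₀ hG₀
  J := J
  isOpen_J := hJ
  ordConnected_J := hJ'
  f := f
  smooth_f := hf
  pos_f := hf0
  Ψ := e.trans κ.symm
  source_eq := by
    rw [OpenPartialHomeomorph.trans_source, ← hsrc]
    exact inter_eq_left.2 fun z hz => htgt (e.map_source hz)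
  mem_target := by
    rw [OpenPartialHomeomorph.trans_target]
    exact ⟨hp, hpe⟩
  smooth := by
    have h1 : ContMDiffOn (𝓘(ℝ, ℝ).prod (𝓡 (n - 1))) (𝓡 n) ∞ e e.source :=
      he.contMDiffOn.comp contMDiff_prod_self.contMDiffOn fun z hz => hz
    exact hG.coord.smooth_symm.comp (h1.mono inter_subset_left) fun z hz => hz.2
  smooth_symm := by
    have h1 : ContMDiffOn (𝓡 n) (𝓘(ℝ, ℝ).prod (𝓡 (n - 1))) ∞ e.symm e.target :=
      (contDiff_fst.comp_contDiffOn hes).contMDiffOn.prodMk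
        (contDiff_snd.comp_contDiffOn hes).contMDiffOn
    refine h1.comp (hG.coord.smooth.mono ?_) ?_
    · exact fun x hx => hx.1
    · exact fun x hx => hx.2
  isometry := by
    intro z hz X Y
    have hze : z ∈ e.source := hz.1
    have hzκ : (e.trans κ.symm) z ∈ κ.source := κ.map_target hz.2
    have h1 : HasMFDerivAt (𝓘(ℝ, ℝ).prod (𝓡 (n - 1))) (𝓡 n) e z (fderiv ℝ e z) :=
      hasMFDerivAt_of_prod
        ((he.contDiffAt (e.open_source.mem_nhds hze)).differentiableAt (by simp)).hasFDerivAt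
    have h2 : MDifferentiableAt (𝓘(ℝ, ℝ).prod (𝓡 (n - 1))) (𝓡 n) (e.trans κ.symm) z :=
      (hG.coord.mdifferentiableAt_symm hz.2).comp z h1.mdifferentiableAt
    have h3 : ∀ X : TangentSpace (𝓘(ℝ, ℝ).prod (𝓡 (n - 1))) z,
        coordVec (𝓡 n) κ (mfderiv (𝓘(ℝ, ℝ).prod (𝓡 (n - 1))) (𝓡 n) (e.trans κ.symm) z X) =
        fderiv ℝ e z X := by
      intro X
      have h4 := mfderiv_comp z (hG.coord.mdifferentiableAt hzκ) h2
      have h5 : κ ∘ (e.trans κ.symm) =ᶠ[𝓝 z] e := by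
        filter_upwards [(e.trans κ.symm).open_source.mem_nhds hz] with w hw
        exact κ.right_inv hw.2
      exact DFunLike.congr_fun (h4.symm.trans (h5.mfderiv_eq.trans h1.mfderiv)) X
    refine (hG.eq _ hzκ _ _).trans ?_
    rw [h3, h3]
    have h6 : κ ((e.trans κ.symm) z) = e z := κ.right_inv hz.2
    rw [h6]
    exact hmet z hze X Y

end WarpedStructure
end

noncomputable section

/-! ### An oblique totally umbilical hypersurface comes from a profile curve. -/

section Forward

/-- The inverse function theorem on the line, restricted so that the source is an interval, as the
parameter set of a profile curve must be. -/
theorem exists_smooth_interval_homeomorph {x : ℝ → ℝ} {U : Set ℝ} (hU : IsOpen U)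
    (hx : ContDiffOn ℝ ∞ x U) {s d : ℝ} (hs : s ∈ U) (hd : HasDerivAt x d s) (hd0 : d ≠ 0) :
    ∃ δ > 0, Ioo (s - δ) (s + δ) ⊆ U ∧ ∃ e : OpenPartialHomeomorph ℝ ℝ,
      e.source = Ioo (s - δ) (s + δ) ∧ (∀ r, e r = x r) ∧ ContDiffOn ℝ ∞ e e.source ∧
      ContDiffOn ℝ ∞ e.symm e.target := by
  obtain ⟨e, hse, heU, hex, hes⟩ := exists_smooth_openPartialHomeomorph hU hx hs _
    (hd.hasFDerivAt_equiv hd0)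
  obtain ⟨δ, hδ, hsub⟩ := Metric.isOpen_iff.1 e.open_source s hse
  rw [Real.ball_eq_Ioo] at hsub
  have hsrc : (e.restrOpen (Ioo (s - δ) (s + δ)) isOpen_Ioo).source = Ioo (s - δ) (s + δ) := by
    rw [OpenPartialHomeomorph.restrOpen_source]; exact inter_eq_right.2 hsub
  refine ⟨δ, hδ, hsub.trans heU, e.restrOpen (Ioo (s - δ) (s + δ)) isOpen_Ioo, hsrc, hex, ?_, ?_⟩
  · rw [hsrc]
    exact (hx.mono (hsub.trans heU)).congr fun r _ => hex r
  · exact hes.mono fun y hy => hy.1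

variable {n : ℕ} {M : Type u} [TopologicalSpace M]
  [ChartedSpace (EuclideanSpace ℝ (Fin n)) M] [IsManifold (𝓡 n) ∞ M]

/-- Near a point where it is oblique, a totally umbilical hypersurface is a graph, in suitable
coordinates of the base, whose height function has a gradient proportional to the unit field of a
closed conformal field. -/
theorem Hypersurface.exists_isUnitConformal {g : SmoothMetric n M} {I : Set ℝ}
    {p : M} {t : ℝ} (F : Hypersurface.{u, v} n M I) (q : F.carrier)
    (humb : F.IsTotallyUmbilical g) (hobl : F.IsObliqueAt g q p t) :
    ∃ (κ : OpenPartialHomeomorph M (EuclideanSpace ℝ (Fin n)))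
      (G : EuclideanSpace ℝ (Fin n) → EuclideanSpace ℝ (Fin n) →L[ℝ]
        EuclideanSpace ℝ (Fin n) →L[ℝ] ℝ)
      (χ : OpenPartialHomeomorph (EuclideanSpace ℝ (Fin n)) F.carrier)
      (V : Set (EuclideanSpace ℝ (Fin n)))
      (T : EuclideanSpace ℝ (Fin n) → EuclideanSpace ℝ (Fin n))
      (ρ l : EuclideanSpace ℝ (Fin n) → ℝ) (c : ℝ),
      p ∈ κ.source ∧ IsMetricIn (metricField g) κ G ∧ κ p ∈ V ∧ V ⊆ χ.source ∧ V ⊆ κ.target ∧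
      ContMDiffOn (𝓡 n) (𝓡 n) ∞ χ χ.source ∧ ContMDiffOn (𝓡 n) (𝓡 n) ∞ χ.symm χ.target ∧
      χ (κ p) = q ∧ (∀ y ∈ χ.source, (F.map (χ y)).1 ∈ κ.source ∧ κ (F.map (χ y)).1 = y) ∧
      IsCoordMetric G V ∧ IsUnitConformal G V T ρ l ∧ c ^ 2 = 1 ∧
      ContDiffOn ℝ ∞ (fun y => (F.map (χ y)).2) χ.source ∧
      fderiv ℝ (fun y => (F.map (χ y)).2) (κ p) ≠ 0 ∧
      ∀ y ∈ V, 0 < 1 - ρ y ^ 2 ∧ ∀ a, √(1 - ρ y ^ 2) *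
        fderiv ℝ (fun y => (F.map (χ y)).2) y a = c * ρ y * G y (T y) a := by
  obtain ⟨hq, hver, hhor⟩ := hobl
  let E := EuclideanSpace ℝ (Fin n)
  let κ := chartAt E p
  have hκ : IsSmoothCoord (𝓡 n) κ := isSmoothCoord_chartAt p
  have hpκ : p ∈ κ.source := mem_chart_source E p
  let G := coordMetric g κ
  have hG : IsMetricIn (metricField g) κ G := isMetricIn_coordMetric g hκ
  obtain ⟨χ, hqχ, hχ, hχs, hχκ⟩ := exists_graph_param F.immersion hver hκ (by rw [hq]; exact hpκ)
  let y₀ : E := χ.symm q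
  have hy₀ : y₀ ∈ χ.source := χ.map_target hqχ
  have hχy₀ : χ y₀ = q := χ.right_inv hqχ
  have hκp : κ p = y₀ := by
    have := (hχκ y₀ hy₀).2
    rwa [hχy₀, hq] at this
  have hφ : ContMDiff (𝓡 n) ((𝓡 n).prod 𝓘(ℝ, ℝ)) ∞ F.map := contMDiffOn_univ.1 F.immersion.1
  obtain ⟨hDh, V, hV, hy₀V, hVχ, Y, l, c, hc, hY, hall⟩ := exists_closedConformal_of_umbilical hφ
    humb hG hχ hχs hχκ hy₀ (by rw [hχy₀]; exact hhor)
  let h : E → ℝ := fun y => (F.map (χ y)).2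
  have hh : ContDiffOn ℝ ∞ h χ.source := contMDiffOn_iff_contDiffOn.1
    (contMDiff_snd.comp_contMDiffOn (hφ.comp_contMDiffOn hχ))
  have hVκ : V ⊆ κ.target := fun y hy => by
    rw [← (hχκ y (hVχ hy)).2]; exact κ.map_source (hχκ y (hVχ hy)).1
  have hGV : IsCoordMetric G V := hG.metric.mono hV hVκ
  have hconf := isUnitConformal_of_closedConformal hGV hY (fun y hy => (hall y hy).1)
    (fun y hy => (hall y hy).2.2.1)
  let ρ : E → ℝ := fun y => √(G y (Y y) (Y y))
  let T : E → E := fun y => (ρ y)⁻¹ • Y y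
  have hρ0 : ∀ y ∈ V, 0 < ρ y := hconf.pos
  have hρ2 : ∀ y ∈ V, ρ y ^ 2 = G y (Y y) (Y y) := fun y hy =>
    Real.sq_sqrt (hGV.pos y hy _ (hall y hy).1).le
  have hgrad : ∀ y ∈ V, ∀ a, √(1 - ρ y ^ 2) * fderiv ℝ h y a = c * ρ y * G y (T y) a := by
    intro y hy a
    rw [hρ2 y hy]
    refine ((hall y hy).2.2.2 a).trans ?_
    change _ = c * ρ y * G y ((ρ y)⁻¹ • Y y) a
    rw [map_smul, smul_apply, smul_eq_mul]
    field_simp [(hρ0 y hy).ne']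
  have hρ1 : ∀ y ∈ V, 0 < 1 - ρ y ^ 2 := fun y hy => by
    rw [hρ2 y hy]; linarith [(hall y hy).2.1]
  refine ⟨κ, G, χ, V, T, ρ, l, c, hpκ, hG, by rwa [hκp], hVχ, hVκ, hχ, hχs, by rw [hκp, hχy₀], hχκ,
    hGV, hconf, hc, hh, by rwa [hκp], fun y hy => ⟨hρ1 y hy, hgrad y hy⟩⟩

/-- Near a point where it is oblique, a totally umbilical hypersurface is generated by a profile
curve in a warped product. -/
theorem Hypersurface.exists_isGeneratedNear (hn : 1 ≤ n) {g : SmoothMetric n M} {I : Set ℝ}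
    {p : M} {t : ℝ} (F : Hypersurface.{u, v} n M I) (q : F.carrier)
    (humb : F.IsTotallyUmbilical g) (hobl : F.IsObliqueAt g q p t) :
    ∃ (W : WarpedProductNear.{u, 0} g p) (c σ : ℝ) (A : Set ℝ) (x₀ x₁ : ℝ → ℝ),
      IsProfileCurve I W.J W.f c σ A x₀ x₁ ∧ F.IsGeneratedNear q W A x₀ x₁ := by
  let E := EuclideanSpace ℝ (Fin n)
  let D := EuclideanSpace ℝ (Fin (n - 1))
  obtain ⟨κ, G, χ, V, T, ρ, l, c, hpκ, hG, hpV, hVχ, hVκ, hχ, hχs, hχq, hχκ, hGV, hconf, hc, hh, hDh,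
    hall⟩ := F.exists_isUnitConformal q humb hobl
  have hV := hGV.isOpen
  have hρ0 := hconf.pos
  let h : E → ℝ := fun y => (F.map (χ y)).2
  have hgrad : ∀ y ∈ V, ∀ a, √(1 - ρ y ^ 2) * fderiv ℝ h y a = c * ρ y * G y (T y) a :=
    fun y hy => (hall y hy).2
  have hρ1 : ∀ y ∈ V, 0 < 1 - ρ y ^ 2 := fun y hy => (hall y hy).1
  have hc0 : c ≠ 0 := by rintro rfl; norm_num at hc
  have hdim : n - 1 + 1 = Module.finrank ℝ E := by
    simp only [E, finrank_euclideanSpace, Fintype.card_fin]; omega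
  -- The level set of the height through `κ p` serves as the fibre. It is orthogonal to `T` because
  -- `dh` is a nonzero multiple of `G(T, ·)`.
  obtain ⟨r, hr, ι, hι, hι0, hιV, hιinj⟩ := exists_levelSet_param (F := D)
    (by rw [← hdim]; simp [D]) hV (hh.mono hVχ) hpV hDh
  obtain ⟨δ, hδ, e, G₀, hsrc, htgt, he, hes, he00, hG₀, heall⟩ := exists_warped_coordinates_univ hGV
    hconf hdim hr hι (by rw [hι0]; exact hpV) (fun u hu huV a => by
      have h1 := hgrad (ι u) huV (fderiv ℝ ι u a)
      rw [(hιV u hu).2, mul_zero] at h1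
      have h2 : c * ρ (ι u) ≠ 0 := mul_ne_zero hc0 (hρ0 _ huV).ne'
      exact (mul_eq_zero.1 h1.symm).resolve_left h2) hιinj
  have heV : ∀ z ∈ e.source, e z ∈ V := fun z hz => htgt (e.map_source hz)
  let f : ℝ → ℝ := fun s => ρ (e (s, 0))
  have hs0 : ∀ s ∈ Ioo (-δ) δ, ∀ u : D, (s, u) ∈ e.source := fun s hs u => by
    rw [hsrc]; exact ⟨hs, mem_univ _⟩
  have hρe : ∀ z ∈ e.source, ρ (e z) = f z.1 := fun z hz => (heall z hz).2.1
  have hf : ContDiffOn ℝ ∞ f (Ioo (-δ) δ) := hconf.smooth_ρ.comp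
    (he.comp (contDiff_prodMk_left _).contDiffOn fun s hs => hs0 s hs 0)
    fun s hs => heV _ (hs0 s hs 0)
  have hf0 : ∀ s ∈ Ioo (-δ) δ, 0 < f s := fun s hs => hρ0 _ (heV _ (hs0 s hs 0))
  have hf1 : ∀ s ∈ Ioo (-δ) δ, 0 < 1 - f s ^ 2 := fun s hs => hρ1 _ (heV _ (hs0 s hs 0))
  have h00 : (0 : ℝ) ∈ Ioo (-δ) δ := ⟨by linarith, hδ⟩
  let W : WarpedProductNear.{u, 0} g p := WarpedProductNear.ofCoord hG hpκ e (Ioo (-δ) δ) isOpen_Ioo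
    ordConnected_Ioo hsrc (htgt.trans hVκ) he hes
    (by rw [← hι0, ← he00]; exact e.map_source (hs0 0 h00 0)) f hf hf0 G₀ hG₀
    (fun z hz X X' => (heall z hz).2.2 X X')
  -- the height function in these coordinates
  have hhe : ContDiffOn ℝ ∞ (h ∘ e) e.source := hh.comp he fun z hz => hVχ (heV z hz)
  have hhed : ∀ z ∈ e.source, HasFDerivAt (h ∘ e) (fderiv ℝ (h ∘ e) z) z := fun z hz =>
    ((hhe.contDiffAt (e.open_source.mem_nhds hz)).differentiableAt (by simp)).hasFDerivAt
  -- In these coordinates `G(T, ·)` is `dx₁`, so the height has derivative `c f / √(1 - f²)` in `x₁`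
  -- and none along the fibre.
  have hheX : ∀ z ∈ e.source, ∀ X, √(1 - f z.1 ^ 2) * fderiv ℝ (h ∘ e) z X = c * f z.1 * X.1 := by
    intro z hz X
    have h1 : HasFDerivAt e (fderiv ℝ e z) z :=
      ((he.contDiffAt (e.open_source.mem_nhds hz)).differentiableAt (by simp)).hasFDerivAt
    have h2 : HasFDerivAt h (fderiv ℝ h (e z)) (e z) :=
      ((hh.contDiffAt (χ.open_source.mem_nhds (hVχ (heV z hz)))).differentiableAt
        (by simp)).hasFDerivAt
    rw [(h2.comp z h1).fderiv, ← hρe z hz]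
    refine (hgrad _ (heV z hz) _).trans ?_
    have h3 := (heall z hz).2.2 (1, 0) X
    rw [(heall z hz).1, map_zero] at h3
    have h4 : G (e z) (T (e z)) (fderiv ℝ e z X) = X.1 := by
      refine h3.trans ?_
      simp
    exact congrArg (fun w : ℝ => c * ρ (e z) * w) h4
  have hconst : ∀ s ∈ Ioo (-δ) δ, ∀ u : D, h (e (s, u)) = h (e (s, 0)) := by
    intro s hs u
    have hd : ∀ u : D, HasFDerivAt (fun u : D => h (e (s, u))) (0 : D →L[ℝ] ℝ) u := by
      intro u
      have h1 := (hhed (s, u) (hs0 s hs u)).comp u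
        ((hasFDerivAt_const s u).prodMk (hasFDerivAt_id u))
      refine h1.congr_fderiv ?_
      ext1 a
      have h2 := hheX (s, u) (hs0 s hs u) (0, a)
      rw [mul_zero] at h2
      exact (mul_eq_zero.1 h2).resolve_left (Real.sqrt_pos.2 (hf1 s hs)).ne'
    exact is_const_of_fderiv_eq_zero (fun u => (hd u).differentiableAt) (fun u => (hd u).fderiv) u 0
  -- the profile curve
  have hode : ContDiffOn ℝ ∞ (fun s => √(1 - f s ^ 2)) (Ioo (-δ) δ) :=
    (contDiffOn_const.sub (hf.pow 2)).sqrt fun s hs => (hf1 s hs).ne'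
  obtain ⟨ε, hε, Φ, hΦ, hΦy⟩ := exists_smooth_flow isOpen_Ioo hode h00
  obtain ⟨hΦ0, hΦs⟩ := hΦy 0 (Metric.mem_ball_self hε)
  let x₁ : ℝ → ℝ := fun s => Φ (s, 0)
  have hx₁ : ContDiffOn ℝ ∞ x₁ (Ioo (-ε) ε) :=
    hΦ.comp (contDiff_prodMk_left _).contDiffOn fun s hs => ⟨hs, Metric.mem_ball_self hε⟩
  have h0ε : (0 : ℝ) ∈ Ioo (-ε) ε := ⟨by linarith, hε⟩
  -- The speed of `x₁` is positive, so after shrinking the interval `x₁` is a diffeomorphism onto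
  -- its image; the parametrization by `A × N` inherits this.
  obtain ⟨α, hα, hαε, ξ, hξsrc, hξx, hξ, hξs⟩ := exists_smooth_interval_homeomorph isOpen_Ioo hx₁ h0ε
    (hΦs 0 h0ε).2 (by rw [hΦ0]; exact (Real.sqrt_pos.2 (hf1 0 h00)).ne')
  let A : Set ℝ := Ioo (0 - α) (0 + α)
  have hxJ : ∀ s ∈ A, x₁ s ∈ Ioo (-δ) δ := fun s hs => (hΦs s (hαε hs)).1
  -- The height along the curve: the factor `√(1 - f²)` of `x₁'` cancels the denominator of the
  -- derivative of the height, leaving `x₀' = c f(x₁)`.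
  let x₀ : ℝ → ℝ := fun s => h (e (x₁ s, 0))
  have hx₁d : ∀ s ∈ A, HasDerivAt x₁ (√(1 - f (x₁ s) ^ 2)) s := fun s hs => (hΦs s (hαε hs)).2
  have hx₀d : ∀ s ∈ A, HasDerivAt x₀ (c * f (x₁ s)) s := by
    intro s hs
    have h1 := (hhed (x₁ s, 0) (hs0 _ (hxJ s hs) 0)).comp_hasDerivAt s
      ((hx₁d s hs).prodMk (hasDerivAt_const s (0 : D)))
    have h2 := hheX (x₁ s, 0) (hs0 _ (hxJ s hs) 0) (√(1 - f (x₁ s) ^ 2), 0)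
    have h3 := (Real.sqrt_pos.2 (hf1 _ (hxJ s hs))).ne'
    have h4 : c * f (x₁ s) = fderiv ℝ (h ∘ e) (x₁ s, 0) (√(1 - f (x₁ s) ^ 2), 0) :=
      mul_left_cancel₀ h3 (by rw [h2]; ring)
    rw [h4]
    exact h1
  -- Since `f` is the length of the horizontal part of a unit normal, the constant is `c = ± 1` and
  -- `c²` disappears. Taking `x₁` increasing gives `σ = 1`.
  refine ⟨W, c, 1, A, x₀, x₁, ⟨hc0, Or.inl rfl, isOpen_Ioo, ordConnected_Ioo, fun s _ => F.mem _,
    hxJ, fun s hs => ?_, hx₀d, fun s hs => ?_⟩, ?_⟩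
  · rw [hc, one_mul]
    exact sub_pos.1 (hf1 _ (hxJ s hs))
  · rw [hc, one_mul, one_mul]
    exact hx₁d s hs
  let ζ : OpenPartialHomeomorph (ℝ × D) (ℝ × D) := ξ.prod (OpenPartialHomeomorph.refl D)
  have hζz : ∀ z, ζ z = (x₁ z.1, z.2) := fun z => Prod.ext (hξx z.1) rfl
  let θ : OpenPartialHomeomorph (ℝ × D) E := ζ.trans e
  have hθ : ContDiffOn ℝ ∞ θ θ.source := by
    have h1 : ContDiffOn ℝ ∞ ζ (ξ.source ×ˢ univ) :=
      (hξ.comp contDiff_fst.contDiffOn fun z hz => hz.1).prodMk contDiff_snd.contDiffOn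
    refine he.comp (h1.mono ?_) ?_
    · exact fun z hz => hz.1
    · exact fun z hz => hz.2
  have hθs : ContDiffOn ℝ ∞ θ.symm θ.target := by
    have h1 : ContDiffOn ℝ ∞ ζ.symm (ξ.target ×ˢ univ) :=
      (hξs.comp contDiff_fst.contDiffOn fun z hz => hz.1).prodMk contDiff_snd.contDiffOn
    refine h1.comp (hes.mono ?_) ?_
    · exact fun z hz => hz.1
    · exact fun z hz => hz.2
  have hθsrc : θ.source = A ×ˢ univ := by
    ext z
    constructor
    · intro hz
      refine ⟨?_, mem_univ _⟩
      have : z.1 ∈ ξ.source := hz.1.1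
      rwa [hξsrc] at this
    · intro hz
      refine ⟨⟨?_, mem_univ _⟩, ?_⟩
      · rw [hξsrc]; exact hz.1
      · change ζ z ∈ e.source
        rw [hζz]; exact hs0 _ (hxJ _ hz.1) _
  have hθz : ∀ z, θ z = e (x₁ z.1, z.2) := fun z => congrArg e (hζz z)
  have hθχ : ∀ z ∈ θ.source, θ z ∈ χ.source := fun z hz =>
    hVχ (htgt (e.map_source (show ζ z ∈ e.source from hz.2)))
  let Ξ : OpenPartialHomeomorph (ℝ × D) F.carrier := θ.trans χ
  have hΞsrc : Ξ.source = A ×ˢ univ := by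
    rw [← hθsrc]
    exact inter_eq_left.2 hθχ
  have hA0 : (0 : ℝ) ∈ A := ⟨by linarith, by linarith⟩
  have hqΞ : Ξ (0, 0) = q := by
    change χ (θ (0, 0)) = q
    have h1 : x₁ 0 = 0 := hΦ0
    rw [hθz]
    simp only [h1]
    rw [he00, hι0, hχq]
  refine ⟨Ξ, hΞsrc, ?_, ?_, ?_, fun a ha => ?_⟩
  · rw [← hqΞ]
    exact Ξ.map_source (by rw [hΞsrc]; exact ⟨hA0, mem_univ _⟩)
  · have h1 : ContMDiffOn (𝓘(ℝ, ℝ).prod (𝓡 (n - 1))) (𝓡 n) ∞ θ θ.source :=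
      hθ.contMDiffOn.comp contMDiff_prod_self.contMDiffOn fun z hz => hz
    exact hχ.comp (h1.mono inter_subset_left) fun z hz => hz.2
  · have h1 : ContMDiffOn (𝓡 n) (𝓘(ℝ, ℝ).prod (𝓡 (n - 1))) ∞ θ.symm θ.target :=
      (contDiff_fst.comp_contDiffOn hθs).contMDiffOn.prodMk
        (contDiff_snd.comp_contDiffOn hθs).contMDiffOn
    refine h1.comp (hχs.mono ?_) ?_
    · exact fun x hx => hx.1
    · exact fun x hx => hx.2
  · have ha' : a ∈ θ.source := Set.mem_of_mem_inter_left ha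
    have haA : a.1 ∈ A := by rw [hθsrc] at ha'; exact ha'.1
    have h1 := hχκ (θ a) (hθχ a ha')
    refine Prod.ext ?_ ?_
    · change (F.map (χ (θ a))).1 = κ.symm (e (x₁ a.1, a.2))
      exact (κ.left_inv h1.1).symm.trans (congrArg κ.symm (h1.2.trans (hθz a)))
    · change h (θ a) = h (e (x₁ a.1, 0))
      exact (congrArg h (hθz a)).trans (hconst _ (hxJ _ haA) a.2)

end Forward
end

noncomputable section

/-! ### Regularity of profile curves. -/

section ODE

/-- Solutions of a smooth autonomous equation are smooth. -/
theorem contDiffOn_of_hasDerivAt_comp {x h : ℝ → ℝ} {A B : Set ℝ} (hA : IsOpen A)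
    (hh : ContDiffOn ℝ ∞ h B) (hm : MapsTo x A B) (hd : ∀ s ∈ A, HasDerivAt x (h (x s)) s) :
    ContDiffOn ℝ ∞ x A := by
  rw [contDiffOn_infty]
  intro m
  induction m with
  | zero => exact contDiffOn_zero.2 fun s hs => (hd s hs).continuousAt.continuousWithinAt
  -- Bootstrapping: if `x` is of class `C^m`, so is `x' = h ∘ x`, and `x` gains one derivative.
  | succ m ih =>
    have h1 : ContDiffOn ℝ (m + 1) x A := by
      refine (contDiffOn_succ_iff_deriv_of_isOpen hA).2
        ⟨fun s hs => (hd s hs).differentiableAt.differentiableWithinAt, by simp, ?_⟩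
      refine ((hh.of_le (by exact_mod_cast le_top)).comp ih hm).congr fun s hs => ?_
      exact (hd s hs).deriv
    exact_mod_cast h1

theorem contDiffOn_of_hasDerivAt {x d : ℝ → ℝ} {A : Set ℝ} (hA : IsOpen A)
    (hd' : ContDiffOn ℝ ∞ d A) (hd : ∀ s ∈ A, HasDerivAt x (d s) s) : ContDiffOn ℝ ∞ x A :=
  (contDiffOn_infty_iff_deriv_of_isOpen hA).2
    ⟨fun s hs => (hd s hs).differentiableAt.differentiableWithinAt,
      hd'.congr fun s hs => (hd s hs).deriv⟩

variable {I J A : Set ℝ} {f x₀ x₁ : ℝ → ℝ} {c σ : ℝ}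

theorem IsProfileCurve.sqrt_pos (h : IsProfileCurve I J f c σ A x₀ x₁) {s : ℝ} (hs : s ∈ A) :
    0 < √(1 - c ^ 2 * f (x₁ s) ^ 2) :=
  Real.sqrt_pos.2 (by linarith [h.lt_one s hs])

theorem IsProfileCurve.sign_sq (h : IsProfileCurve I J f c σ A x₀ x₁) : σ ^ 2 = 1 := by
  rcases h.sign with h | h <;> rw [h] <;> norm_num

theorem IsProfileCurve.deriv₁_ne (h : IsProfileCurve I J f c σ A x₀ x₁) {s : ℝ} (hs : s ∈ A) :
    σ * √(1 - c ^ 2 * f (x₁ s) ^ 2) ≠ 0 := by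
  refine mul_ne_zero (fun h0 => ?_) (h.sqrt_pos hs).ne'
  have := h.sign_sq
  rw [h0] at this
  norm_num at this

/-- A profile curve is only assumed to be differentiable. The strict inequality `c² f² < 1` keeps
the square root smooth along it, so the equation for `x₁` forces smoothness. -/
theorem IsProfileCurve.contDiffOn₁ (h : IsProfileCurve I J f c σ A x₀ x₁)
    (hf : ContDiffOn ℝ ∞ f J) : ContDiffOn ℝ ∞ x₁ A := by
  have h1 : ContDiffOn ℝ ∞ (fun r => σ * √(1 - c ^ 2 * f r ^ 2))
      (J ∩ {r | c ^ 2 * f r ^ 2 < 1}) := by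
    refine contDiffOn_const.mul (ContDiffOn.sqrt (contDiffOn_const.sub
      (contDiffOn_const.mul ((hf.mono inter_subset_left).pow 2))) fun r hr => ?_)
    have : c ^ 2 * f r ^ 2 < 1 := hr.2
    exact (sub_pos.2 this).ne'
  exact contDiffOn_of_hasDerivAt_comp h.isOpen h1 (fun s hs => ⟨h.mapsTo₁ hs, h.lt_one s hs⟩)
    h.deriv₁

theorem IsProfileCurve.contDiffOn₀ (h : IsProfileCurve I J f c σ A x₀ x₁)
    (hf : ContDiffOn ℝ ∞ f J) : ContDiffOn ℝ ∞ x₀ A :=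
  contDiffOn_of_hasDerivAt h.isOpen
    (contDiffOn_const.mul (hf.comp (h.contDiffOn₁ hf) h.mapsTo₁)) h.deriv₀

end ODE

/-! ### Connection of a warped product in coordinates. -/

section WarpedCoordMetric

variable {D : Type*} [NormedAddCommGroup D] [NormedSpace ℝ D]

/-- A warped product metric in coordinates. -/
def warpedCoordMetric (f : ℝ → ℝ) (G : D → D →L[ℝ] D →L[ℝ] ℝ) (y : ℝ × D) :
    (ℝ × D) →L[ℝ] (ℝ × D) →L[ℝ] ℝ :=
  (ContinuousLinearMap.mul ℝ ℝ).bilinearComp (ContinuousLinearMap.fst ℝ ℝ D)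
      (ContinuousLinearMap.fst ℝ ℝ D) +
    (f y.1 ^ 2) • (G y.2).bilinearComp (ContinuousLinearMap.snd ℝ ℝ D)
      (ContinuousLinearMap.snd ℝ ℝ D)

theorem warpedCoordMetric_apply (f : ℝ → ℝ) (G : D → D →L[ℝ] D →L[ℝ] ℝ) (y a b : ℝ × D) :
    warpedCoordMetric f G y a b = a.1 * b.1 + f y.1 ^ 2 * G y.2 a.2 b.2 := rfl

theorem IsCoordMetric.warped [FiniteDimensional ℝ D] {f : ℝ → ℝ} {J : Set ℝ} (hJ : IsOpen J)
    (hf : ContDiffOn ℝ ∞ f J) (hf0 : ∀ r ∈ J, 0 < f r) {G : D → D →L[ℝ] D →L[ℝ] ℝ} {V : Set D}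
    (hG : IsCoordMetric G V) : IsCoordMetric (warpedCoordMetric f G) (J ×ˢ V) := by
  refine ⟨hJ.prod hG.isOpen, ?_, fun y hy a b => ?_, fun y hy a ha => ?_⟩
  · rw [contDiffOn_clm_apply]
    intro a
    rw [contDiffOn_clm_apply]
    intro b
    simp only [warpedCoordMetric_apply]
    have h1 : ContDiffOn ℝ ∞ (fun y => G y a.2 b.2) V :=
      (hG.smooth.clm_apply contDiffOn_const).clm_apply contDiffOn_const
    exact contDiffOn_const.add (((hf.comp contDiff_fst.contDiffOn fun y hy => hy.1).pow 2).mul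
      (h1.comp contDiff_snd.contDiffOn fun y hy => hy.2))
  · rw [warpedCoordMetric_apply, warpedCoordMetric_apply, hG.symm _ hy.2, mul_comm]
  · rw [warpedCoordMetric_apply]
    have hf2 : 0 < f y.1 ^ 2 := pow_pos (hf0 _ hy.1) 2
    by_cases h1 : a.2 = 0
    · have h2 : a.1 ≠ 0 := fun h2 => ha (Prod.ext h2 h1)
      rw [h1, map_zero, mul_zero, add_zero]
      exact mul_self_pos.2 h2
    · exact add_pos_of_nonneg_of_pos (mul_self_nonneg _)
        (mul_pos hf2 (hG.pos _ hy.2 _ h1))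

/-- All coefficients that involve the radial direction are constant, so only the radial derivative
of `f²` contributes. In classical terms, the covariant derivative of `∂₁` is `f' / f` times the
projection to the fibre. -/
theorem coordChristoffel_warped [FiniteDimensional ℝ D] {f : ℝ → ℝ} {J : Set ℝ} (hJ : IsOpen J)
    (hf : ContDiffOn ℝ ∞ f J) (hf0 : ∀ r ∈ J, 0 < f r) {G : D → D →L[ℝ] D →L[ℝ] ℝ} {V : Set D}
    (hG : IsCoordMetric G V) {y : ℝ × D} (hy : y ∈ J ×ˢ V) (a b : ℝ × D) (r : ℝ) :
    coordChristoffel (warpedCoordMetric f G) y a (r, 0) b =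
      r * (f y.1 * deriv f y.1) * G y.2 a.2 b.2 := by
  have hd := (hG.warped hJ hf hf0).differentiableAt hy
  have h1 : ∀ d b : ℝ × D, fderiv ℝ (warpedCoordMetric f G) y d (r, 0) b = 0 := by
    intro d b
    rw [fderiv_apply_apply hd]
    simp [warpedCoordMetric_apply]
  have h2 : ∀ d b : ℝ × D, fderiv ℝ (warpedCoordMetric f G) y d b (r, 0) = 0 := by
    intro d b
    rw [fderiv_apply_apply hd]
    simp [warpedCoordMetric_apply]
  have h3 : fderiv ℝ (warpedCoordMetric f G) y (r, 0) a b =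
      2 * (r * (f y.1 * deriv f y.1) * G y.2 a.2 b.2) := by
    rw [fderiv_apply_apply hd]
    have hdf : HasDerivAt f (deriv f y.1) y.1 :=
      ((hf.contDiffAt (hJ.mem_nhds hy.1)).differentiableAt (by simp)).hasDerivAt
    have hslice : HasDerivAt (fun s : ℝ => (y.1 + s * r, y.2)) (r, (0 : D)) 0 := by
      have := (((hasDerivAt_id (0 : ℝ)).mul_const r).const_add y.1).prodMk
        (hasDerivAt_const (0 : ℝ) y.2)
      simpa using this
    have hb : DifferentiableAt ℝ (fun z => warpedCoordMetric f G z a b) y :=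
      (hd.clm_apply (differentiableAt_const _)).clm_apply (differentiableAt_const _)
    have h4 : HasDerivAt (fun s : ℝ => warpedCoordMetric f G (y.1 + s * r, y.2) a b)
        (fderiv ℝ (fun z => warpedCoordMetric f G z a b) y (r, 0)) 0 := by
      refine HasFDerivAt.comp_hasDerivAt (l := fun z => warpedCoordMetric f G z a b) 0 ?_ hslice
      simp only [zero_mul, add_zero]
      exact hb.hasFDerivAt
    have h5 : HasDerivAt (fun s : ℝ => a.1 * b.1 + f (y.1 + s * r) ^ 2 * G y.2 a.2 b.2)
        (2 * (r * (f y.1 * deriv f y.1) * G y.2 a.2 b.2)) 0 := by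
      have h6 : HasDerivAt (fun s : ℝ => y.1 + s * r) r 0 := by
        simpa using ((hasDerivAt_id (0 : ℝ)).mul_const r).const_add y.1
      have h7 : HasDerivAt (fun s : ℝ => f (y.1 + s * r)) (deriv f y.1 * r) 0 := by
        refine HasDerivAt.comp 0 ?_ h6
        simpa using hdf
      refine (((h7.pow 2).mul_const (G y.2 a.2 b.2)).const_add (a.1 * b.1)).congr_deriv ?_
      simp
      ring
    exact h4.unique h5
  rw [coordChristoffel, h1, h2, h3]
  ring

end WarpedCoordMetric

/-! ### Coordinates on a warped product structure. -/

section Converse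

variable {n : ℕ} {M : Type u} [TopologicalSpace M]
  [ChartedSpace (EuclideanSpace ℝ (Fin n)) M] [IsManifold (𝓡 n) ∞ M] {g : SmoothMetric n M}
  {p : M}

theorem WarpedProductNear.mdifferentiable (W : WarpedProductNear.{u, w} g p) :
    W.Ψ.MDifferentiable (𝓘(ℝ, ℝ).prod (𝓡 (n - 1))) (𝓡 n) :=
  ⟨W.smooth.mdifferentiableOn (by simp), W.smooth_symm.mdifferentiableOn (by simp)⟩

/-- Coordinates on the base of a warped product give coordinates on the warped product. -/
def WarpedProductNear.coord (W : WarpedProductNear.{u, w} g p) (u : W.N) :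
    OpenPartialHomeomorph M (ℝ × EuclideanSpace ℝ (Fin (n - 1))) :=
  W.Ψ.symm.trans ((OpenPartialHomeomorph.refl ℝ).prod (chartAt (EuclideanSpace ℝ (Fin (n - 1))) u))

theorem WarpedProductNear.mem_coord_source (W : WarpedProductNear.{u, w} g p) {u : W.N}
    {z : ℝ × W.N} (hz : z.1 ∈ W.J)
    (hzu : z.2 ∈ (chartAt (EuclideanSpace ℝ (Fin (n - 1))) u).source) :
    W.Ψ z ∈ (W.coord u).source := by
  have hzs : z ∈ W.Ψ.source := by rw [W.source_eq]; exact ⟨hz, mem_univ _⟩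
  refine ⟨W.Ψ.map_source hzs, ?_⟩
  change W.Ψ.symm (W.Ψ z) ∈ ((OpenPartialHomeomorph.refl ℝ).prod
    (chartAt (EuclideanSpace ℝ (Fin (n - 1))) u)).source
  rw [W.Ψ.left_inv hzs]
  exact ⟨mem_univ _, hzu⟩

theorem WarpedProductNear.coord_apply (W : WarpedProductNear.{u, w} g p) {u : W.N}
    {z : ℝ × W.N} (hz : z.1 ∈ W.J) : W.coord u (W.Ψ z) =
      (z.1, chartAt (EuclideanSpace ℝ (Fin (n - 1))) u z.2) := by
  have hzs : z ∈ W.Ψ.source := by rw [W.source_eq]; exact ⟨hz, mem_univ _⟩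
  change ((W.Ψ.symm (W.Ψ z)).1, chartAt (EuclideanSpace ℝ (Fin (n - 1))) u
    (W.Ψ.symm (W.Ψ z)).2) = _
  rw [W.Ψ.left_inv hzs]

theorem WarpedProductNear.isSmoothCoord (W : WarpedProductNear.{u, w} g p) (u : W.N) :
    IsSmoothCoord (𝓡 n) (W.coord u) := by
  have hk := isSmoothCoord_chartAt (n := n - 1) u
  constructor
  · have h1 : ContMDiffOn (𝓘(ℝ, ℝ).prod (𝓡 (n - 1))) 𝓘(ℝ, ℝ × EuclideanSpace ℝ (Fin (n - 1))) ∞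
        (fun z : ℝ × W.N => (z.1, chartAt (EuclideanSpace ℝ (Fin (n - 1))) u z.2))
        (univ ×ˢ (chartAt (EuclideanSpace ℝ (Fin (n - 1))) u).source) :=
      contMDiff_fst.contMDiffOn.prodMk_space
        (hk.smooth.comp contMDiff_snd.contMDiffOn fun z hz => hz.2)
    refine h1.comp (W.smooth_symm.mono ?_) ?_
    · exact fun x hx => hx.1
    · exact fun x hx => hx.2
  · have h1 : ContMDiffOn 𝓘(ℝ, ℝ × EuclideanSpace ℝ (Fin (n - 1))) (𝓘(ℝ, ℝ).prod (𝓡 (n - 1))) ∞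
        (fun y : ℝ × EuclideanSpace ℝ (Fin (n - 1)) =>
          (y.1, (chartAt (EuclideanSpace ℝ (Fin (n - 1))) u).symm y.2))
        (univ ×ˢ (chartAt (EuclideanSpace ℝ (Fin (n - 1))) u).target) :=
      contDiff_fst.contMDiff.contMDiffOn.prodMk
        (hk.smooth_symm.comp contDiff_snd.contMDiff.contMDiffOn fun z hz => hz.2)
    refine W.smooth.comp (h1.mono ?_) ?_
    · exact fun x hx => hx.1
    · exact fun x hx => hx.2

theorem WarpedProductNear.coordVec_coord (W : WarpedProductNear.{u, w} g p) {u : W.N}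
    {z : ℝ × W.N} (hz : z.1 ∈ W.J)
    (hzu : z.2 ∈ (chartAt (EuclideanSpace ℝ (Fin (n - 1))) u).source)
    (X : TangentSpace (𝓘(ℝ, ℝ).prod (𝓡 (n - 1))) z) :
    coordVec (𝓡 n) (W.coord u) (mfderiv (𝓘(ℝ, ℝ).prod (𝓡 (n - 1))) (𝓡 n) W.Ψ z X) =
      (X.1, coordVec (𝓡 (n - 1)) (chartAt (EuclideanSpace ℝ (Fin (n - 1))) u) (z := z.2) X.2) := by
  have hzs : z ∈ W.Ψ.source := by rw [W.source_eq]; exact ⟨hz, mem_univ _⟩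
  have h1 := mfderiv_comp z ((W.isSmoothCoord u).mdifferentiableAt (W.mem_coord_source hz hzu))
    (W.mdifferentiable.mdifferentiableAt hzs)
  have h2 := hasMFDerivAt_prod_right (z := z)
    ((isSmoothCoord_chartAt (n := n - 1) u).mdifferentiableAt hzu)
  have h3 : W.coord u ∘ W.Ψ =ᶠ[𝓝 z]
      fun z => (z.1, chartAt (EuclideanSpace ℝ (Fin (n - 1))) u z.2) := by
    filter_upwards [W.Ψ.open_source.mem_nhds hzs] with z' hz'
    rw [W.source_eq] at hz'
    exact W.coord_apply hz'.1
  exact DFunLike.congr_fun (h1.symm.trans (h3.mfderiv_eq.trans h2.mfderiv)) X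

theorem WarpedProductNear.isMetricIn (W : WarpedProductNear.{u, w} g p) (u : W.N) :
    IsMetricIn (metricField g) (W.coord u) (warpedCoordMetric W.f
      (coordMetric W.gN (chartAt (EuclideanSpace ℝ (Fin (n - 1))) u))) := by
  have hk := isMetricIn_coordMetric W.gN (isSmoothCoord_chartAt (n := n - 1) u)
  refine ⟨W.isSmoothCoord u, ?_, fun x hx X Y => ?_⟩
  · refine (hk.metric.warped W.isOpen_J W.smooth_f W.pos_f).mono (W.coord u).open_target ?_
    intro y hy
    refine ⟨?_, hy.1.2⟩
    have h1 : ((y.1, (chartAt (EuclideanSpace ℝ (Fin (n - 1))) u).symm y.2) : ℝ × W.N) ∈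
      W.Ψ.source := hy.2
    rw [W.source_eq] at h1
    exact h1.1
  · obtain ⟨z, hzs, rfl⟩ : ∃ z ∈ W.Ψ.source, W.Ψ z = x :=
      ⟨W.Ψ.symm x, W.Ψ.map_target hx.1, W.Ψ.right_inv hx.1⟩
    have hzJ : z.1 ∈ W.J := by rw [W.source_eq] at hzs; exact hzs.1
    have hzu : z.2 ∈ (chartAt (EuclideanSpace ℝ (Fin (n - 1))) u).source := by
      have h1 : W.Ψ.symm (W.Ψ z) ∈ (((OpenPartialHomeomorph.refl ℝ).prod
        (chartAt (EuclideanSpace ℝ (Fin (n - 1))) u)).source) := hx.2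
      rw [W.Ψ.left_inv hzs] at h1
      exact h1.2
    obtain ⟨X, rfl⟩ := W.mdifferentiable.mfderiv_surjective hzs X
    obtain ⟨Y, rfl⟩ := W.mdifferentiable.mfderiv_surjective hzs Y
    rw [W.coordVec_coord hzJ hzu, W.coordVec_coord hzJ hzu, W.coord_apply hzJ,
      warpedCoordMetric_apply]
    refine (W.isometry z hzs X Y).trans ?_
    exact congrArg (fun r : ℝ => X.1 * Y.1 + W.f z.1 ^ 2 * r) (hk.eq z.2 hzu X.2 Y.2)

end Converse
end

noncomputable section

/-! ### Hypersurfaces generated by profile curves are totally umbilical. -/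

section Generated

variable {n : ℕ} {M : Type u} [TopologicalSpace M]
  [ChartedSpace (EuclideanSpace ℝ (Fin n)) M] [IsManifold (𝓡 n) ∞ M] {g : SmoothMetric n M}
  {p : M}

theorem WarpedProductNear.mfderiv_generated (W : WarpedProductNear.{u, w} g p) {x₀ x₁ : ℝ → ℝ}
    {a : ℝ × W.N} {d₀ d₁ : ℝ} (ha : x₁ a.1 ∈ W.J) (h₀ : HasDerivAt x₀ d₀ a.1)
    (h₁ : HasDerivAt x₁ d₁ a.1) (X : TangentSpace (𝓘(ℝ, ℝ).prod (𝓡 (n - 1))) a) :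
    mfderiv (𝓘(ℝ, ℝ).prod (𝓡 (n - 1))) ((𝓡 n).prod 𝓘(ℝ, ℝ)) (W.generated x₀ x₁) a X =
      (mfderiv (𝓘(ℝ, ℝ).prod (𝓡 (n - 1))) (𝓡 n) W.Ψ (x₁ a.1, a.2)
        ((X.1 * d₁ : ℝ), X.2), (X.1 * d₀ : ℝ)) := by
  have hs : (x₁ a.1, a.2) ∈ W.Ψ.source := by rw [W.source_eq]; exact ⟨ha, mem_univ _⟩
  have hfst : HasMFDerivAt (𝓘(ℝ, ℝ).prod (𝓡 (n - 1))) 𝓘(ℝ, ℝ) (Prod.fst : ℝ × W.N → ℝ) a _ :=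
    hasMFDerivAt_fst a
  have h2 := h₁.hasFDerivAt.hasMFDerivAt.comp a hfst
  have h3 := h₀.hasFDerivAt.hasMFDerivAt.comp a hfst
  have h4 : HasMFDerivAt (𝓘(ℝ, ℝ).prod (𝓡 (n - 1))) (𝓘(ℝ, ℝ).prod (𝓡 (n - 1)))
      (fun a : ℝ × W.N => (x₁ a.1, a.2)) a _ := h2.prodMk (hasMFDerivAt_snd a)
  have h5 := (W.mdifferentiable.mdifferentiableAt hs).hasMFDerivAt.comp a h4
  have h6 : HasMFDerivAt (𝓘(ℝ, ℝ).prod (𝓡 (n - 1))) ((𝓡 n).prod 𝓘(ℝ, ℝ))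
      (W.generated x₀ x₁) a _ := h5.prodMk h3
  exact DFunLike.congr_fun h6.mfderiv X

variable {I A : Set ℝ} {x₀ x₁ : ℝ → ℝ} {c σ : ℝ}

theorem WarpedProductNear.contMDiffOn_generated (W : WarpedProductNear.{u, w} g p)
    (h : IsProfileCurve I W.J W.f c σ A x₀ x₁) :
    ContMDiffOn (𝓘(ℝ, ℝ).prod (𝓡 (n - 1))) ((𝓡 n).prod 𝓘(ℝ, ℝ)) ∞ (W.generated x₀ x₁)
      (A ×ˢ univ) := by
  have h1 : ContMDiffOn (𝓘(ℝ, ℝ).prod (𝓡 (n - 1))) 𝓘(ℝ, ℝ) ∞ (fun a : ℝ × W.N => x₁ a.1)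
      (A ×ˢ univ) := (h.contDiffOn₁ W.smooth_f).contMDiffOn.comp contMDiff_fst.contMDiffOn
        fun a ha => ha.1
  have h0 : ContMDiffOn (𝓘(ℝ, ℝ).prod (𝓡 (n - 1))) 𝓘(ℝ, ℝ) ∞ (fun a : ℝ × W.N => x₀ a.1)
      (A ×ˢ univ) := (h.contDiffOn₀ W.smooth_f).contMDiffOn.comp contMDiff_fst.contMDiffOn
        fun a ha => ha.1
  refine (W.smooth.comp (h1.prodMk contMDiff_snd.contMDiffOn) fun a ha => ?_).prodMk h0
  rw [W.source_eq]
  exact ⟨h.mapsTo₁ ha.1, mem_univ _⟩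

/-- Because `x₁' ≠ 0` and `Ψ` is a local diffeomorphism, the projection to `M` already has an
injective differential. For the same reason the hypersurface is nowhere vertical. -/
theorem WarpedProductNear.isSmoothImmersionOn_generated (W : WarpedProductNear.{u, w} g p)
    (h : IsProfileCurve I W.J W.f c σ A x₀ x₁) :
    IsSmoothImmersionOn (𝓘(ℝ, ℝ).prod (𝓡 (n - 1))) ((𝓡 n).prod 𝓘(ℝ, ℝ))
      (W.generated x₀ x₁) (A ×ˢ univ) := by
  refine ⟨W.contMDiffOn_generated h, fun a ha => ?_⟩
  refine (injective_iff_map_eq_zero _).2 fun X hX => ?_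
  have hJ := h.mapsTo₁ ha.1
  have hs : (x₁ a.1, a.2) ∈ W.Ψ.source := by rw [W.source_eq]; exact ⟨hJ, mem_univ _⟩
  rw [W.mfderiv_generated hJ (h.deriv₀ _ ha.1) (h.deriv₁ _ ha.1)] at hX
  have h1 := congrArg Prod.fst hX
  have h2 := W.mdifferentiable.mfderiv_injective hs (h1.trans (map_zero _).symm)
  have h3 : (X.1 * (σ * √(1 - c ^ 2 * W.f (x₁ a.1) ^ 2)) : ℝ) = 0 := congrArg Prod.fst h2
  have h4 : X.2 = 0 := congrArg Prod.snd h2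
  exact Prod.ext ((mul_eq_zero.1 h3).resolve_right (h.deriv₁_ne ha.1)) h4

theorem WarpedProductNear.not_isVerticalAt_generated (W : WarpedProductNear.{u, w} g p)
    (h : IsProfileCurve I W.J W.f c σ A x₀ x₁) {a : ℝ × W.N} (ha : a.1 ∈ A) :
    ¬ IsVerticalAt n (𝓘(ℝ, ℝ).prod (𝓡 (n - 1))) (W.generated x₀ x₁) a := by
  rintro ⟨X, hX⟩
  have hJ := h.mapsTo₁ ha
  have hs : (x₁ a.1, a.2) ∈ W.Ψ.source := by rw [W.source_eq]; exact ⟨hJ, mem_univ _⟩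
  rw [W.mfderiv_generated hJ (h.deriv₀ _ ha) (h.deriv₁ _ ha)] at hX
  have h1 := congrArg Prod.fst hX
  have h2 := W.mdifferentiable.mfderiv_injective hs (h1.trans (map_zero _).symm)
  have h3 : (X.1 * (σ * √(1 - c ^ 2 * W.f (x₁ a.1) ^ 2)) : ℝ) = 0 := congrArg Prod.fst h2
  have h4 : (X.1 * (c * W.f (x₁ a.1)) : ℝ) = 1 := congrArg Prod.snd hX
  have h5 : X.1 = (0 : ℝ) := (mul_eq_zero.1 h3).resolve_right (h.deriv₁_ne ha)
  have h6 : (0 * (c * W.f (x₁ a.1)) : ℝ) = 1 :=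
    (congrArg (fun r : ℝ => r * (c * W.f (x₁ a.1))) h5.symm).trans h4
  simp at h6

theorem WarpedProductNear.not_isHorizontalAt_generated (W : WarpedProductNear.{u, w} g p)
    (h : IsProfileCurve I W.J W.f c σ A x₀ x₁) {a : ℝ × W.N} (ha : a.1 ∈ A) :
    ¬ IsHorizontalAt (𝓘(ℝ, ℝ).prod (𝓡 (n - 1))) g (W.generated x₀ x₁) a := by
  intro hX
  have hJ := h.mapsTo₁ ha
  let X : TangentSpace (𝓘(ℝ, ℝ).prod (𝓡 (n - 1))) a :=
    ((1 : ℝ), (0 : EuclideanSpace ℝ (Fin (n - 1))))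
  have h1 := hX X
  rw [W.mfderiv_generated hJ (h.deriv₀ _ ha) (h.deriv₁ _ ha)] at h1
  have h2 : (0 : ℝ) + 1 * (1 * (c * W.f (x₁ a.1))) = 0 := by
    refine Eq.trans ?_ h1
    refine congrArg (fun r : ℝ => r + 1 * (1 * (c * W.f (x₁ a.1)))) ?_
    exact (DFunLike.congr_fun (map_zero (g.inner _)) _).symm
  have h3 : c * W.f (x₁ a.1) = 0 := by linarith
  rcases mul_eq_zero.1 h3 with h3 | h3
  · exact h.c_ne h3
  · exact (W.pos_f _ hJ).ne' h3

/-- The unit normal is `-c f ∂₁ + x₁' ξ`. Along the profile, `x₁'' = -c² f f'` gives its derivative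
as `-c f' (x₁', c f)`. Along the fibre, the warped connection gives `-c f` times `f' / f`. Both
factors equal `-c f'`. -/
theorem WarpedProductNear.isTotallyUmbilicalOn_generated (W : WarpedProductNear.{u, w} g p)
    (h : IsProfileCurve I W.J W.f c σ A x₀ x₁) :
    IsTotallyUmbilicalOn (𝓘(ℝ, ℝ).prod (𝓡 (n - 1))) (prodMetric g)
      (W.generated x₀ x₁) (A ×ˢ univ) := by
  let D := EuclideanSpace ℝ (Fin (n - 1))
  refine isTotallyUmbilicalOn_of_coord (E' := (ℝ × D) × ℝ) fun a ha => ?_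
  let u := a.2
  let k := chartAt D u
  let e := W.coord u
  let GN := coordMetric W.gN k
  have hGN : IsMetricIn (metricField W.gN) k GN :=
    isMetricIn_coordMetric W.gN (isSmoothCoord_chartAt (n := n - 1) u)
  have hme := W.isMetricIn u
  let d : ℝ → ℝ := fun s => σ * √(1 - c ^ 2 * W.f (x₁ s) ^ 2)
  have hd2 : ∀ s ∈ A, d s * d s = 1 - c ^ 2 * W.f (x₁ s) ^ 2 := fun s hs => by
    have h1 := Real.sq_sqrt (sub_pos.2 (h.lt_one s hs)).le
    have h2 := h.sign_sq
    calc d s * d s = σ ^ 2 * √(1 - c ^ 2 * W.f (x₁ s) ^ 2) ^ 2 := by simp only [d]; ring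
      _ = _ := by rw [h1, h2, one_mul]
  let v₁ : ℝ → (ℝ × D) × ℝ := fun s => ((-(c * W.f (x₁ s)), 0), d s)
  have hx₁ := h.contDiffOn₁ W.smooth_f
  have hf₁ : ContDiffOn ℝ ∞ (fun s => W.f (x₁ s)) A := W.smooth_f.comp hx₁ h.mapsTo₁
  have hdC : ContDiffOn ℝ ∞ d A := contDiffOn_const.mul
    ((contDiffOn_const.sub (contDiffOn_const.mul (hf₁.pow 2))).sqrt fun s hs =>
      (sub_pos.2 (h.lt_one s hs)).ne')
  have hv₁ : ContDiffOn ℝ ∞ v₁ A :=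
    ((contDiffOn_const.mul hf₁).neg.prodMk contDiffOn_const).prodMk hdC
  have hfd : ∀ s ∈ A, HasDerivAt (fun s => W.f (x₁ s)) (deriv W.f (x₁ s) * d s) s := by
    intro s hs
    have h1 : HasDerivAt W.f (deriv W.f (x₁ s)) (x₁ s) :=
      ((W.smooth_f.contDiffAt (W.isOpen_J.mem_nhds (h.mapsTo₁ hs))).differentiableAt
        (by simp)).hasDerivAt
    exact h1.comp s (h.deriv₁ s hs)
  -- Differentiate `d² = 1 - c² f(x₁)²` and divide by `2 d`, which is not zero.
  have hdd : ∀ s ∈ A, HasDerivAt d (-(c ^ 2 * W.f (x₁ s) * deriv W.f (x₁ s))) s := by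
    intro s hs
    have h1 : HasDerivAt d (deriv d s) s :=
      ((hdC.contDiffAt (h.isOpen.mem_nhds hs)).differentiableAt (by simp)).hasDerivAt
    have h2 := h1.mul h1
    have h3 : HasDerivAt (fun s => 1 - c ^ 2 * W.f (x₁ s) ^ 2) _ s :=
      (((hfd s hs).pow 2).const_mul (c ^ 2)).const_sub 1
    have h4 : (d * d) =ᶠ[𝓝 s] fun s => 1 - c ^ 2 * W.f (x₁ s) ^ 2 := by
      filter_upwards [h.isOpen.mem_nhds hs] with r hr using hd2 r hr
    have h5 := h2.unique (h3.congr_of_eventuallyEq h4)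
    have h6 : d s ≠ 0 := h.deriv₁_ne hs
    have h7 : deriv d s = -(c ^ 2 * W.f (x₁ s) * deriv W.f (x₁ s)) := by
      apply mul_left_cancel₀ h6
      simp at h5
      linarith
    rw [← h7]; exact h1
  have hv₁d : ∀ s ∈ A, HasDerivAt v₁ ((-(c * (deriv W.f (x₁ s) * d s)), 0),
      -(c ^ 2 * W.f (x₁ s) * deriv W.f (x₁ s))) s := fun s hs =>
    (((hfd s hs).const_mul c).neg.prodMk (hasDerivAt_const s (0 : D))).prodMk (hdd s hs)
  let V : Set (ℝ × W.N) := A ×ˢ k.source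
  have hVA : V ⊆ A ×ˢ univ := prod_mono_right (subset_univ _)
  have hVe : ∀ b ∈ V, W.Ψ (x₁ b.1, b.2) ∈ e.source := fun b hb =>
    W.mem_coord_source (h.mapsTo₁ hb.1) hb.2
  have hvec : ∀ b ∈ V, ∀ X : TangentSpace (𝓘(ℝ, ℝ).prod (𝓡 (n - 1))) b,
      coordVec ((𝓡 n).prod 𝓘(ℝ, ℝ)) (prodCoord e)
        (mfderiv (𝓘(ℝ, ℝ).prod (𝓡 (n - 1))) ((𝓡 n).prod 𝓘(ℝ, ℝ)) (W.generated x₀ x₁) b X) =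
      (((X.1 * d b.1 : ℝ), coordVec (𝓡 (n - 1)) k (z := b.2) X.2),
        (X.1 * (c * W.f (x₁ b.1)) : ℝ)) := by
    intro b hb X
    rw [W.mfderiv_generated (h.mapsTo₁ hb.1) (h.deriv₀ _ hb.1) (h.deriv₁ _ hb.1)]
    refine (coordVec_prodCoord (z := W.generated x₀ x₁ b) hme.coord (hVe b hb) _).trans ?_
    refine Prod.ext ?_ rfl
    exact W.coordVec_coord (z := (x₁ b.1, b.2)) (h.mapsTo₁ hb.1) hb.2 _
  have hpt : ∀ b ∈ V, (prodCoord e (W.generated x₀ x₁ b)).1 = (x₁ b.1, k b.2) := fun b hb =>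
    W.coord_apply (z := (x₁ b.1, b.2)) (h.mapsTo₁ hb.1)
  refine ⟨prodCoord e, prodCoordMetric (warpedCoordMetric W.f GN), V, fun b => v₁ b.1,
    fun b => c * deriv W.f (x₁ b.1), hme.prod, h.isOpen.prod k.open_source,
    ⟨ha.1, mem_chart_source D u⟩, hVA, fun b hb => mem_prodCoord_source.2 (hVe b hb),
    (W.contMDiffOn_generated h).mono hVA,
    hv₁.contMDiffOn.comp contMDiff_fst.contMDiffOn fun b hb => hb.1, fun b hb => ⟨?_, fun X => ⟨?_,
      fun w => ?_⟩⟩⟩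
  · rw [prodCoordMetric_apply, warpedCoordMetric_apply]
    simp only [v₁, map_zero, mul_zero, add_zero]
    have := hd2 b.1 hb.1
    linarith
  · rw [hvec b hb, prodCoordMetric_apply, warpedCoordMetric_apply]
    simp only [v₁, map_zero, zero_apply, mul_zero, add_zero]
    ring
  · have hy : (prodCoord e (W.generated x₀ x₁ b)).1 ∈ W.J ×ˢ k.target := by
      rw [hpt b hb]; exact ⟨h.mapsTo₁ hb.1, k.map_source hb.2⟩
    have hdv : (mfderiv (𝓘(ℝ, ℝ).prod (𝓡 (n - 1))) 𝓘(ℝ, (ℝ × D) × ℝ) (fun b => v₁ b.1) b X :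
        (ℝ × D) × ℝ) = X.1 • (((-(c * (deriv W.f (x₁ b.1) * d b.1)), 0),
          -(c ^ 2 * W.f (x₁ b.1) * deriv W.f (x₁ b.1))) : (ℝ × D) × ℝ) := by
      have hfst : HasMFDerivAt (𝓘(ℝ, ℝ).prod (𝓡 (n - 1))) 𝓘(ℝ, ℝ) (Prod.fst : ℝ × W.N → ℝ) b _ :=
        hasMFDerivAt_fst b
      have h1 := (hv₁d b.1 hb.1).hasFDerivAt.hasMFDerivAt.comp b hfst
      exact DFunLike.congr_fun h1.mfderiv X
    -- Stated for a variable `w'` in the coordinate space, so that the computation takes place there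
    -- and not in a tangent space.
    have key : ∀ w' : (ℝ × D) × ℝ, w' = X.1 • (((-(c * (deriv W.f (x₁ b.1) * d b.1)), 0),
          -(c ^ 2 * W.f (x₁ b.1) * deriv W.f (x₁ b.1))) : (ℝ × D) × ℝ) →
        prodCoordMetric (warpedCoordMetric W.f GN) (prodCoord e (W.generated x₀ x₁ b)) w' w +
          coordChristoffel (prodCoordMetric (warpedCoordMetric W.f GN))
            (prodCoord e (W.generated x₀ x₁ b))
            (((X.1 * d b.1 : ℝ), coordVec (𝓡 (n - 1)) k (z := b.2) X.2),
              (X.1 * (c * W.f (x₁ b.1)) : ℝ)) (v₁ b.1) w =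
        -(c * deriv W.f (x₁ b.1)) *
          prodCoordMetric (warpedCoordMetric W.f GN) (prodCoord e (W.generated x₀ x₁ b))
            (((X.1 * d b.1 : ℝ), coordVec (𝓡 (n - 1)) k (z := b.2) X.2),
              (X.1 * (c * W.f (x₁ b.1)) : ℝ)) w := by
      rintro _ rfl
      rw [coordChristoffel_prod (hGN.metric.warped W.isOpen_J W.smooth_f W.pos_f) hy,
        coordChristoffel_warped W.isOpen_J W.smooth_f W.pos_f hGN.metric hy,
        prodCoordMetric_apply, prodCoordMetric_apply, warpedCoordMetric_apply,
        warpedCoordMetric_apply, hpt b hb]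
      simp only [Prod.smul_fst, Prod.smul_snd, smul_zero, map_zero, zero_apply, mul_zero, add_zero,
        smul_eq_mul]
      ring
    rw [hvec b hb]
    exact key _ hdv

end Generated
end

noncomputable section

/-! ### Differential of the inclusion of an open subset. -/

section Opens

variable {n : ℕ} {M : Type u} [TopologicalSpace M]
  [ChartedSpace (EuclideanSpace ℝ (Fin n)) M] [IsManifold (𝓡 n) ∞ M]

/-- The preferred chart of `U` at `x` is by definition that of `M` composed with the inclusion, and
both charts have bijective differentials. -/
theorem mfderiv_subtype_val_bijective (U : TopologicalSpace.Opens M) (x : U) :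
    Function.Bijective (mfderiv (𝓡 n) (𝓡 n) (Subtype.val : U → M) x) := by
  let k := chartAt (EuclideanSpace ℝ (Fin n)) x.1
  let k' := chartAt (EuclideanSpace ℝ (Fin n)) x
  have hk' := isSmoothCoord_chartAt (n := n) x
  have hk := isSmoothCoord_chartAt (n := n) x.1
  have hval : MDifferentiableAt (𝓡 n) (𝓡 n) (Subtype.val : U → M) x :=
    (contMDiff_subtype_val (n := ∞) x).mdifferentiableAt (by simp)
  have hkd := hk.mdifferentiableAt (mem_chart_source _ x.1)
  have hmk : k.MDifferentiable (𝓡 n) (𝓡 n) :=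
    ⟨hk.smooth.mdifferentiableOn (by simp), hk.smooth_symm.mdifferentiableOn (by simp)⟩
  have hmk' : k'.MDifferentiable (𝓡 n) (𝓡 n) :=
    ⟨hk'.smooth.mdifferentiableOn (by simp), hk'.smooth_symm.mdifferentiableOn (by simp)⟩
  have h1 := mfderiv_comp x hkd hval
  have h2 : mfderiv (𝓡 n) (𝓡 n) k' x = mfderiv (𝓡 n) (𝓡 n) (k ∘ Subtype.val) x := rfl
  have h3 : ∀ X, mfderiv (𝓡 n) (𝓡 n) k' x X =
      mfderiv (𝓡 n) (𝓡 n) k x.1 (mfderiv (𝓡 n) (𝓡 n) (Subtype.val : U → M) x X) := fun X =>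
    DFunLike.congr_fun (h2.trans h1) X
  have hb' := hmk'.mfderiv_bijective (mem_chart_source _ x)
  have hb := hmk.mfderiv_bijective (mem_chart_source _ x.1)
  refine ⟨fun X Y hXY => hb'.1 ?_, fun Z => ?_⟩
  · rw [h3, h3, hXY]
  · obtain ⟨X, hX⟩ := hb'.2 (mfderiv (𝓡 n) (𝓡 n) k x.1 Z)
    exact ⟨X, hb.1 ((h3 X).symm.trans hX)⟩

end Opens

/-! ### Existence of oblique totally umbilical hypersurfaces. -/

section Existence

variable {n : ℕ} {M : Type u} [TopologicalSpace M]
  [ChartedSpace (EuclideanSpace ℝ (Fin n)) M] [IsManifold (𝓡 n) ∞ M] {g : SmoothMetric n M}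
  {p : M}

/-- Profile curves through a given point exist. -/
theorem exists_isProfileCurve {I J : Set ℝ} (hI : IsOpen I) (hJ : IsOpen J) {f : ℝ → ℝ}
    (hf : ContDiffOn ℝ ∞ f J) (hf0 : ∀ r ∈ J, 0 < f r) {t r : ℝ} (ht : t ∈ I) (hr : r ∈ J) :
    ∃ (c : ℝ) (A : Set ℝ) (x₀ x₁ : ℝ → ℝ) (ξ : OpenPartialHomeomorph ℝ ℝ),
      IsProfileCurve I J f c 1 A x₀ x₁ ∧ 0 ∈ A ∧ x₀ 0 = t ∧ x₁ 0 = r ∧ ξ.source = A ∧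
      (∀ s, ξ s = x₁ s) ∧ ContDiffOn ℝ ∞ ξ ξ.source ∧ ContDiffOn ℝ ∞ ξ.symm ξ.target := by
  have hfr := hf0 r hr
  obtain ⟨c, hc0, hc⟩ : ∃ c : ℝ, c ≠ 0 ∧ c ^ 2 * f r ^ 2 < 1 := by
    -- Any small nonzero constant would do; this one makes `c² f(r)² = 1/4`.
    refine ⟨(2 * f r)⁻¹, inv_ne_zero (by positivity), ?_⟩
    have : (2 * f r)⁻¹ ^ 2 * f r ^ 2 = 1 / 4 := by field_simp; norm_num
    rw [this]; norm_num
  let Ω : Set ℝ := J ∩ (fun r => c ^ 2 * f r ^ 2) ⁻¹' Iio 1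
  have hΩ : IsOpen Ω := (continuousOn_const.mul (hf.continuousOn.pow 2)).isOpen_inter_preimage hJ
    isOpen_Iio
  have hfΩ : ContDiffOn ℝ ∞ f Ω := hf.mono inter_subset_left
  have h1 : ContDiffOn ℝ ∞ (fun r => √(1 - c ^ 2 * f r ^ 2)) Ω :=
    (contDiffOn_const.sub (contDiffOn_const.mul (hfΩ.pow 2))).sqrt fun r hr =>
      (sub_pos.2 hr.2).ne'
  -- Both profile equations form one autonomous planar system on `I × Ω`. Its flow stays in this
  -- set, which yields the range conditions and `c² f² < 1` at once.
  let T : ℝ × ℝ → ℝ × ℝ := fun z => (c * f z.2, √(1 - c ^ 2 * f z.2 ^ 2))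
  have hT : ContDiffOn ℝ ∞ T (I ×ˢ Ω) :=
    (contDiffOn_const.mul (hfΩ.comp contDiff_snd.contDiffOn fun z hz => hz.2)).prodMk
      (h1.comp contDiff_snd.contDiffOn fun z hz => hz.2)
  obtain ⟨ε, hε, Φ, hΦ, hΦy⟩ := exists_smooth_flow (hI.prod hΩ) hT (y₀ := (t, r)) ⟨ht, hr, hc⟩
  obtain ⟨hΦ0, hΦs⟩ := hΦy (t, r) (Metric.mem_ball_self hε)
  have hcurve : ContDiffOn ℝ ∞ (fun s => Φ (s, (t, r))) (Ioo (-ε) ε) :=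
    hΦ.comp (contDiff_prodMk_left _).contDiffOn fun s hs => ⟨hs, Metric.mem_ball_self hε⟩
  let x₀ : ℝ → ℝ := fun s => (Φ (s, (t, r))).1
  let x₁ : ℝ → ℝ := fun s => (Φ (s, (t, r))).2
  have hd₀ : ∀ s ∈ Ioo (-ε) ε, HasDerivAt x₀ (c * f (x₁ s)) s := fun s hs =>
    HasFDerivAt.comp_hasDerivAt (l := Prod.fst) (l' := ContinuousLinearMap.fst ℝ ℝ ℝ) s
      hasFDerivAt_fst (hΦs s hs).2
  have hd₁ : ∀ s ∈ Ioo (-ε) ε, HasDerivAt x₁ (√(1 - c ^ 2 * f (x₁ s) ^ 2)) s := fun s hs =>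
    HasFDerivAt.comp_hasDerivAt (l := Prod.snd) (l' := ContinuousLinearMap.snd ℝ ℝ ℝ) s
      hasFDerivAt_snd (hΦs s hs).2
  have hlt : ∀ s ∈ Ioo (-ε) ε, c ^ 2 * f (x₁ s) ^ 2 < 1 := fun s hs => (hΦs s hs).1.2.2
  have h0ε : (0 : ℝ) ∈ Ioo (-ε) ε := ⟨by linarith, hε⟩
  obtain ⟨δ, hδ, hδε, ξ, hξsrc, hξx, hξ, hξs⟩ := exists_smooth_interval_homeomorph isOpen_Ioo
    (contDiff_snd.comp_contDiffOn hcurve) h0ε (hd₁ 0 h0ε)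
    (Real.sqrt_pos.2 (sub_pos.2 (hlt 0 h0ε))).ne'
  refine ⟨c, Ioo (0 - δ) (0 + δ), x₀, x₁, ξ, ⟨hc0, Or.inl rfl, isOpen_Ioo, ordConnected_Ioo,
    fun s hs => (hΦs s (hδε hs)).1.1, fun s hs => (hΦs s (hδε hs)).1.2.1,
    fun s hs => hlt s (hδε hs), fun s hs => hd₀ s (hδε hs), fun s hs => ?_⟩,
    ⟨by linarith, by linarith⟩, congrArg Prod.fst hΦ0, congrArg Prod.snd hΦ0, hξsrc, hξx, hξ, hξs⟩
  rw [one_mul]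
  exact hd₁ s (hδε hs)

/-- A warped product structure near `p` gives an oblique totally umbilical hypersurface through
every point over `p`. -/
theorem WarpedProductNear.exists_hypersurface [T2Space M] [SecondCountableTopology M]
    (W : WarpedProductNear.{u, w} g p) {I : Set ℝ} (hI : IsOpen I) {t : ℝ} (ht : t ∈ I) :
    ∃ (F : Hypersurface.{u, u} n M I) (q : F.carrier),
      F.IsTotallyUmbilical g ∧ F.IsObliqueAt g q p t := by
  let IN := 𝓘(ℝ, ℝ).prod (𝓡 (n - 1))
  let z₀ : ℝ × W.N := W.Ψ.symm p
  have hz₀ : z₀ ∈ W.Ψ.source := W.Ψ.map_target W.mem_target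
  have hΨz₀ : W.Ψ z₀ = p := W.Ψ.right_inv W.mem_target
  have hz₀J : z₀.1 ∈ W.J := by rw [W.source_eq] at hz₀; exact hz₀.1
  obtain ⟨c, A, x₀, x₁, ξ, h, hA0, hx₀, hx₁, hξsrc, hξx, hξ, hξs⟩ :=
    exists_isProfileCurve hI W.isOpen_J W.smooth_f W.pos_f ht hz₀J
  let ζ : OpenPartialHomeomorph (ℝ × W.N) (ℝ × W.N) := ξ.prod (OpenPartialHomeomorph.refl W.N)
  have hζz : ∀ z, ζ z = (x₁ z.1, z.2) := fun z => Prod.ext (hξx z.1) rfl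
  let θ : OpenPartialHomeomorph (ℝ × W.N) M := ζ.trans W.Ψ
  have hθz : ∀ z, θ z = W.Ψ (x₁ z.1, z.2) := fun z => congrArg W.Ψ (hζz z)
  have hθ : ContMDiffOn IN (𝓡 n) ∞ θ θ.source := by
    have h1 : ContMDiffOn IN IN ∞ ζ (ξ.source ×ˢ univ) :=
      (hξ.contMDiffOn.comp contMDiff_fst.contMDiffOn fun z hz => hz.1).prodMk
        contMDiff_snd.contMDiffOn
    refine W.smooth.comp (h1.mono ?_) ?_
    · exact fun z hz => hz.1
    · exact fun z hz => hz.2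
  have hθs : ContMDiffOn (𝓡 n) IN ∞ θ.symm θ.target := by
    have h1 : ContMDiffOn IN IN ∞ ζ.symm (ξ.target ×ˢ univ) :=
      (hξs.contMDiffOn.comp contMDiff_fst.contMDiffOn fun z hz => hz.1).prodMk
        contMDiff_snd.contMDiffOn
    refine h1.comp (W.smooth_symm.mono ?_) ?_
    · exact fun z hz => hz.1
    · exact fun z hz => hz.2
  have hθA : ∀ z ∈ θ.source, z.1 ∈ A := fun z hz => by
    have : z.1 ∈ ξ.source := hz.1.1
    rwa [hξsrc] at this
  have h0θ : (0, z₀.2) ∈ θ.source := by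
    refine ⟨⟨by rw [hξsrc]; exact hA0, mem_univ _⟩, ?_⟩
    change ζ (0, z₀.2) ∈ W.Ψ.source
    rw [hζz, hx₁]
    exact hz₀
  have hθ0 : θ (0, z₀.2) = p := by
    rw [hθz]
    simp only [hx₁]
    exact hΨz₀
  -- The generated hypersurface is a graph over an open subset of `M`, which is taken as its
  -- carrier: it is modelled on `ℝⁿ` and lies in the universe of `M`, whatever the universe of the
  -- fibre.
  let U : TopologicalSpace.Opens M := ⟨θ.target, θ.open_target⟩
  let χ : U → ℝ × W.N := fun x => θ.symm x.1
  have hχ : ContMDiff (𝓡 n) IN ∞ χ := by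
    intro x
    exact (hθs.contMDiffAt (θ.open_target.mem_nhds x.2)).comp x (contMDiff_subtype_val x)
  have hχA : ∀ x, χ x ∈ A ×ˢ univ := fun x => ⟨hθA _ (θ.map_target x.2), mem_univ _⟩
  have hmθ : θ.MDifferentiable IN (𝓡 n) :=
    ⟨hθ.mdifferentiableOn (by simp), hθs.mdifferentiableOn (by simp)⟩
  have hχb : ∀ x, Function.Bijective (mfderiv (𝓡 n) IN χ x) := by
    intro x
    have h1 := mfderiv_comp x (hmθ.symm.mdifferentiableAt (x := x.1) x.2)
      ((contMDiff_subtype_val (n := ∞) x).mdifferentiableAt (by simp))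
    have h2 := (hmθ.symm.mfderiv_bijective (x := x.1) x.2).comp (mfderiv_subtype_val_bijective U x)
    have h3 : ⇑(mfderiv (𝓡 n) IN χ x) = ⇑(mfderiv (𝓡 n) IN θ.symm x.1) ∘
      ⇑(mfderiv (𝓡 n) (𝓡 n) (Subtype.val : U → M) x) := congrArg DFunLike.coe h1
    rw [h3]
    exact h2
  have himm := W.isSmoothImmersionOn_generated h
  have hAo : IsOpen (A ×ˢ (univ : Set W.N)) := h.isOpen.prod isOpen_univ
  have hcomp : ∀ x, ∀ X : TangentSpace (𝓡 n) x,
      mfderiv (𝓡 n) ((𝓡 n).prod 𝓘(ℝ, ℝ)) (W.generated x₀ x₁ ∘ χ) x X =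
      mfderiv IN ((𝓡 n).prod 𝓘(ℝ, ℝ)) (W.generated x₀ x₁) (χ x) (mfderiv (𝓡 n) IN χ x X) := by
    intro x X
    exact DFunLike.congr_fun (mfderiv_comp x ((himm.1.contMDiffAt
      (hAo.mem_nhds (hχA x))).mdifferentiableAt (by simp))
      ((hχ x).mdifferentiableAt (by simp))) X
  let F : Hypersurface.{u, u} n M I :=
    { carrier := U
      map := W.generated x₀ x₁ ∘ χ
      mem := fun x => h.mapsTo₀ (hχA x).1
      immersion := by
        refine ⟨himm.1.comp hχ.contMDiffOn fun x _ => hχA x, fun x _ X Y hXY => ?_⟩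
        rw [hcomp, hcomp] at hXY
        exact (hχb x).1 (himm.2 _ (hχA x) hXY) }
  let q : U := ⟨p, mem_of_eq_of_mem hθ0.symm (θ.map_source h0θ)⟩
  have hχq : χ q = (0, z₀.2) := (congrArg θ.symm hθ0).symm.trans (θ.left_inv h0θ)
  refine ⟨F, q, (W.isTotallyUmbilicalOn_generated h).comp isOpen_univ hχ.contMDiffOn
    fun x _ => hχA x, ?_, ?_, ?_⟩
  · change W.generated x₀ x₁ (χ q) = (p, t)
    rw [hχq]
    refine Prod.ext ?_ hx₀
    exact (hθz _).symm.trans hθ0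
  · rintro ⟨X, hX⟩
    refine W.not_isVerticalAt_generated h (hχA q).1 ⟨mfderiv (𝓡 n) IN χ q X, ?_⟩
    exact (hcomp q X).symm.trans hX
  · intro hX
    refine W.not_isHorizontalAt_generated h (hχA q).1 fun Z => ?_
    obtain ⟨X, rfl⟩ := (hχb q).2 Z
    rw [← hcomp q X]
    exact hX X

end Existence
end

noncomputable section

/-! ### Dimension two: rotation by a right angle. -/

section Plane

variable {G : EuclideanSpace ℝ (Fin 2) → EuclideanSpace ℝ (Fin 2) →L[ℝ]
  EuclideanSpace ℝ (Fin 2) →L[ℝ] ℝ} {V : Set (EuclideanSpace ℝ (Fin 2))}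

/-- In dimension two, a nonvanishing field has a unit orthogonal field. -/
theorem IsCoordMetric.exists_unit_orthogonal (hG : IsCoordMetric G V)
    {Z : EuclideanSpace ℝ (Fin 2) → EuclideanSpace ℝ (Fin 2)} (hZ : ContDiffOn ℝ ∞ Z V)
    (hZ0 : ∀ y ∈ V, Z y ≠ 0) :
    ∃ U : EuclideanSpace ℝ (Fin 2) → EuclideanSpace ℝ (Fin 2), ContDiffOn ℝ ∞ U V ∧
      ∀ y ∈ V, G y (U y) (U y) = 1 ∧ G y (Z y) (U y) = 0 ∧
        ∀ b, G y (Z y) b = 0 → G y (U y) b = 0 → b = 0 := by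
  let E := EuclideanSpace ℝ (Fin 2)
  let e : Fin 2 → E := fun i => EuclideanSpace.single i (1 : ℝ)
  have hcomb : ∀ r r' : ℝ, (r • e 0 + r' • e 1) 0 = r ∧ (r • e 0 + r' • e 1) 1 = r' := by
    intro r r'
    change (r • EuclideanSpace.single (0 : Fin 2) (1 : ℝ) +
      r' • EuclideanSpace.single (1 : Fin 2) (1 : ℝ)) 0 = r ∧
      (r • EuclideanSpace.single (0 : Fin 2) (1 : ℝ) +
      r' • EuclideanSpace.single (1 : Fin 2) (1 : ℝ)) 1 = r'
    simp
  have hdec : ∀ b : E, b = b 0 • e 0 + b 1 • e 1 := by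
    intro b
    ext i
    fin_cases i
    · exact (hcomb (b 0) (b 1)).1.symm
    · exact (hcomb (b 0) (b 1)).2.symm
  -- The coefficients of the covector `G(Z, ·)`, turned by a right angle, span its kernel; `R` is
  -- then normalized.
  let R : E → E := fun y => -(G y (Z y) (e 1)) • e 0 + G y (Z y) (e 0) • e 1
  have hZe (i : Fin 2) : ContDiffOn ℝ ∞ (fun y => G y (Z y) (e i)) V :=
    hG.contDiffOn_apply hZ contDiffOn_const
  have hR : ContDiffOn ℝ ∞ R V :=
    ((hZe 1).neg.smul contDiffOn_const).add ((hZe 0).smul contDiffOn_const)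
  have hGb : ∀ y (a b : E), G y a b = b 0 * G y a (e 0) + b 1 * G y a (e 1) := by
    intro y a b
    conv_lhs => rw [hdec b]
    simp only [map_add, map_smul, smul_eq_mul]
  have hZR : ∀ y, G y (Z y) (R y) = 0 := by
    intro y
    simp only [R, map_add, map_smul, smul_eq_mul]
    ring
  have hZZ : ∀ y ∈ V, 0 < G y (Z y) (e 0) ^ 2 + G y (Z y) (e 1) ^ 2 := by
    intro y hy
    by_contra hcon
    have h0 : G y (Z y) (e 0) = 0 := by nlinarith [sq_nonneg (G y (Z y) (e 0)), sq_nonneg (G y (Z y) (e 1))]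
    have h1 : G y (Z y) (e 1) = 0 := by nlinarith [sq_nonneg (G y (Z y) (e 0)), sq_nonneg (G y (Z y) (e 1))]
    have h2 := hG.pos y hy _ (hZ0 y hy)
    rw [hGb, h0, h1] at h2
    simp at h2
  have hpar : ∀ y (b : E), G y (Z y) b = 0 →
      (G y (Z y) (e 0) ^ 2 + G y (Z y) (e 1) ^ 2) • b =
        (G y (Z y) (e 0) * b 1 - G y (Z y) (e 1) * b 0) • R y := by
    intro y b hb
    rw [hGb] at hb
    conv_lhs => rw [hdec b]
    simp only [R, smul_add, smul_smul]
    congr 1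
    · congr 1
      linear_combination G y (Z y) (e 0) * hb
    · congr 1
      linear_combination G y (Z y) (e 1) * hb
  have hker : ∀ y ∈ V, ∀ b : E, G y (Z y) b = 0 → G y (R y) b = 0 → b = 0 := by
    intro y hy b h1 h2
    by_contra hb
    have h3 := congrArg (fun w => G y w b) (hpar y b h1)
    simp only [map_smul, smul_apply, h2, mul_zero, smul_eq_mul] at h3
    exact (mul_pos (hZZ y hy) (hG.pos y hy b hb)).ne' h3
  have hR0 : ∀ y ∈ V, R y ≠ 0 := by
    intro y hy h0
    have h1 := hcomb (-(G y (Z y) (e 1))) (G y (Z y) (e 0))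
    have h2 : -(G y (Z y) (e 1)) = 0 := h1.1.symm.trans (congrArg (fun w : E => w 0) h0)
    have h3 : G y (Z y) (e 0) = 0 := h1.2.symm.trans (congrArg (fun w : E => w 1) h0)
    have h5 := hZZ y hy
    rw [h3, neg_eq_zero.1 h2] at h5
    simp at h5
  have hRR := fun y (hy : y ∈ V) => hG.pos y hy _ (hR0 y hy)
  have hs : ∀ y ∈ V, 0 < √(G y (R y) (R y)) := fun y hy => Real.sqrt_pos.2 (hRR y hy)
  refine ⟨fun y => (√(G y (R y) (R y)))⁻¹ • R y,
    (((hG.contDiffOn_apply hR hR).sqrt fun y hy => (hRR y hy).ne').inv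
      fun y hy => (hs y hy).ne').smul hR, fun y hy => ⟨?_, ?_, fun b h1 h2 => ?_⟩⟩
  · simp only [map_smul, smul_apply, smul_eq_mul]
    have h := Real.mul_self_sqrt (hRR y hy).le
    have := (hs y hy).ne'
    field_simp
    rw [sq, h]
  · simp only [map_smul, hZR, smul_zero]
  · refine hker y hy b h1 ?_
    simp only [map_smul, smul_apply, smul_eq_mul] at h2
    exact (mul_eq_zero.1 h2).resolve_left (inv_ne_zero (hs y hy).ne')

theorem coordCovDeriv_add_right {E : Type*} [NormedAddCommGroup E] [NormedSpace ℝ E]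
    (G : E → E →L[ℝ] E →L[ℝ] ℝ) (Y : E → E) (y a b b' : E) (r r' : ℝ) :
    coordCovDeriv G Y y a (r • b + r' • b') =
      r * coordCovDeriv G Y y a b + r' * coordCovDeriv G Y y a b' := by
  simp only [coordCovDeriv, coordChristoffel, map_add, map_smul, add_apply, smul_apply,
    smul_eq_mul]
  ring

/-- In dimension two, rotating a Killing field gives a closed conformal field. -/
theorem exists_isUnitConformal_of_killing (hG : IsCoordMetric G V)
    {K : EuclideanSpace ℝ (Fin 2) → EuclideanSpace ℝ (Fin 2)} (hK : ContDiffOn ℝ ∞ K V)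
    (hK0 : ∀ y ∈ V, K y ≠ 0)
    (hkill : ∀ y ∈ V, ∀ a b, coordCovDeriv G K y a b + coordCovDeriv G K y b a = 0) :
    ∃ T ρ l, IsUnitConformal G V T ρ l := by
  obtain ⟨T, hT, hTall⟩ := hG.exists_unit_orthogonal hK hK0
  have hKK := fun y (hy : y ∈ V) => hG.pos y hy _ (hK0 y hy)
  have hKKs := hG.contDiffOn_apply hK hK
  let ρ : EuclideanSpace ℝ (Fin 2) → ℝ := fun y => √(G y (K y) (K y))
  have hρ : ContDiffOn ℝ ∞ ρ V := hKKs.sqrt fun y hy => (hKK y hy).ne'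
  have hρ0 : ∀ y ∈ V, 0 < ρ y := fun y hy => Real.sqrt_pos.2 (hKK y hy)
  have hρ2 : ∀ y ∈ V, G y (K y) (K y) = ρ y * ρ y := fun y hy =>
    (Real.mul_self_sqrt (hKK y hy).le).symm
  have hKd : ∀ y ∈ V, DifferentiableAt ℝ K y := fun y hy =>
    (hK.contDiffAt (hG.isOpen.mem_nhds hy)).differentiableAt (by simp)
  have hTd : ∀ y ∈ V, DifferentiableAt ℝ T y := fun y hy =>
    (hT.contDiffAt (hG.isOpen.mem_nhds hy)).differentiableAt (by simp)
  have hdec : ∀ y ∈ V, ∀ a, ∃ k : ℝ, a = G y (T y) a • T y + k • K y := by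
    intro y hy a
    obtain ⟨h1, h2, h3⟩ := hTall y hy
    refine ⟨G y (K y) a / G y (K y) (K y), ?_⟩
    have h4 := (hKK y hy).ne'
    refine sub_eq_zero.1 (h3 _ ?_ ?_)
    · simp only [map_sub, map_add, map_smul, h2, smul_eq_mul]
      field_simp
      ring
    · simp only [map_sub, map_add, map_smul, h1, hG.symm y hy (T y) (K y), h2, smul_eq_mul]
      ring
  have hdρ : ∀ y ∈ V, ∀ a, ρ y * fderiv ℝ ρ y a = coordCovDeriv G K y a (K y) := by
    intro y hy a
    have h1 := hG.hasFDerivAt_apply hy (hKd y hy) (hKd y hy) a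
    have h2 := (((hKKs.contDiffAt (hG.isOpen.mem_nhds hy)).differentiableAt
      (by simp)).hasFDerivAt.sqrt (hKK y hy).ne').fderiv
    have h3 : fderiv ℝ ρ y a = (1 / (2 * ρ y)) * (coordCovDeriv G K y a (K y) +
        coordCovDeriv G K y a (K y)) := by
      rw [← h1]
      exact DFunLike.congr_fun h2 a
    rw [h3]
    have := (hρ0 y hy).ne'
    field_simp
    ring
  have hTT : ∀ y ∈ V, ∀ a, coordCovDeriv G T y a (T y) = 0 := by
    intro y hy a
    have h1 := hG.hasFDerivAt_apply hy (hTd y hy) (hTd y hy) a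
    have h2 : (fun z => G z (T z) (T z)) =ᶠ[𝓝 y] fun _ => 1 := by
      filter_upwards [hG.isOpen.mem_nhds hy] with z hz using (hTall z hz).1
    rw [h2.fderiv_eq] at h1
    simp at h1
    linarith
  -- Differentiating `G(K, T) = 0` gives `G(∇_a T, K) = -G(∇_a K, T)`, and the Killing equation
  -- exchanges `a` and `T` with a change of sign.
  have hTK : ∀ y ∈ V, ∀ a, coordCovDeriv G T y a (K y) = coordCovDeriv G K y (T y) a := by
    intro y hy a
    have h1 := hG.hasFDerivAt_apply hy (hKd y hy) (hTd y hy) a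
    have h2 : (fun z => G z (K z) (T z)) =ᶠ[𝓝 y] fun _ => 0 := by
      filter_upwards [hG.isOpen.mem_nhds hy] with z hz using (hTall z hz).2.1
    rw [h2.fderiv_eq] at h1
    have h3 := hkill y hy a (T y)
    simp at h1
    linarith
  refine ⟨T, ρ, fun y => fderiv ℝ ρ y (T y), hT, hρ, hρ0, fun y hy => (hTall y hy).1,
    fun y hy a => ?_, fun y hy a b => ?_⟩
  · obtain ⟨k, hk⟩ := hdec y hy a
    -- The length of a Killing field is constant along its own orbits, so `dρ` only sees the
    -- `T`-component and the conformal factor must be `dρ(T)`.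
    have h1 : fderiv ℝ ρ y (K y) = 0 := by
      have h2 := hdρ y hy (K y)
      have h3 := hkill y hy (K y) (K y)
      have h4 : ρ y * fderiv ℝ ρ y (K y) = 0 := by linarith
      exact (mul_eq_zero.1 h4).resolve_left (hρ0 y hy).ne'
    conv_lhs => rw [hk]
    rw [map_add, map_smul, map_smul, h1, smul_eq_mul, smul_zero, add_zero, mul_comm]
  · obtain ⟨h1, h2, -⟩ := hTall y hy
    obtain ⟨j, hj⟩ := hdec y hy a
    obtain ⟨k, hk⟩ := hdec y hy b
    have h3 : coordCovDeriv G K y (T y) (T y) = 0 := by linarith [hkill y hy (T y) (T y)]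
    have h4 : coordCovDeriv G K y (T y) (K y) = ρ y * fderiv ℝ ρ y (T y) :=
      (hdρ y hy (T y)).symm
    have h5 : G y (T y) (K y) = 0 := by rw [hG.symm y hy]; exact h2
    -- In the frame `T, K` only the pair `(K, K)` survives: `T` has unit length, and `G(∇_T K, T) =
    -- 0` by skew symmetry.
    have hL : coordCovDeriv G T y a b = j * k * (ρ y * fderiv ℝ ρ y (T y)) := by
      conv_lhs => rw [hk]
      rw [coordCovDeriv_add_right, hTT y hy, hTK y hy]
      conv_lhs => rw [hj]
      rw [coordCovDeriv_add_right, h3, h4]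
      ring
    have hR : G y a b = G y (T y) a * G y (T y) b + j * k * (ρ y * ρ y) := by
      conv_lhs => rw [hj, hk]
      simp only [map_add, map_smul, add_apply, smul_apply, smul_eq_mul, h1, h2, h5, hρ2 y hy]
      ring
    rw [hL, hR]
    have := (hρ0 y hy).ne'
    field_simp
    ring

/-- In dimension two, a unit field has orthogonal trajectories. -/
theorem exists_orthogonal_curve (hG : IsCoordMetric G V)
    {T : EuclideanSpace ℝ (Fin 2) → EuclideanSpace ℝ (Fin 2)} (hT : ContDiffOn ℝ ∞ T V)
    (hT0 : ∀ y ∈ V, T y ≠ 0) {y₀ : EuclideanSpace ℝ (Fin 2)} (hy₀ : y₀ ∈ V) :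
    ∃ r > 0, ∃ ι ι' : ℝ → EuclideanSpace ℝ (Fin 2), ContDiffOn ℝ ∞ ι (Ioo (-r) r) ∧ ι 0 = y₀ ∧
      ∀ u ∈ Ioo (-r) r, ι u ∈ V ∧ HasDerivAt ι (ι' u) u ∧ G (ι u) (ι' u) (ι' u) = 1 ∧
        G (ι u) (T (ι u)) (ι' u) = 0 := by
  obtain ⟨U, hU, hUall⟩ := hG.exists_unit_orthogonal hT hT0
  obtain ⟨ε, hε, Φ, hΦ, hΦy⟩ := exists_smooth_flow hG.isOpen hU hy₀
  obtain ⟨hΦ0, hΦs⟩ := hΦy y₀ (Metric.mem_ball_self hε)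
  exact ⟨ε, hε, fun s => Φ (s, y₀), fun s => U (Φ (s, y₀)),
    hΦ.comp (contDiff_prodMk_left _).contDiffOn fun s hs => ⟨hs, Metric.mem_ball_self hε⟩, hΦ0,
    fun s hs => ⟨(hΦs s hs).1, (hΦs s hs).2, (hUall _ (hΦs s hs).1).1,
      (hUall _ (hΦs s hs).1).2.1⟩⟩

end Plane
end

noncomputable section

/-! ### Killing fields in coordinates. -/

section Killing

variable {E H P : Type*} [NormedAddCommGroup E] [NormedSpace ℝ E] [TopologicalSpace H]
  {IP : ModelWithCorners ℝ E H} [TopologicalSpace P] [ChartedSpace H P]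
  {E' E'' : Type*} [NormedAddCommGroup E'] [NormedSpace ℝ E'] [NormedAddCommGroup E'']
  [NormedSpace ℝ E'']

/-- The covariant derivative of a vector field, in coordinates. -/
theorem covDerivInner_id_eq [IP.Boundaryless] [IsManifold IP ∞ P] {γ : MetricField IP P}
    {e : OpenPartialHomeomorph P E'} {G : E' → E' →L[ℝ] E' →L[ℝ] ℝ} (h : IsMetricIn γ e G)
    {K : ∀ z : P, TangentSpace IP z} {W : Set P} (hW : IsOpen W)
    (hK : ContMDiffOn IP IP.tangent ∞ (fun z => (⟨z, K z⟩ : TangentBundle IP P)) W) {z : P}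
    (hz : z ∈ W) (hze : z ∈ e.source) (X Y : TangentSpace IP z) :
    covDerivInner IP γ (fun z' : P => z') K z X Y =
      coordCovDeriv G (fun y => coordVec IP e (K (e.symm y))) (e z) (coordVec IP e X)
        (coordVec IP e Y) := by
  rw [covDerivInner_eq (φ := fun z' : P => z') h hW hK hz hze]
  have hK' : ContMDiffOn IP 𝓘(ℝ, E') ∞ (fun z => coordVec IP e (K z)) (W ∩ e.source) :=
    ContMDiffOn.mfderiv_apply_section (φ := fun z' : P => z') (hK.mono inter_subset_left)
      e.open_source h.coord.smooth fun z hz => hz.2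
  have hKd : MDifferentiableAt IP 𝓘(ℝ, E') (fun z => coordVec IP e (K z)) (e.symm (e z)) := by
    rw [e.left_inv hze]
    exact (hK'.contMDiffAt ((hW.inter e.open_source).mem_nhds ⟨hz, hze⟩)).mdifferentiableAt
      (by simp)
  have h1 : MDifferentiableAt 𝓘(ℝ, E') 𝓘(ℝ, E') (fun y => coordVec IP e (K (e.symm y))) (e z) :=
    hKd.comp (e z) (h.coord.mdifferentiableAt_symm (e.map_source hze))
  have h2 := mfderiv_comp z h1 (h.coord.mdifferentiableAt hze)
  have h3 : (fun y => coordVec IP e (K (e.symm y))) ∘ e =ᶠ[𝓝 z] fun z => coordVec IP e (K z) := by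
    filter_upwards [e.open_source.mem_nhds hze] with w hw
    exact congrArg (fun w => coordVec IP e (K w)) (e.left_inv hw)
  have h4 : (mfderiv IP 𝓘(ℝ, E') (fun z => coordVec IP e (K z)) z X : E') =
      fderiv ℝ (fun y => coordVec IP e (K (e.symm y))) (e z) (coordVec IP e X) := by
    rw [← mfderiv_eq_fderiv]
    exact DFunLike.congr_fun (h3.mfderiv_eq.symm.trans h2) X
  have h5 : coordVec IP e (K (e.symm (e z))) = coordVec IP e (K z) :=
    congrArg (fun w => coordVec IP e (K w)) (e.left_inv hze)
  have h6 : mfderiv IP IP (fun z' : P => z') z X = X :=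
    DFunLike.congr_fun (mfderiv_id (I := IP) (x := z)) X
  rw [coordCovDeriv, h5]
  refine congrArg₂ (· + ·) (congrArg (fun w : E' => G (e z) w (coordVec IP e Y)) h4) ?_
  exact congrArg (fun w : TangentSpace IP z => coordChristoffel G (e z) (coordVec IP e w)
    (coordVec IP e (K z)) (coordVec IP e Y)) h6

theorem IsKillingOn.coord [IP.Boundaryless] [IsManifold IP ∞ P] {γ : MetricField IP P}
    {e : OpenPartialHomeomorph P E'} {G : E' → E' →L[ℝ] E' →L[ℝ] ℝ} (h : IsMetricIn γ e G)
    {K : ∀ z : P, TangentSpace IP z} {W : Set P} (hW : IsOpen W) (hK : IsKillingOn γ K W) {V : Set E'}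
    (hVe : V ⊆ e.target) (hVW : MapsTo e.symm V W) :
    ContDiffOn ℝ ∞ (fun y => coordVec IP e (K (e.symm y))) V ∧
    ∀ y ∈ V, ∀ a b, coordCovDeriv G (fun y => coordVec IP e (K (e.symm y))) y a b +
      coordCovDeriv G (fun y => coordVec IP e (K (e.symm y))) y b a = 0 := by
  have hK' : ContMDiffOn IP 𝓘(ℝ, E') ∞ (fun z => coordVec IP e (K z)) (W ∩ e.source) :=
    ContMDiffOn.mfderiv_apply_section (φ := fun z' : P => z') (hK.smooth.mono inter_subset_left)
      e.open_source h.coord.smooth fun z hz => hz.2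
  refine ⟨contMDiffOn_iff_contDiffOn.1 (hK'.comp (h.coord.smooth_symm.mono hVe) fun y hy =>
    ⟨hVW hy, e.map_target (hVe hy)⟩), fun y hy a b => ?_⟩
  obtain ⟨z, hz, rfl⟩ : ∃ z ∈ e.source, e z = y :=
    ⟨e.symm y, e.map_target (hVe hy), e.right_inv (hVe hy)⟩
  have hzW : z ∈ W := by have := hVW hy; rwa [e.left_inv hz] at this
  obtain ⟨X, rfl⟩ := h.coord.coordVec_surjective hz a
  obtain ⟨Y, rfl⟩ := h.coord.coordVec_surjective hz b
  rw [← covDerivInner_id_eq h hW hK.smooth hzW hz, ← covDerivInner_id_eq h hW hK.smooth hzW hz]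
  exact hK.killing z hzW X Y

/-- A coordinate field along which the metric is constant is a Killing field. -/
theorem isKillingOn_of_coord [IP.Boundaryless] [IsManifold IP ∞ P] {γ : MetricField IP P}
    {e : OpenPartialHomeomorph P E'} {G : E' → E' →L[ℝ] E' →L[ℝ] ℝ} (h : IsMetricIn γ e G) (k : E')
    (hk : ∀ y ∈ e.target, fderiv ℝ G y k = 0) :
    IsKillingOn γ (fun z => (mfderiv 𝓘(ℝ, E') IP e.symm (e z) k : E)) e.source ∧
      ∀ z ∈ e.source, coordVec IP e (z := z) (mfderiv 𝓘(ℝ, E') IP e.symm (e z) k : E) = k := by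
  have hs : ContMDiffOn IP IP.tangent ∞
      (fun z => (⟨z, mfderiv 𝓘(ℝ, E') IP e.symm (e z) k⟩ : TangentBundle IP P)) e.source :=
    contMDiffOn_section_of_coord (φ := fun z : P => z) contMDiffOn_id h.coord (fun z hz => hz)
      contMDiffOn_const
  have hvec : ∀ z ∈ e.source,
      coordVec IP e (z := z) (mfderiv 𝓘(ℝ, E') IP e.symm (e z) k : E) = k := fun z hz =>
    h.coord.coordVec_symm_self hz k
  refine ⟨⟨hs, fun z hz X Y => ?_⟩, hvec⟩
  rw [covDerivInner_id_eq h e.open_source hs hz hz, covDerivInner_id_eq h e.open_source hs hz hz]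
  let K' : E' → E' := fun y => coordVec IP e (z := e.symm y)
    (mfderiv 𝓘(ℝ, E') IP e.symm (e (e.symm y)) k : E)
  have hK' : K' =ᶠ[𝓝 (e z)] fun _ => k := by
    filter_upwards [e.open_target.mem_nhds (e.map_source hz)] with y hy
    exact hvec _ (e.map_target hy)
  have hzt := e.map_source hz
  change coordCovDeriv G K' (e z) (coordVec IP e X) (coordVec IP e Y) +
    coordCovDeriv G K' (e z) (coordVec IP e Y) (coordVec IP e X) = 0
  rw [coordCovDeriv, coordCovDeriv, hK'.fderiv_eq, hK'.self_of_nhds,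
    h.metric.christoffel_symm hzt, h.metric.christoffel_symm hzt (coordVec IP e Y)]
  -- For a field with constant components `k` the symmetrized covariant derivative is the derivative
  -- of the metric in direction `k`.
  have h1 := h.metric.christoffel_add hzt k (coordVec IP e X) (coordVec IP e Y)
  rw [hk _ hzt] at h1
  simpa using h1

theorem IsMetricIn.trans_symm {γ : MetricField IP P} {κ : OpenPartialHomeomorph P E'}
    {G : E' → E' →L[ℝ] E' →L[ℝ] ℝ} (h : IsMetricIn γ κ G) {e : OpenPartialHomeomorph E'' E'}
    (he : ContDiffOn ℝ ∞ e e.source) (hes : ContDiffOn ℝ ∞ e.symm e.target)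
    {G' : E'' → E'' →L[ℝ] E'' →L[ℝ] ℝ} (hG' : IsCoordMetric G' e.source)
    (hmet : ∀ y ∈ e.source, ∀ a b, G (e y) (fderiv ℝ e y a) (fderiv ℝ e y b) = G' y a b) :
    IsMetricIn γ (κ.trans e.symm) G' := by
  have hcoord : IsSmoothCoord IP (κ.trans e.symm) := by
    constructor
    · exact hes.contMDiffOn.comp (h.coord.smooth.mono inter_subset_left) fun z hz => hz.2
    · refine h.coord.smooth_symm.comp (he.contMDiffOn.mono ?_) ?_
      · exact fun y hy => hy.1
      · exact fun y hy => hy.2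
  refine ⟨hcoord, hG'.mono (κ.trans e.symm).open_target fun y hy => hy.1, fun z hz X Y => ?_⟩
  have hzκ : z ∈ κ.source := hz.1
  have hze : κ z ∈ e.target := hz.2
  have hy : (κ.trans e.symm) z ∈ e.source := e.map_target hze
  have hd : HasFDerivAt e (fderiv ℝ e ((κ.trans e.symm) z)) ((κ.trans e.symm) z) :=
    ((he.contDiffAt (e.open_source.mem_nhds hy)).differentiableAt (by simp)).hasFDerivAt
  have hvec : ∀ X : TangentSpace IP z, fderiv ℝ e ((κ.trans e.symm) z)
      (coordVec IP (κ.trans e.symm) X) = coordVec IP κ X := by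
    intro X
    have h1 := hd.hasMFDerivAt.comp z (hcoord.mdifferentiableAt hz).hasMFDerivAt
    have h2 : e ∘ (κ.trans e.symm) =ᶠ[𝓝 z] κ := by
      filter_upwards [(κ.trans e.symm).open_source.mem_nhds hz] with w hw
      exact e.right_inv hw.2
    exact DFunLike.congr_fun (h1.mfderiv.symm.trans h2.mfderiv_eq) X
  rw [← hmet _ hy, hvec, hvec, h.eq z hzκ]
  have h3 : e ((κ.trans e.symm) z) = κ z := e.right_inv hze
  rw [h3]

end Killing

/-! ### Coordinates of a surface of revolution. -/

section Revolution

variable {G : EuclideanSpace ℝ (Fin 2) → EuclideanSpace ℝ (Fin 2) →L[ℝ]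
  EuclideanSpace ℝ (Fin 2) →L[ℝ] ℝ} {V : Set (EuclideanSpace ℝ (Fin 2))}

theorem isCoordMetric_mul {U : Set ℝ} (hU : IsOpen U) :
    IsCoordMetric (fun _ : ℝ => ContinuousLinearMap.mul ℝ ℝ) U :=
  ⟨hU, contDiffOn_const, fun _ _ a b => mul_comm a b, fun _ _ _ ha => mul_self_pos.2 ha⟩

/-- The coefficients of `dx² + f(x)² du²` do not involve `u`; this is what makes `∂_u` a Killing
field. -/
theorem fderiv_warpedCoordMetric_mul {f : ℝ → ℝ} {y : ℝ × ℝ}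
    (hd : DifferentiableAt ℝ (warpedCoordMetric f fun _ : ℝ => ContinuousLinearMap.mul ℝ ℝ) y) :
    fderiv ℝ (warpedCoordMetric f fun _ : ℝ => ContinuousLinearMap.mul ℝ ℝ) y (0, 1) = 0 := by
  have h1 : HasDerivAt (fun s : ℝ => (y.1, y.2 + s)) ((0 : ℝ), (1 : ℝ)) 0 :=
    (hasDerivAt_const (0 : ℝ) y.1).prodMk ((hasDerivAt_id (0 : ℝ)).const_add y.2)
  have hd' : HasFDerivAt (warpedCoordMetric f fun _ : ℝ => ContinuousLinearMap.mul ℝ ℝ)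
      (fderiv ℝ (warpedCoordMetric f fun _ : ℝ => ContinuousLinearMap.mul ℝ ℝ) y)
      (y.1, y.2 + 0) := by
    rw [add_zero]; exact hd.hasFDerivAt
  have h2 := HasFDerivAt.comp_hasDerivAt
    (l := warpedCoordMetric f fun _ : ℝ => ContinuousLinearMap.mul ℝ ℝ) 0 hd' h1
  exact h2.unique (hasDerivAt_const (0 : ℝ)
    (warpedCoordMetric f (fun _ : ℝ => ContinuousLinearMap.mul ℝ ℝ) y))

variable {T : EuclideanSpace ℝ (Fin 2) → EuclideanSpace ℝ (Fin 2)}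
  {ρ l : EuclideanSpace ℝ (Fin 2) → ℝ}

theorem IsUnitConformal.ne_zero (h : IsUnitConformal G V T ρ l) {y : EuclideanSpace ℝ (Fin 2)}
    (hy : y ∈ V) : T y ≠ 0 := by
  intro h0
  have := h.unit y hy
  rw [h0] at this
  simp at this

/-- In dimension two, a closed conformal field gives coordinates as on a surface of revolution. -/
theorem IsUnitConformal.exists_revolution_coordinates (hG : IsCoordMetric G V)
    (h : IsUnitConformal G V T ρ l) {y₀ : EuclideanSpace ℝ (Fin 2)} (hy₀ : y₀ ∈ V) :
    ∃ δ > 0, ∃ (e : OpenPartialHomeomorph (ℝ × ℝ) (EuclideanSpace ℝ (Fin 2))) (f : ℝ → ℝ),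
      e.source = Ioo (-δ) δ ×ˢ Ioo (-δ) δ ∧ e.target ⊆ V ∧ ContDiffOn ℝ ∞ e e.source ∧
      ContDiffOn ℝ ∞ e.symm e.target ∧ e (0, 0) = y₀ ∧
      (∀ z ∈ e.source, fderiv ℝ e z (1, 0) = T (e z)) ∧
      IsCoordMetric (warpedCoordMetric f fun _ : ℝ => ContinuousLinearMap.mul ℝ ℝ) e.source ∧
      ∀ z ∈ e.source, ∀ a b, G (e z) (fderiv ℝ e z a) (fderiv ℝ e z b) =
        warpedCoordMetric f (fun _ : ℝ => ContinuousLinearMap.mul ℝ ℝ) z a b := by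
  obtain ⟨r, hr, ι, ι', hι, hι0, hιall⟩ := exists_orthogonal_curve hG h.smooth_T
    (fun y hy => h.ne_zero hy) hy₀
  have hball : ∀ s : ℝ, Metric.ball (0 : ℝ) s = Ioo (-s) s := fun s => by
    rw [Real.ball_eq_Ioo, zero_sub, zero_add]
  have hd : ∀ u ∈ Ioo (-r) r, ∀ a, fderiv ℝ ι u a = a • ι' u := fun u hu a => by
    rw [(hιall u hu).2.1.hasFDerivAt.fderiv]
    rfl
  have h0 : (0 : ℝ) ∈ Ioo (-r) r := ⟨by linarith, hr⟩
  obtain ⟨δ, hδ, hδr, e, hsrc, htgt, he, hes, he0, heT, hall⟩ :=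
    exists_warped_coordinates (F := ℝ) (ι := ι) hG h (by simp) hr (by rwa [hball])
      (by rw [hι0]; exact hy₀) (fun u hu huV a => by
        rw [hball] at hu
        rw [hd u hu, map_smul, (hιall u hu).2.2.2, smul_zero]) (fun a ha => by
        rw [hd 0 h0] at ha
        refine (smul_eq_zero.1 ha).resolve_right fun h1 => ?_
        have h2 := (hιall 0 h0).2.2.1
        rw [h1] at h2
        simp at h2)
  rw [hball] at hsrc
  simp only [hball] at he0 hall
  have h0δ : (0 : ℝ) ∈ Ioo (-δ) δ := ⟨by linarith, hδ⟩
  -- The orthogonal curve has unit speed. Dividing `ρ` by its value on that curve makes the fibre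
  -- metric exactly `du²`.
  let f : ℝ → ℝ := fun s => ρ (e (s, 0)) * (ρ (ι 0))⁻¹
  have hs0 : ∀ s ∈ Ioo (-δ) δ, (s, (0 : ℝ)) ∈ e.source := fun s hs => by
    rw [hsrc]; exact ⟨hs, h0δ⟩
  have hρι : 0 < ρ (ι 0) := h.pos _ (by rw [hι0]; exact hy₀)
  have hf : ContDiffOn ℝ ∞ f (Ioo (-δ) δ) := (h.smooth_ρ.comp
    (he.comp (contDiff_prodMk_left _).contDiffOn hs0)
    fun s hs => htgt (e.map_source (hs0 s hs))).mul contDiffOn_const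
  have hf0 : ∀ s ∈ Ioo (-δ) δ, 0 < f s := fun s hs =>
    mul_pos (h.pos _ (htgt (e.map_source (hs0 s hs)))) (inv_pos.2 hρι)
  refine ⟨δ, hδ, e, f, hsrc, htgt, he, hes, by rw [he0 0 h0δ, hι0], heT, ?_, fun z hz a b => ?_⟩
  · rw [hsrc]
    exact (isCoordMetric_mul isOpen_Ioo).warped isOpen_Ioo hf hf0
  · rw [hsrc] at hz
    have hzr : z.2 ∈ Ioo (-r) r := ⟨by linarith [hz.2.1], by linarith [hz.2.2]⟩
    refine ((hall z.1 hz.1 z.2 hz.2).2 a b).trans ?_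
    rw [warpedCoordMetric_apply, hd _ hzr, hd _ hzr]
    simp only [map_smul, smul_apply, (hιall _ hzr).2.2.1, f]
    change _ = a.1 * b.1 + (ρ (e (z.1, 0)) * (ρ (ι 0))⁻¹) ^ 2 * (a.2 * b.2)
    simp only [smul_eq_mul]
    ring

/-- In dimension two, a closed conformal field gives a warped product structure. -/
theorem IsUnitConformal.nonempty_warpedProductNear {M : Type u} [TopologicalSpace M]
    [ChartedSpace (EuclideanSpace ℝ (Fin 2)) M] [IsManifold (𝓡 2) ∞ M] {g : SmoothMetric 2 M}
    {p : M} {κ : OpenPartialHomeomorph M (EuclideanSpace ℝ (Fin 2))}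
    (hκ : IsMetricIn (metricField g) κ G) (hpκ : p ∈ κ.source) (hVκ : V ⊆ κ.target)
    (hG : IsCoordMetric G V) (h : IsUnitConformal G V T ρ l) (hpV : κ p ∈ V) :
    Nonempty (WarpedProductNear.{u, 0} g p) := by
  obtain ⟨r, hr, ι, ι', hι, hι0, hιall⟩ := exists_orthogonal_curve hG h.smooth_T
    (fun y hy => h.ne_zero hy) hpV
  have h0 : (0 : ℝ) ∈ Ioo (-r) r := ⟨by linarith, hr⟩
  -- The fibre has to be modelled on the one-dimensional Euclidean space, so the orthogonal curve is
  -- precomposed with the coordinate function.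
  let π : EuclideanSpace ℝ (Fin (2 - 1)) →L[ℝ] ℝ := EuclideanSpace.proj (0 : Fin 1)
  have hπ : ∀ u ∈ Metric.ball (0 : EuclideanSpace ℝ (Fin (2 - 1))) r, π u ∈ Ioo (-r) r := by
    intro u hu
    have h1 : ‖u‖ < r := by simpa using hu
    have h2 : ‖π u‖ ≤ ‖u‖ := PiLp.norm_apply_le u (0 : Fin 1)
    exact abs_lt.1 (h2.trans_lt h1)
  have hd : ∀ u ∈ Metric.ball (0 : EuclideanSpace ℝ (Fin (2 - 1))) r, ∀ a,
      fderiv ℝ (ι ∘ π) u a = π a • ι' (π u) := fun u hu a => by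
    rw [((hιall _ (hπ u hu)).2.1.hasFDerivAt.comp u π.hasFDerivAt).fderiv]
    rfl
  obtain ⟨δ, hδ, e, G₀, hsrc, htgt, he, hes, he00, hG₀, heall⟩ :=
    exists_warped_coordinates_univ (k := 2 - 1) (ι := ι ∘ π) hG h (by simp) hr
      (hι.comp π.contDiff.contDiffOn hπ)
      (by simp only [Function.comp_apply, map_zero, hι0]; exact hpV) (fun u hu huV a => by
        rw [hd u hu, map_smul]
        simp only [Function.comp_apply, (hιall _ (hπ u hu)).2.2.2, smul_zero]) (fun a ha => by
        rw [hd 0 (Metric.mem_ball_self hr), map_zero] at ha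
        have h3 : π a = 0 := by
          refine (smul_eq_zero.1 ha).resolve_right fun h1 => ?_
          have h2 := (hιall 0 h0).2.2.1
          rw [h1] at h2
          simp at h2
        ext i
        fin_cases i
        exact h3)
  have hs0 : ∀ s ∈ Ioo (-δ) δ, ∀ u : EuclideanSpace ℝ (Fin (2 - 1)), (s, u) ∈ e.source :=
    fun s hs u => by rw [hsrc]; exact ⟨hs, mem_univ _⟩
  have heV : ∀ z ∈ e.source, e z ∈ V := fun z hz => htgt (e.map_source hz)
  refine ⟨WarpedProductNear.ofCoord hκ hpκ e (Ioo (-δ) δ) isOpen_Ioo ordConnected_Ioo hsrc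
    (htgt.trans hVκ) he hes ?_ (fun s => ρ (e (s, 0))) ?_ (fun s hs => h.pos _ (heV _ (hs0 s hs 0)))
    G₀ hG₀ fun z hz X Y => (heall z hz).2.2 X Y⟩
  · have h1 : e (0, 0) = κ p := by
      rw [he00]; simp only [Function.comp_apply, map_zero, hι0]
    rw [← h1]
    exact e.map_source (hs0 0 ⟨by linarith, hδ⟩ 0)
  · exact h.smooth_ρ.comp (he.comp (contDiff_prodMk_left _).contDiffOn fun s hs => hs0 s hs 0)
      fun s hs => heV _ (hs0 s hs 0)

end Revolution
end

noncomputable section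

/-! ### Killing fields and invariance of umbilical surfaces. -/

section Surface

variable {M : Type u} [TopologicalSpace M] [ChartedSpace (EuclideanSpace ℝ (Fin 2)) M]
  [IsManifold (𝓡 2) ∞ M] {g : SmoothMetric 2 M}

theorem IsKillingOn.nonempty_warpedProductNear {p : M} {W : Set M}
    {K : ∀ x : M, TangentSpace (𝓡 2) x} (hW : IsOpen W) (hp : p ∈ W)
    (hK : IsKillingOn (metricField g) K W) (hK0 : ∀ x ∈ W, K x ≠ 0) :
    Nonempty (WarpedProductNear.{u, 0} g p) := by
  let κ := chartAt (EuclideanSpace ℝ (Fin 2)) p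
  have hpκ : p ∈ κ.source := mem_chart_source _ p
  have hκ := isMetricIn_coordMetric g (isSmoothCoord_chartAt (n := 2) p)
  let V := κ.target ∩ κ.symm ⁻¹' W
  have hV : IsOpen V := κ.symm.continuousOn.isOpen_inter_preimage κ.open_target hW
  have hVκ : V ⊆ κ.target := inter_subset_left
  obtain ⟨hKs, hKk⟩ := hK.coord hκ hW hVκ (fun y hy => hy.2)
  have hGV := hκ.metric.mono hV hVκ
  obtain ⟨T, ρ, l, h⟩ := exists_isUnitConformal_of_killing hGV hKs (fun y hy h0 => by
    refine hK0 _ hy.2 ?_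
    rw [← hκ.coord.symm_coordVec (κ.map_target hy.1) (K (κ.symm y))]
    exact (congrArg (mfderiv 𝓘(ℝ, EuclideanSpace ℝ (Fin 2)) (𝓡 2) κ.symm (κ (κ.symm y))) h0).trans
      (map_zero _)) hKk
  refine h.nonempty_warpedProductNear hκ hpκ hVκ hGV ⟨κ.map_source hpκ, ?_⟩
  rw [mem_preimage, κ.left_inv hpκ]
  exact hp

/-- The field is `∂_u` in the revolution coordinates of the closed conformal field of the surface;
its components `(0, 1)` show that it has no zeros. -/
theorem Hypersurface.exists_isKillingOn {I : Set ℝ} {p : M} {t : ℝ}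
    (F : Hypersurface.{u, v} 2 M I) (q : F.carrier) (humb : F.IsTotallyUmbilical g)
    (hobl : F.IsObliqueAt g q p t) :
    ∃ (W : Set M) (K : ∀ x : M, TangentSpace (𝓡 2) x), IsOpen W ∧ p ∈ W ∧
      IsKillingOn (metricField g) K W ∧ ∀ x ∈ W, K x ≠ 0 := by
  obtain ⟨κ, G, χ, V, T, ρ, l, c, hpκ, hG, hpV, hVχ, hVκ, hχ, hχs, hχq, hχκ, hGV, hconf, -⟩ :=
    F.exists_isUnitConformal q humb hobl
  obtain ⟨δ, hδ, e, f, hsrc, htgt, he, hes, he0, heT, hGr, hmet⟩ :=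
    hconf.exists_revolution_coordinates hGV hpV
  have hη := hG.trans_symm he hes hGr hmet
  obtain ⟨hkill, hvec⟩ := isKillingOn_of_coord hη ((0 : ℝ), (1 : ℝ)) fun y hy =>
    fderiv_warpedCoordMetric_mul (hη.metric.differentiableAt hy)
  refine ⟨_, _, (κ.trans e.symm).open_source, ⟨hpκ, ?_⟩, hkill, fun x hx h0 => ?_⟩
  · change κ p ∈ e.target
    rw [← he0]
    exact e.map_source (by rw [hsrc]; exact ⟨⟨by linarith, hδ⟩, ⟨by linarith, hδ⟩⟩)
  · have h1 := hvec x hx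
    have h2 : coordVec (𝓡 2) (κ.trans e.symm) (z := x) (0 : TangentSpace (𝓡 2) x) =
        (0 : ℝ × ℝ) := map_zero _
    have h3 : (0 : ℝ × ℝ) = (0, 1) := h2.symm.trans
      ((congrArg (fun w : TangentSpace (𝓡 2) x => coordVec (𝓡 2) (κ.trans e.symm) w) h0).symm.trans
        h1)
    simpa using congrArg Prod.snd h3

/-- The translation `(x, u) ↦ (x, u + s)` in the coordinates `η`. -/
def coordShift (η : OpenPartialHomeomorph M (ℝ × ℝ)) (s : ℝ) (z : M) : M :=
  η.symm ((η z).1, (η z).2 + s)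

/-- In coordinates as on a surface of revolution, rotations are isometries. -/
theorem isLocalIsometryGroup_coordShift {η : OpenPartialHomeomorph M (ℝ × ℝ)} {f : ℝ → ℝ}
    (hη : IsMetricIn (metricField g) η
      (warpedCoordMetric f fun _ : ℝ => ContinuousLinearMap.mul ℝ ℝ))
    {J : Set ℝ} {ε : ℝ} (hε : 0 < ε) (htgt : η.target = J ×ˢ Ioo (-(2 * ε)) (2 * ε))
    {I : Set ℝ} (hI : IsOpen I) :
    IsLocalIsometryGroup ((𝓡 2).prod 𝓘(ℝ, ℝ)) (prodMetric g) ε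
      ((η.source ∩ η ⁻¹' (univ ×ˢ Ioo (-ε) ε)) ×ˢ I) (fun s z => (coordShift η s z.1, z.2)) := by
  let W := η.source ∩ η ⁻¹' (univ ×ˢ Ioo (-ε) ε)
  have hW : IsOpen W := η.continuousOn.isOpen_inter_preimage η.open_source
    (isOpen_univ.prod isOpen_Ioo)
  -- Points of `W` have second coordinate of size less than `ε`, half the width of the chart, so
  -- translations by `|s| < ε` do not leave it.
  have hmem : ∀ s ∈ Ioo (-ε) ε, ∀ z ∈ W, ((η z).1, (η z).2 + s) ∈ η.target := by
    intro s hs z hz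
    have h1 := η.map_source hz.1
    have h2 := hz.2.2
    rw [htgt] at h1 ⊢
    exact ⟨h1.1, by linarith [h2.1, hs.1], by linarith [h2.2, hs.2]⟩
  have hval : ∀ s ∈ Ioo (-ε) ε, ∀ z ∈ W, η (coordShift η s z) = ((η z).1, (η z).2 + s) :=
    fun s hs z hz => η.right_inv (hmem s hs z hz)
  have hsh : ContDiff ℝ ∞ (fun a : (ℝ × ℝ) × ℝ => (a.1.1, a.1.2 + a.2)) := by fun_prop
  have hshs (s : ℝ) : ContDiff ℝ ∞ (fun a : ℝ × ℝ => (a.1, a.2 + s)) := by fun_prop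
  have hshift : ∀ s ∈ Ioo (-ε) ε, ContMDiffOn (𝓡 2) (𝓡 2) ∞ (coordShift η s) W := by
    intro s hs
    have h1 : ContMDiffOn (𝓡 2) 𝓘(ℝ, ℝ × ℝ) ∞ (fun z => ((η z).1, (η z).2 + s)) W :=
      (hshs s).contMDiff.comp_contMDiffOn (hη.coord.smooth.mono inter_subset_left)
    exact hη.coord.smooth_symm.comp h1 fun z hz => hmem s hs z hz
  refine ⟨hε, hW.prod hI, ?_, fun z hz => ?_, fun s hs s' hs' _ z hz _ => ?_,
    fun s hs z hz z' hz' h => ?_, fun s hs z hz X Y => ?_⟩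
  · have h1 : ContMDiffOn (𝓘(ℝ, ℝ).prod ((𝓡 2).prod 𝓘(ℝ, ℝ))) 𝓘(ℝ, (ℝ × ℝ) × ℝ) ∞
        (fun a : ℝ × (M × ℝ) => (η a.2.1, a.1)) (Ioo (-ε) ε ×ˢ (W ×ˢ I)) :=
      (hη.coord.smooth.comp (contMDiff_fst.comp contMDiff_snd).contMDiffOn
        fun a ha => ha.2.1.1).prodMk_space contMDiff_fst.contMDiffOn
    have h2 : ContMDiffOn (𝓘(ℝ, ℝ).prod ((𝓡 2).prod 𝓘(ℝ, ℝ))) 𝓘(ℝ, ℝ × ℝ) ∞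
        (fun a : ℝ × (M × ℝ) => ((η a.2.1).1, (η a.2.1).2 + a.1)) (Ioo (-ε) ε ×ˢ (W ×ˢ I)) :=
      hsh.contMDiff.comp_contMDiffOn h1
    exact (hη.coord.smooth_symm.comp h2 fun a ha => hmem _ ha.1 _ ha.2.1).prodMk
      (contMDiff_snd.comp contMDiff_snd).contMDiffOn
  · refine Prod.ext ?_ rfl
    change η.symm ((η z.1).1, (η z.1).2 + 0) = z.1
    rw [add_zero]
    exact η.left_inv hz.1.1
  · refine Prod.ext ?_ rfl
    change η.symm ((η (coordShift η s' z.1)).1, (η (coordShift η s' z.1)).2 + s) =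
      η.symm ((η z.1).1, (η z.1).2 + (s + s'))
    rw [hval s' hs' _ hz.1]
    simp only [add_assoc, add_comm s' s]
  · have h1 : coordShift η s z.1 = coordShift η s z'.1 := (Prod.mk.inj h).1
    have h2 : z.2 = z'.2 := (Prod.mk.inj h).2
    have h3 := congrArg η h1
    rw [hval s hs _ hz.1, hval s hs _ hz'.1] at h3
    have h4 : (η z.1).1 = (η z'.1).1 := (Prod.mk.inj h3).1
    have h5 : (η z.1).2 = (η z'.1).2 := add_right_cancel (Prod.mk.inj h3).2
    exact Prod.ext (η.injOn hz.1.1 hz'.1.1 (Prod.ext h4 h5)) h2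
  · have hz1 : z.1 ∈ W := hz.1
    have hd : MDifferentiableAt (𝓡 2) (𝓡 2) (coordShift η s) z.1 :=
      ((hshift s hs).contMDiffAt (hW.mem_nhds hz1)).mdifferentiableAt (by simp)
    have hst : coordShift η s z.1 ∈ η.source := η.map_target (hmem s hs _ hz1)
    have hvec : ∀ X : TangentSpace (𝓡 2) z.1, coordVec (𝓡 2) η
        (mfderiv (𝓡 2) (𝓡 2) (coordShift η s) z.1 X) = coordVec (𝓡 2) η X := by
      intro X
      have h1 := mfderiv_comp z.1 (hη.coord.mdifferentiableAt hst) hd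
      have h2 : HasFDerivAt (fun a : ℝ × ℝ => (a.1, a.2 + s))
          ((ContinuousLinearMap.fst ℝ ℝ ℝ).prod (ContinuousLinearMap.snd ℝ ℝ ℝ)) (η z.1) :=
        hasFDerivAt_fst.prodMk (hasFDerivAt_snd.add_const s)
      have h3 := h2.hasMFDerivAt.comp z.1 (hη.coord.mdifferentiableAt hz1.1).hasMFDerivAt
      have h4 : η ∘ coordShift η s =ᶠ[𝓝 z.1] (fun a : ℝ × ℝ => (a.1, a.2 + s)) ∘ η := by
        filter_upwards [hW.mem_nhds hz1] with w hw using hval s hs w hw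
      exact DFunLike.congr_fun (h1.symm.trans (h4.mfderiv_eq.trans h3.mfderiv)) X
    have hiso : ∀ X Y : TangentSpace (𝓡 2) z.1, g.inner (coordShift η s z.1)
        (mfderiv (𝓡 2) (𝓡 2) (coordShift η s) z.1 X)
        (mfderiv (𝓡 2) (𝓡 2) (coordShift η s) z.1 Y) = g.inner z.1 X Y := by
      intro X Y
      refine (hη.eq _ hst _ _).trans (Eq.trans ?_ (hη.eq _ hz1.1 X Y).symm)
      -- A translation preserves coordinate components of vectors and the first coordinate, on which
      -- alone the metric depends.
      rw [hvec, hvec, hval s hs _ hz1]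
      rfl
    have h5 : HasMFDerivAt ((𝓡 2).prod 𝓘(ℝ, ℝ)) (𝓡 2) (coordShift η s ∘ Prod.fst) z _ :=
      hd.hasMFDerivAt.comp z (hasMFDerivAt_fst z)
    have h6 : HasMFDerivAt ((𝓡 2).prod 𝓘(ℝ, ℝ)) ((𝓡 2).prod 𝓘(ℝ, ℝ))
        (fun z : M × ℝ => (coordShift η s z.1, z.2)) z _ := h5.prodMk (hasMFDerivAt_snd z)
    rw [h6.mfderiv]
    exact congrArg (fun r : ℝ => r + X.2 * Y.2) (hiso X.1 Y.1)

/-- In the coordinates `η` the orbit of `p` is a straight line with velocity `(0, 1)`. -/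
theorem mfderiv_coordShift_ne_zero {η : OpenPartialHomeomorph M (ℝ × ℝ)}
    (hη : IsSmoothCoord (𝓡 2) η) {p : M} (hp : p ∈ η.source) :
    mfderiv 𝓘(ℝ, ℝ) (𝓡 2) (fun s => coordShift η s p) 0 (1 : ℝ) ≠ 0 := by
  have hc : HasDerivAt (fun s : ℝ => ((η p).1, (η p).2 + s)) ((0 : ℝ), (1 : ℝ)) 0 :=
    (hasDerivAt_const (0 : ℝ) (η p).1).prodMk ((hasDerivAt_id (0 : ℝ)).const_add (η p).2)
  have hc0 : ((η p).1, (η p).2 + (0 : ℝ)) = η p := by rw [add_zero]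
  have ht : ((η p).1, (η p).2 + (0 : ℝ)) ∈ η.target := by rw [hc0]; exact η.map_source hp
  have h1 : MDifferentiableAt 𝓘(ℝ, ℝ) (𝓡 2) (fun s => coordShift η s p) 0 :=
    (hη.mdifferentiableAt_symm ht).comp 0 hc.hasFDerivAt.hasMFDerivAt.mdifferentiableAt
  have hs : coordShift η 0 p ∈ η.source := η.map_target ht
  have h2 := mfderiv_comp 0 (hη.mdifferentiableAt hs) h1
  have h3 : η ∘ (fun s => coordShift η s p) =ᶠ[𝓝 0] fun s : ℝ => ((η p).1, (η p).2 + s) := by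
    filter_upwards [hc.continuousAt.preimage_mem_nhds (η.open_target.mem_nhds ht)] with s hs
    exact η.right_inv hs
  intro h0
  have h4 := DFunLike.congr_fun (h2.symm.trans (h3.mfderiv_eq.trans
    hc.hasFDerivAt.hasMFDerivAt.mfderiv)) (1 : ℝ)
  have h5 : coordVec (𝓡 2) η (mfderiv 𝓘(ℝ, ℝ) (𝓡 2) (fun s => coordShift η s p) 0 (1 : ℝ)) =
      ((1 : ℝ) • ((0 : ℝ), (1 : ℝ))) := h4
  rw [h0] at h5
  have h6 : (0 : ℝ × ℝ) = ((1 : ℝ) • ((0 : ℝ), (1 : ℝ))) := (map_zero _).symm.trans h5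
  simpa using congrArg Prod.snd h6

/-- An oblique totally umbilical surface is locally invariant under a one-parameter group of
isometries of the base. -/
theorem Hypersurface.isInvariantNear {I : Set ℝ} (hI : IsOpen I) {p : M} {t : ℝ}
    (F : Hypersurface.{u, v} 2 M I) (q : F.carrier) (humb : F.IsTotallyUmbilical g)
    (hobl : F.IsObliqueAt g q p t) : F.IsInvariantNear g q p := by
  obtain ⟨κ, G, χ, V, T, ρ, l, c, hpκ, hG, hpV, hVχ, hVκ, hχ, hχs, hχq, hχκ, hGV, hconf, hc, hh, -,
    hall⟩ := F.exists_isUnitConformal q humb hobl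
  obtain ⟨δ, hδ, e, f, hsrc, htgt, he, hes, he0, heT, hGr, hmet⟩ :=
    hconf.exists_revolution_coordinates hGV hpV
  have hη := hG.trans_symm he hes hGr hmet
  let η := κ.trans e.symm
  have hηt : η.target = e.source := by
    refine inter_eq_left.2 fun z hz => ?_
    exact hVκ (htgt (e.map_source hz))
  have heV : ∀ z ∈ e.source, e z ∈ V := fun z hz => htgt (e.map_source hz)
  have h0δ : (0 : ℝ) ∈ Ioo (-δ) δ := ⟨by linarith, hδ⟩
  have h00 : ((0 : ℝ), (0 : ℝ)) ∈ e.source := by rw [hsrc]; exact ⟨h0δ, h0δ⟩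
  have hpη : p ∈ η.source := ⟨hpκ, by
    change κ p ∈ e.target
    rw [← he0]; exact e.map_source h00⟩
  have hηp : η p = (0, 0) := by
    change e.symm (κ p) = _
    rw [← he0, e.left_inv h00]
  let ε := δ / 2
  have hε : 0 < ε := half_pos hδ
  have h0ε : (0 : ℝ) ∈ Ioo (-ε) ε := ⟨by linarith, hε⟩
  have h2ε : 2 * ε = δ := by simp only [ε]; ring
  have hgroup := isLocalIsometryGroup_coordShift hη hε (J := Ioo (-δ) δ)
    (by rw [h2ε, ← hsrc]; exact hηt) hI
  let W := η.source ∩ η ⁻¹' (univ ×ˢ Ioo (-ε) ε)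
  have hW : IsOpen W := η.continuousOn.isOpen_inter_preimage η.open_source
    (isOpen_univ.prod isOpen_Ioo)
  let h : EuclideanSpace ℝ (Fin 2) → ℝ := fun y => (F.map (χ y)).2
  -- the height function does not depend on the second coordinate
  have hheight : ∀ x ∈ Ioo (-δ) δ, ∀ u ∈ Ioo (-δ) δ, h (e (x, u)) = h (e (x, 0)) := by
    intro x hx u hu
    refine eqOn_Ioo_of_hasDerivAt_zero (f := fun u => h (e (x, u))) (fun u hu => ?_) hu
    have hz : (x, u) ∈ e.source := by rw [hsrc]; exact ⟨hx, hu⟩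
    have h1 : HasFDerivAt e (fderiv ℝ e (x, u)) (x, u) :=
      ((he.contDiffAt (e.open_source.mem_nhds hz)).differentiableAt (by simp)).hasFDerivAt
    have h2 : HasFDerivAt h (fderiv ℝ h (e (x, u))) (e (x, u)) :=
      ((hh.contDiffAt (χ.open_source.mem_nhds (hVχ (heV _ hz)))).differentiableAt
        (by simp)).hasFDerivAt
    have h3 : HasDerivAt (fun u : ℝ => (x, u)) ((0 : ℝ), (1 : ℝ)) u :=
      (hasDerivAt_const u x).prodMk (hasDerivAt_id u)
    have h4 := (h2.comp (x, u) h1).comp_hasDerivAt u h3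
    refine h4.congr_deriv ?_
    obtain ⟨h5, h6⟩ := hall _ (heV _ hz)
    have h7 := h6 (fderiv ℝ e (x, u) (0, 1))
    -- The coordinate vectors are orthogonal and the first one is `T`. As `dh` is a multiple of
    -- `G(T, ·)`, it vanishes on the second.
    have h8 := hmet _ hz (1, 0) (0, 1)
    rw [heT _ hz, warpedCoordMetric_apply] at h8
    rw [h8] at h7
    simp only [map_zero, zero_apply, mul_zero, add_zero] at h7
    exact (mul_eq_zero.1 h7).resolve_left (Real.sqrt_pos.2 h5).ne'
  -- Revolution coordinates on the surface itself. The lifted flow is translation of the second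
  -- coordinate here, compatible with `coordShift` since `η` of the projection is `τ.symm` (`hUη`)
  -- and the height is unchanged (`hheight`).
  let τ : OpenPartialHomeomorph (ℝ × ℝ) F.carrier := e.trans χ
  have hτs : ∀ z ∈ e.source, z ∈ τ.source := fun z hz => ⟨hz, hVχ (heV z hz)⟩
  have hτ : ContMDiffOn 𝓘(ℝ, ℝ × ℝ) (𝓡 2) ∞ τ τ.source :=
    hχ.comp (he.contMDiffOn.mono inter_subset_left) fun z hz => hz.2
  have hτsymm : ContMDiffOn (𝓡 2) 𝓘(ℝ, ℝ × ℝ) ∞ τ.symm τ.target := by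
    refine hes.contMDiffOn.comp (hχs.mono ?_) ?_
    · exact fun x hx => hx.1
    · exact fun x hx => hx.2
  have hFκ : ∀ z ∈ e.source, (F.map (τ z)).1 ∈ κ.source ∧ κ (F.map (τ z)).1 = e z := fun z hz =>
    hχκ (e z) (hVχ (heV z hz))
  let U := τ.target ∩ τ.symm ⁻¹' (univ ×ˢ Ioo (-ε) ε)
  have hU : IsOpen U := τ.symm.continuousOn.isOpen_inter_preimage τ.open_target
    (isOpen_univ.prod isOpen_Ioo)
  have hmem : ∀ s ∈ Ioo (-ε) ε, ∀ x ∈ U, ((τ.symm x).1, (τ.symm x).2 + s) ∈ e.source := by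
    intro s hs x hx
    have h1 : τ.symm x ∈ e.source := (τ.map_target hx.1).1
    have h2 := hx.2.2
    rw [hsrc] at h1 ⊢
    exact ⟨h1.1, by linarith [h2.1, hs.1, h2ε], by linarith [h2.2, hs.2, h2ε]⟩
  have hτ0 : τ (0, 0) = q := by
    change χ (e (0, 0)) = q
    rw [he0, hχq]
  have hUη : ∀ x ∈ U, (F.map x).1 ∈ η.source ∧ η (F.map x).1 = τ.symm x := by
    intro x hx
    have h1 : τ.symm x ∈ e.source := (τ.map_target hx.1).1
    obtain ⟨h2, h3⟩ := hFκ _ h1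
    rw [τ.right_inv hx.1] at h2 h3
    refine ⟨⟨h2, ?_⟩, ?_⟩
    · change κ (F.map x).1 ∈ e.target
      rw [h3]; exact e.map_source h1
    · change e.symm (κ (F.map x).1) = _
      rw [h3, e.left_inv h1]
  have hsh : ContDiff ℝ ∞ (fun a : (ℝ × ℝ) × ℝ => (a.1.1, a.1.2 + a.2)) := by fun_prop
  refine ⟨ε, W, coordShift η, hgroup, hW, ⟨hpη, ?_⟩, mfderiv_coordShift_ne_zero hη.coord hpη, U,
    fun s x => τ ((τ.symm x).1, (τ.symm x).2 + s), hU, ⟨?_, ?_⟩, fun x hx => ?_, ?_, fun x hx => ?_,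
    fun s hs x hx => ?_⟩
  · rw [mem_preimage, hηp]; exact ⟨mem_univ _, h0ε⟩
  · rw [← hτ0]; exact τ.map_source (hτs _ h00)
  · rw [mem_preimage, ← hτ0, τ.left_inv (hτs _ h00)]; exact ⟨mem_univ _, h0ε⟩
  · refine ⟨(hUη x hx).1, ?_⟩
    rw [mem_preimage, (hUη x hx).2]
    exact hx.2
  · have h1 : ContMDiffOn (𝓘(ℝ, ℝ).prod (𝓡 2)) 𝓘(ℝ, (ℝ × ℝ) × ℝ) ∞
        (fun a : ℝ × F.carrier => (τ.symm a.2, a.1)) (Ioo (-ε) ε ×ˢ U) :=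
      (hτsymm.comp contMDiff_snd.contMDiffOn fun a ha => ha.2.1).prodMk_space
        contMDiff_fst.contMDiffOn
    have h2 : ContMDiffOn (𝓘(ℝ, ℝ).prod (𝓡 2)) 𝓘(ℝ, ℝ × ℝ) ∞
        (fun a : ℝ × F.carrier => ((τ.symm a.2).1, (τ.symm a.2).2 + a.1)) (Ioo (-ε) ε ×ˢ U) :=
      hsh.contMDiff.comp_contMDiffOn h1
    exact hτ.comp h2 fun a ha => hτs _ (hmem _ ha.1 _ ha.2)
  · change τ ((τ.symm x).1, (τ.symm x).2 + 0) = x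
    rw [add_zero]
    exact τ.right_inv hx.1
  · have h1 := hmem s hs x hx
    obtain ⟨h2, h3⟩ := hFκ _ h1
    have h4 : τ.symm x ∈ e.source := (τ.map_target hx.1).1
    refine Prod.ext ?_ ?_
    · change (F.map (τ ((τ.symm x).1, (τ.symm x).2 + s))).1 =
        κ.symm (e ((η (F.map x).1).1, (η (F.map x).1).2 + s))
      rw [(hUη x hx).2, ← h3, κ.left_inv h2]
    · have h5 : (F.map x).2 = h (e (τ.symm x)) := by
        conv_lhs => rw [← τ.right_inv hx.1]
        rfl
      rw [h5]
      change h (e ((τ.symm x).1, (τ.symm x).2 + s)) = h (e ((τ.symm x).1, (τ.symm x).2))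
      rw [hsrc] at h1 h4
      rw [hheight _ h1.1 _ h1.2, hheight _ h4.1 _ h4.2]

end Surface
end

/-! ### The main theorem. -/

theorem theorem1 {n : ℕ} (hn : 1 ≤ n) {M : Type u} [TopologicalSpace M] [T2Space M]
    [SecondCountableTopology M] [ChartedSpace (EuclideanSpace ℝ (Fin n)) M]
    [IsManifold (𝓡 n) ∞ M] (g : SmoothMetric n M)
    (I : Set ℝ) (hI : IsOpen I) (hI' : I.OrdConnected) (p : M) (t : ℝ) (ht : t ∈ I) :
    -- existence of an oblique totally umbilical hypersurface through `(p, t)`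
    ((∃ (F : Hypersurface.{u, u} n M I) (q : F.carrier),
        F.IsTotallyUmbilical g ∧ F.IsObliqueAt g q p t) ↔
      Nonempty (WarpedProductNear.{u, 0} g p)) ∧
    -- every such hypersurface is generated by a profile curve
    (∀ (F : Hypersurface.{u, v} n M I) (q : F.carrier),
      F.IsTotallyUmbilical g → F.IsObliqueAt g q p t →
      ∃ (W : WarpedProductNear.{u, 0} g p) (c σ : ℝ) (A : Set ℝ) (x₀ x₁ : ℝ → ℝ),
        IsProfileCurve I W.J W.f c σ A x₀ x₁ ∧ F.IsGeneratedNear q W A x₀ x₁) ∧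
    -- every profile curve generates such a hypersurface
    (∀ (W : WarpedProductNear.{u, w} g p) (c σ : ℝ) (A : Set ℝ) (x₀ x₁ : ℝ → ℝ),
      IsProfileCurve I W.J W.f c σ A x₀ x₁ →
      IsSmoothImmersionOn (𝓘(ℝ, ℝ).prod (𝓡 (n - 1))) ((𝓡 n).prod 𝓘(ℝ, ℝ))
        (W.generated x₀ x₁) (A ×ˢ univ) ∧
      IsTotallyUmbilicalOn (𝓘(ℝ, ℝ).prod (𝓡 (n - 1))) (prodMetric g)
        (W.generated x₀ x₁) (A ×ˢ univ) ∧
      ∀ a ∈ A ×ˢ (univ : Set W.N),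
        ¬ IsVerticalAt n (𝓘(ℝ, ℝ).prod (𝓡 (n - 1))) (W.generated x₀ x₁) a ∧
        ¬ IsHorizontalAt (𝓘(ℝ, ℝ).prod (𝓡 (n - 1))) g (W.generated x₀ x₁) a) ∧
    -- surfaces
    (n = 2 →
      ((∃ (F : Hypersurface.{u, u} n M I) (q : F.carrier),
          F.IsTotallyUmbilical g ∧ F.IsObliqueAt g q p t) ↔
        ∃ (W : Set M) (K : ∀ x : M, TangentSpace (𝓡 n) x), IsOpen W ∧ p ∈ W ∧
          IsKillingOn (metricField g) K W ∧ ∀ x ∈ W, K x ≠ 0) ∧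
      ∀ (F : Hypersurface.{u, v} n M I) (q : F.carrier),
        F.IsTotallyUmbilical g → F.IsObliqueAt g q p t → F.IsInvariantNear g q p) := by
  refine ⟨⟨fun ⟨F, q, hF, hq⟩ => ?_, fun ⟨W⟩ => W.exists_hypersurface hI ht⟩,
    fun F q hF hq => F.exists_isGeneratedNear hn q hF hq,
    fun W c σ A x₀ x₁ h => ⟨W.isSmoothImmersionOn_generated h,
      W.isTotallyUmbilicalOn_generated h, fun a ha =>
        ⟨W.not_isVerticalAt_generated h ha.1, W.not_isHorizontalAt_generated h ha.1⟩⟩, ?_⟩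
  · obtain ⟨W, -⟩ := F.exists_isGeneratedNear hn q hF hq
    exact ⟨W⟩
  · rintro rfl
    refine ⟨⟨fun ⟨F, q, hF, hq⟩ => F.exists_isKillingOn q hF hq, ?_⟩,
      fun F q hF hq => F.isInvariantNear hI q hF hq⟩
    rintro ⟨W, K, hW, hp, hK, hK0⟩
    -- Turning the Killing field by a right angle produces a warped product structure, and existence
    -- then follows as in the general case.
    obtain ⟨W'⟩ := hK.nonempty_warpedProductNear hW hp hK0
    exact W'.exists_hypersurface hI ht
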